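/- **Setting.** Let $k\ge 4$ be an integer, $\mathcal N$ an odd square-free positive integer, $q$ a prime dividing $\mathcal N$, and $\chi$ a Dirichlet character modulo $\mathcal N$ with $\chi^2=1$ and $\chi(-1)=(-1)^k$. For $d\mid\mathcal N$ let $\chi_d$ be the $d$-component of $\chi$: the Dirichlet character modulo $d$ with $\chi_d(x)=\chi(y)$ whenever $y\equiv x\ (d)$ and $y\equiv 1\ (\mathcal N/d)$. Let $\mathcal H_2$ be the Siegel upper half-space of degree $2$. Put $$\Gamma_\infty=\Big\{\begin{pmatrix}A&B\\ C&D\end{pmatrix}\in Sp_2(\mathbb Z): C=0\Big\},\qquad \Gamma_0(n)=\Big\{\begin{pmatrix}A&B\\ C&D\end{pmatrix}\in Sp_2(\mathbb Z): C\equiv 0\ (n)\Big\},$$ where $Sp_2(\mathbb Z)$ is the group of integral symplectic $4\times4$ matrices, written in $2\times 2$ blocks. For $n\in\{\mathcal N,q\mathcal N\}$ and a diagonal integral $2\times2$ matrix $M$, put $\gamma_M=\begin{pmatrix}I&0\\ M&I\end{pmatrix}$. The Eisenstein series of weight $k$, level $n$ and character $\chi$ attached to $M$ is $$\mathbb E^{(n)}_M(\tau)=\sum_{\gamma}\overline\chi(\det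 D_\gamma)\,\det\big(C_{\gamma_M\gamma}\tau+D_{\gamma_M\gamma}\big)^{-k}\qquad(\tau\in\mathcal H_2),$$ where $\gamma$ runs through elements of $\Gamma_0(n)$ such that $\Gamma_\infty\gamma_M\gamma$ runs once through each coset in the $\Gamma_0(n)$-orbit of $\Gamma_\infty\gamma_M$; the summand does not depend on the choice of $\gamma$ for a given coset. Let $\mathcal N_0\mathcal N_1\mathcal N_2=\mathcal N/q$ with positive integers $\mathcal N_i$, and let $\omega$ be an integer with $\left(\frac{\omega}{q}\right)=-1$. Say that a diagonal integral matrix $M$ has type $\sigma$ if, for each prime $p\mid\mathcal N/q$, modulo $p$ it is $0$, $\mathrm{diag}(1,0)$ or $I$ according as $p\mid\mathcal N_0$, $p\mid\mathcal N_1$ or $p\mid\mathcal N_2$. * For $i=0,1,2$, let $M_i$ be of type $\sigma$ with $M_i\equiv 0,\ \mathrm{diag}(1,0),\ I\ (q)$ respectively, and put $\mathbb E_i=\mathbb E^{(\mathcal N)}_{M_i}$. * Let $M_{0,0},\ M_{0,1,+},\ M_{0,1,-},\ M_{0,2,\alpha}\ (\alpha\in(\mathbb Z/q\mathbb Z)^\times),\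 M_{1,1},\ M_{1,2,+},\ M_{1,2,-}$ be of type $\sigma$ and congruent modulo $q^2$, respectively, to $0$, $\mathrm{diag}(q,0)$, $\mathrm{diag}(q\omega,0)$, $\mathrm{diag}(q,q\alpha)$, $\mathrm{diag}(1,0)$, $\mathrm{diag}(1,q)$, $\mathrm{diag}(1,q\omega)$. For each of these indices put $\mathbb E_*=\mathbb E^{(q\mathcal N)}_{M_*}$. Put $\mathbb E_{0,2,\pm}=\sum_{\left(\frac{\alpha}{q}\right)=\pm1}\mathbb E_{0,2,\alpha}$ and $\mathbb E_{0,1}=\mathbb E_{0,1,+}+\mathbb E_{0,1,-}$, $\mathbb E_{0,2}=\mathbb E_{0,2,+}+\mathbb E_{0,2,-}$, $\mathbb E_{1,2}=\mathbb E_{1,2,+}+\mathbb E_{1,2,-}$. Let $B(q)$ be the shift operator $f|B(q)(\tau)=f(q\tau)$. **Proposition 5.2.** For every $\gamma_0\in Sp_2(\mathbb Z)$ and $n\in\{\mathcal N,q\mathcal N\}$ the Eisenstein series defined as above, with $\gamma_0$ in place of $\gamma_M$ and with any choice of representatives, converges absolutely on $\mathcal H_2$, and the following identities hold on $\mathcal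 H_2$. If $\chi_q\ne1$, then $$\begin{aligned} \mathbb E_0|B(q)&=\chi_{\mathcal N_1}(q)\,\mathbb E_{0,0},\\ \mathbb E_1|B(q)&=\chi_{\mathcal N_0\mathcal N_2}(q)\,q^{-k}\,\mathbb E_{1,1}+\chi_{\mathcal N_1}(q)\,(\mathbb E_{0,1,+}-\mathbb E_{0,1,-}),\\ \mathbb E_2|B(q)&=\chi_{\mathcal N_1}(q)\,q^{-2k}\,\mathbb E_2+\chi_{\mathcal N_0\mathcal N_2}(q)\,q^{-k}\,(\mathbb E_{1,2,+}-\mathbb E_{1,2,-})+\chi_{\mathcal N_1}(q)\,(\mathbb E_{0,2,+}-\mathbb E_{0,2,-}). \end{aligned}$$ If $\chi_q=1$, then $$\begin{aligned} \mathbb E_0|B(q)&=\chi_{\mathcal N_1}(q)\,\mathbb E_{0,0},\\ \mathbb E_1|B(q)&=\chi_{\mathcal N_0\mathcal N_2}(q)\,q^{-k}\,\mathbb E_{1,1}+\chi_{\mathcal N_1}(q)\,\mathbb E_{0,1},\\ \mathbb E_2|B(q)&=\chi_{\mathcal N_1}(q)\,q^{-2k}\,\mathbb E_2+\chi_{\mathcal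 N_0\mathcal N_2}(q)\,q^{-k}\,\mathbb E_{1,2}+\chi_{\mathcal N_1}(q)\,\mathbb E_{0,2}. \end{aligned}$$ -/

import Mathlib

open Matrix

namespace SiegelEisenstein

/-- The symplectic group of `4 × 4` integral matrices, with `2 × 2` blocks `A, B, C, D`. -/
abbrev Sp2Z := symplecticGroup (Fin 2) ℤ

/-- The Siegel upper half-space of degree 2. -/
def upperHalfSpace : Set (Matrix (Fin 2) (Fin 2) ℂ) :=
  {τ | τ.IsSymm ∧ (τ.map Complex.im).PosDef}

/-- The lower left block of a symplectic matrix. -/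
def blockC (γ : Sp2Z) : Matrix (Fin 2) (Fin 2) ℤ :=
  (γ : Matrix (Fin 2 ⊕ Fin 2) (Fin 2 ⊕ Fin 2) ℤ).toBlocks₂₁

/-- The lower right block of a symplectic matrix. -/
def blockD (γ : Sp2Z) : Matrix (Fin 2) (Fin 2) ℤ :=
  (γ : Matrix (Fin 2 ⊕ Fin 2) (Fin 2 ⊕ Fin 2) ℤ).toBlocks₂₂

/-- The upper left block of a symplectic matrix. -/
def blockA (γ : Sp2Z) : Matrix (Fin 2) (Fin 2) ℤ :=
  (γ : Matrix (Fin 2 ⊕ Fin 2) (Fin 2 ⊕ Fin 2) ℤ).toBlocks₁₁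

/-- The upper right block of a symplectic matrix. -/
def blockB (γ : Sp2Z) : Matrix (Fin 2) (Fin 2) ℤ :=
  (γ : Matrix (Fin 2 ⊕ Fin 2) (Fin 2 ⊕ Fin 2) ℤ).toBlocks₁₂

theorem eq_fromBlocks (γ : Sp2Z) :
    (γ : Matrix (Fin 2 ⊕ Fin 2) (Fin 2 ⊕ Fin 2) ℤ) =
      fromBlocks (blockA γ) (blockB γ) (blockC γ) (blockD γ) :=
  (fromBlocks_toBlocks _).symm

theorem blockC_mul (γ δ : Sp2Z) :
    blockC (γ * δ) = blockC γ * blockA δ + blockD γ * blockC δ := by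
  have h : ((γ * δ : Sp2Z) : Matrix (Fin 2 ⊕ Fin 2) (Fin 2 ⊕ Fin 2) ℤ) =
      (γ : Matrix (Fin 2 ⊕ Fin 2) (Fin 2 ⊕ Fin 2) ℤ) * δ := rfl
  rw [blockC, h, eq_fromBlocks γ, eq_fromBlocks δ, fromBlocks_multiply, toBlocks_fromBlocks₂₁]

theorem blockD_mul (γ δ : Sp2Z) :
    blockD (γ * δ) = blockC γ * blockB δ + blockD γ * blockD δ := by
  have h : ((γ * δ : Sp2Z) : Matrix (Fin 2 ⊕ Fin 2) (Fin 2 ⊕ Fin 2) ℤ) =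
      (γ : Matrix (Fin 2 ⊕ Fin 2) (Fin 2 ⊕ Fin 2) ℤ) * δ := rfl
  rw [blockD, h, eq_fromBlocks γ, eq_fromBlocks δ, fromBlocks_multiply, toBlocks_fromBlocks₂₂]

theorem blockC_inv (γ : Sp2Z) : blockC γ⁻¹ = -(blockC γ)ᵀ := by
  rw [blockC, SymplecticGroup.coe_inv, eq_fromBlocks γ, J, fromBlocks_transpose, fromBlocks_neg,
    fromBlocks_multiply, fromBlocks_multiply, toBlocks_fromBlocks₂₁]
  simp

theorem blockC_one : blockC 1 = 0 := by
  ext i j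
  simp [blockC, toBlocks₂₁]

/-- `Γ₀(n)`: the integral symplectic matrices whose lower left block is divisible by `n`. -/
def Gamma0 (n : ℕ) : Subgroup Sp2Z where
  carrier := {γ | ∀ i j, (n : ℤ) ∣ blockC γ i j}
  mul_mem' := by
    intro a b ha hb i j
    rw [blockC_mul, Matrix.add_apply, Matrix.mul_apply, Matrix.mul_apply]
    exact dvd_add (Finset.dvd_sum fun x _ => (ha i x).mul_right _)
      (Finset.dvd_sum fun x _ => (hb x j).mul_left _)
  one_mem' := by
    intro i j
    rw [blockC_one]
    exact dvd_zero _
  inv_mem' := by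
    intro a ha i j
    rw [blockC_inv]
    exact (ha j i).neg_right

/-- `Γ_∞`: the integral symplectic matrices whose lower left block is zero. -/
def GammaInf : Subgroup Sp2Z where
  carrier := {γ | blockC γ = 0}
  mul_mem' := by
    intro a b ha hb
    have ha' : blockC a = 0 := ha
    have hb' : blockC b = 0 := hb
    change blockC (a * b) = 0
    rw [blockC_mul, ha', hb', Matrix.zero_mul, Matrix.mul_zero, add_zero]
  one_mem' := blockC_one
  inv_mem' := by
    intro a ha
    have ha' : blockC a = 0 := ha
    change blockC a⁻¹ = 0
    rw [blockC_inv, ha', Matrix.transpose_zero, neg_zero]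

/-- `1|γ (τ) = det(Cτ + D)^{-k}`. -/
noncomputable def oneSlash (k : ℕ) (γ : Sp2Z) (τ : Matrix (Fin 2) (Fin 2) ℂ) : ℂ :=
  (((blockC γ).map (Int.cast : ℤ → ℂ) * τ + (blockD γ).map (Int.cast : ℤ → ℂ)).det ^ k)⁻¹

/-- `γ ∼ γ'` in `Γ₀(n)` when `Γ_∞ γ₀ γ = Γ_∞ γ₀ γ'`; the classes are therefore the cosets
`Γ_∞ γ₀ γ` in the `Γ₀(n)`-orbit of `Γ_∞ γ₀`. -/
def orbitSetoid (n : ℕ) (γ₀ : Sp2Z) : Setoid (Gamma0 n) :=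
  (QuotientGroup.rightRel GammaInf).comap (fun γ : Gamma0 n => γ₀ * (γ : Sp2Z))

/-- The summand `conj (χ (det D_γ)) · 1|γ₀γ (τ)` attached to `γ ∈ Γ₀(n)`. -/
noncomputable def summand {N : ℕ} (k : ℕ) (χ : DirichletCharacter ℂ N) (n : ℕ) (γ₀ : Sp2Z)
    (τ : Matrix (Fin 2) (Fin 2) ℂ) (γ : Gamma0 n) : ℂ :=
  star (χ (((blockD (γ : Sp2Z)).det : ℤ) : ZMod N)) * oneSlash k (γ₀ * (γ : Sp2Z)) τ

/-- The summand attached to a coset in the `Γ₀(n)`-orbit of `Γ_∞ γ₀`, computed with a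
representative.  In the setting of use it does not depend on the representative, see
`summand_eq_of_rel` below. -/
noncomputable def cosetSummand {N : ℕ} (k : ℕ) (χ : DirichletCharacter ℂ N) (n : ℕ) (γ₀ : Sp2Z)
    (τ : Matrix (Fin 2) (Fin 2) ℂ) (c : Quotient (orbitSetoid n γ₀)) : ℂ :=
  summand k χ n γ₀ τ c.out

/-- The degree 2 Siegel Eisenstein series of weight `k`, level `n` and character `χ` (a character
modulo `N`, where `N ∣ n`), supported on the `Γ₀(n)`-orbit of `Γ_∞ γ₀`. -/
noncomputable def siegelEisenstein {N : ℕ} (k : ℕ) (χ : DirichletCharacter ℂ N) (n : ℕ)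
    (γ₀ : Sp2Z) (τ : Matrix (Fin 2) (Fin 2) ℂ) : ℂ :=
  ∑' c : Quotient (orbitSetoid n γ₀), cosetSummand k χ n γ₀ τ c

/-- The symplectic matrix with blocks `A = I`, `B = 0`, `C = diag(m 0, m 1)`, `D = I`. -/
def lowerUnipotent (m : Fin 2 → ℤ) : Sp2Z :=
  ⟨fromBlocks 1 0 (diagonal m) 1, by
    rw [SymplecticGroup.fromBlocks_mem_iff]
    simp⟩

/-- The shift operator: `f|B(q) (τ) = f(qτ)`. -/
def shift (q : ℕ) (f : Matrix (Fin 2) (Fin 2) ℂ → ℂ) (τ : Matrix (Fin 2) (Fin 2) ℂ) : ℂ :=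
  f ((q : ℂ) • τ)

/-- `diag(m 0, m 1) ≡ diag(m' 0, m' 1)` modulo `n`. -/
def DiagModEq (n : ℕ) (m m' : Fin 2 → ℤ) : Prop :=
  ∀ i, m i ≡ m' i [ZMOD n]

/-- The diagonal matrix `diag(m 0, m 1)` is a matrix `M_ρ` for `ρ = (N₀, N₁, N₂)`: modulo each
prime `p` it is `0` if `p ∣ N₀`, `diag(1, 0)` if `p ∣ N₁`, and the identity if `p ∣ N₂`. -/
def IsTypeMatrix (N₀ N₁ N₂ : ℕ) (m : Fin 2 → ℤ) : Prop :=
  ∀ p : ℕ, p.Prime →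
    (p ∣ N₀ → DiagModEq p m ![0, 0]) ∧
    (p ∣ N₁ → DiagModEq p m ![1, 0]) ∧
    (p ∣ N₂ → DiagModEq p m ![1, 1])

open Classical in
/-- For `d ∣ N` with `d` and `N / d` coprime, the component `χ_d` modulo `d` of a character `χ`
modulo `N`: on units, `χ_d (x) = χ (y)` where `y ≡ x` modulo `d` and `y ≡ 1` modulo `N / d`.
(For other `d` the value is the trivial character.) -/
noncomputable def component {N : ℕ} (χ : DirichletCharacter ℂ N) (d : ℕ) :
    DirichletCharacter ℂ d :=
  if h : d ∣ N ∧ d.Coprime (N / d) then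
    MulChar.ofUnitHom <| χ.toUnitHom.comp <|
      (Units.map (ZMod.castHom (Nat.mul_div_cancel' h.1).symm.dvd (ZMod N)).toMonoidHom).comp <|
      (Units.mapEquiv (ZMod.chineseRemainder h.2).symm.toMulEquiv).toMonoidHom.comp <|
      MulEquiv.prodUnits.symm.toMonoidHom.comp <|
      MonoidHom.inl (ZMod d)ˣ (ZMod (N / d))ˣ
  else 1

/-- A unit which is a square modulo every prime divisor of a square-free `N` is a square
modulo `N`. -/
theorem isSquare_of_forall_prime {N : ℕ} (hN : Squarefree N) (u : ℤ)
    (h : ∀ p : ℕ, p.Prime → p ∣ N → IsSquare (u : ZMod p)) : IsSquare (u : ZMod N) := by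
  induction N using Nat.recOnPosPrimePosCoprime with
  | zero => exact absurd hN not_squarefree_zero
  | one => exact ⟨0, Subsingleton.elim (α := ZMod 1) _ _⟩
  | prime_pow p n hp hn =>
    have : n = 1 := by
      rcases (Nat.squarefree_pow_iff hp.ne_one hn.ne').1 hN with ⟨-, h1⟩
      exact h1
    subst this
    rw [pow_one]
    exact h p hp (by simp)
  | coprime a b ha hb hab iha ihb =>
    obtain ⟨x, hx⟩ := iha (hN.squarefree_of_dvd (Dvd.intro _ rfl))
      fun p hp hpa => h p hp (hpa.mul_right _)
    obtain ⟨y, hy⟩ := ihb (hN.squarefree_of_dvd (Dvd.intro_left _ rfl))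
      fun p hp hpb => h p hp (hpb.mul_left _)
    refine ⟨(ZMod.chineseRemainder hab).symm (x, y), ?_⟩
    apply (ZMod.chineseRemainder hab).injective
    rw [map_mul, RingEquiv.apply_symm_apply, map_intCast]
    exact Prod.ext hx hy

/-- If `diag(a, b)` over a field is carried to itself by left multiplication by `E⁻¹` and right
multiplication by `A`, then `det D · det E` is a square, where `D` is the lower right block. -/
theorem isSquare_of_field {F : Type*} [Field F] (a b : F) (A B D E : Matrix (Fin 2) (Fin 2) F)
    (h1 : diagonal ![a, b] * A = E * diagonal ![a, b]) (h2 : diagonal ![a, b] * B + D = E)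
    (h3 : A.det * D.det = 1) (h5 : A * Dᵀ = 1) :
    IsSquare (D.det * E.det) := by
  by_cases hab : a * b = 0
  · have e := fun i j => congrFun (congrFun h1 i) j
    have f := fun i j => congrFun (congrFun h2 i) j
    have g := fun i => congrFun (congrFun h5 i) i
    simp only [Matrix.mul_apply, Fin.sum_univ_two, Matrix.add_apply, Matrix.diagonal_apply,
      Matrix.transpose_apply, Matrix.one_apply] at e f g
    have e00 := e 0 0
    have e01 := e 0 1
    have e10 := e 1 0
    have e11 := e 1 1
    have f00 := f 0 0
    have f01 := f 0 1
    have f10 := f 1 0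
    have f11 := f 1 1
    have g0 := g 0
    have g1 := g 1
    clear e f g h1 h2 h3 h5
    simp at e00 e01 e10 e11 f00 f01 f10 f11 g0 g1
    simp only [Matrix.det_fin_two]
    by_cases ha : a = 0
    · by_cases hb : b = 0
      · subst ha hb
        simp only [zero_mul, zero_add] at f00 f01 f10 f11
        rw [f00, f01, f10, f11]
        exact ⟨_, rfl⟩
      · subst ha
        have h10 : A 1 0 = 0 := by
          apply mul_left_cancel₀ hb
          linear_combination e10
        have k01 : E 0 1 = 0 := by
          apply mul_right_cancel₀ hb
          linear_combination -e01
        have h11 : A 1 1 = E 1 1 := by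
          apply mul_left_cancel₀ hb
          linear_combination e11
        simp only [zero_mul, zero_add] at f00 f01
        rw [h10, h11] at g1
        refine ⟨E 0 0, ?_⟩
        rw [f00, f01, k01]
        linear_combination (E 0 0) ^ 2 * g1
    · have hb : b = 0 := (mul_eq_zero.1 hab).resolve_left ha
      subst hb
      have h01 : A 0 1 = 0 := by
        apply mul_left_cancel₀ ha
        linear_combination e01
      have k10 : E 1 0 = 0 := by
        apply mul_right_cancel₀ ha
        linear_combination -e10
      have h00 : A 0 0 = E 0 0 := by
        apply mul_left_cancel₀ ha
        linear_combination e00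
      simp only [zero_mul, zero_add] at f10 f11
      rw [h01, h00] at g0
      refine ⟨E 1 1, ?_⟩
      rw [f10, f11, k10]
      linear_combination (E 1 1) ^ 2 * g0
  · have h := congrArg Matrix.det h1
    rw [Matrix.det_mul, Matrix.det_mul, Matrix.det_diagonal, Fin.prod_univ_two] at h
    have h' : A.det = E.det := by
      apply mul_left_cancel₀ hab
      simp only [Matrix.cons_val_zero, Matrix.cons_val_one] at h
      linear_combination h
    refine ⟨1, ?_⟩
    rw [← h', mul_comm, h3, one_mul]

theorem blockA_mul_blockD_transpose (γ : Sp2Z) :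
    blockA γ * (blockD γ)ᵀ - blockB γ * (blockC γ)ᵀ = 1 := by
  have h := SymplecticGroup.mem_iff.1 γ.2
  rw [eq_fromBlocks γ, J, fromBlocks_transpose, fromBlocks_multiply, fromBlocks_multiply] at h
  have h' := congrArg Matrix.toBlocks₁₂ h
  simp only [toBlocks_fromBlocks₁₂] at h'
  simp only [Matrix.mul_zero, Matrix.mul_one, Matrix.mul_neg, zero_add, add_zero,
    Matrix.neg_mul] at h'
  rw [← neg_inj, ← h']
  abel

theorem map_cast_mul (R : Type*) [CommRing R] (X Y : Matrix (Fin 2) (Fin 2) ℤ) :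
    (X * Y).map (Int.cast : ℤ → R) = X.map (Int.cast : ℤ → R) * Y.map (Int.cast : ℤ → R) :=
  Matrix.map_mul (f := Int.castRingHom R)

theorem map_cast_add (R : Type*) [CommRing R] (X Y : Matrix (Fin 2) (Fin 2) ℤ) :
    (X + Y).map (Int.cast : ℤ → R) = X.map (Int.cast : ℤ → R) + Y.map (Int.cast : ℤ → R) :=
  Matrix.map_add _ (fun _ _ => Int.cast_add _ _) X Y

theorem map_cast_det (R : Type*) [CommRing R] (X : Matrix (Fin 2) (Fin 2) ℤ) :
    ((X.det : ℤ) : R) = (X.map (Int.cast : ℤ → R)).det :=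
  (Int.castRingHom R).map_det X

theorem map_cast_blockC {n p : ℕ} (hp : p ∣ n) (γ : Gamma0 n) :
    (blockC (γ : Sp2Z)).map (Int.cast : ℤ → ZMod p) = 0 := by
  ext i j
  rw [Matrix.map_apply, Matrix.zero_apply, ZMod.intCast_zmod_eq_zero_iff_dvd]
  exact (Int.natCast_dvd_natCast.2 hp).trans (γ.2 i j)

theorem map_cast_blockA_mul {n p : ℕ} (hp : p ∣ n) (γ : Gamma0 n) :
    (blockA (γ : Sp2Z)).map (Int.cast : ℤ → ZMod p) *
      ((blockD (γ : Sp2Z)).map (Int.cast : ℤ → ZMod p))ᵀ = 1 := by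
  have h := congrArg (fun X => X.map (Int.cast : ℤ → ZMod p)) (eq_add_of_sub_eq
      (blockA_mul_blockD_transpose (γ : Sp2Z)))
  simpa only [map_cast_add, map_cast_mul, Matrix.transpose_map, map_cast_blockC hp γ,
    Matrix.transpose_zero, Matrix.mul_zero, add_zero,
    Matrix.map_one _ Int.cast_zero Int.cast_one] using h

theorem map_cast_det_mul {n p : ℕ} (hp : p ∣ n) (γ : Gamma0 n) :
    ((blockA (γ : Sp2Z)).map (Int.cast : ℤ → ZMod p)).det *
      ((blockD (γ : Sp2Z)).map (Int.cast : ℤ → ZMod p)).det = 1 := by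
  rw [← Matrix.det_transpose (Matrix.map (blockD (γ : Sp2Z)) _), ← Matrix.det_mul,
    map_cast_blockA_mul hp, Matrix.det_one]

theorem oneSlash_mul {k : ℕ} {δ : Sp2Z} (hδ : δ ∈ GammaInf) (g : Sp2Z)
    (τ : Matrix (Fin 2) (Fin 2) ℂ) :
    oneSlash k (δ * g) τ = ((((blockD δ).det : ℤ) : ℂ) ^ k)⁻¹ * oneSlash k g τ := by
  have hδC : blockC δ = 0 := hδ
  rw [oneSlash, oneSlash, blockC_mul, blockD_mul, hδC, ← mul_inv, ← mul_pow, map_cast_det,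
    ← Matrix.det_mul, Matrix.mul_add, ← Matrix.mul_assoc]
  simp only [Matrix.zero_mul, zero_add, map_cast_mul]

theorem blockD_det_mul {N n : ℕ} (hn : N ∣ n) (γ γ' : Gamma0 n) :
    (((blockD ((γ * γ' : Gamma0 n) : Sp2Z)).det : ℤ) : ZMod N) =
      (((blockD (γ : Sp2Z)).det : ℤ) : ZMod N) * (((blockD (γ' : Sp2Z)).det : ℤ) : ZMod N) := by
  rw [Subgroup.coe_mul, blockD_mul, map_cast_det, map_cast_add, map_cast_mul, map_cast_mul,
    map_cast_blockC hn γ, Matrix.zero_mul, zero_add, Matrix.det_mul, map_cast_det, map_cast_det]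

/-- For `N` square-free and `χ` quadratic with `χ(-1) = (-1)^k`, the summand depends only on the
coset `Γ_∞ γ₀ γ`. -/
theorem summand_eq_of_rel {N : ℕ} (hN : Squarefree N) {k : ℕ} {χ : DirichletCharacter ℂ N}
    (hχ : χ ^ 2 = 1) (hχk : χ (-1) = (-1) ^ k) {n : ℕ} (hn : N ∣ n) (m : Fin 2 → ℤ)
    (τ : Matrix (Fin 2) (Fin 2) ℂ) (γ γ' : Gamma0 n)
    (h : (orbitSetoid n (lowerUnipotent m)) γ γ') :
    summand k χ n (lowerUnipotent m) τ γ = summand k χ n (lowerUnipotent m) τ γ' := by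
  have hrel := QuotientGroup.rightRel_apply.1 h
  obtain ⟨δ, hδ⟩ : ∃ δ : Sp2Z, δ = lowerUnipotent m * (γ' : Sp2Z) *
    (lowerUnipotent m * (γ : Sp2Z))⁻¹ := ⟨_, rfl⟩
  have hδI : δ ∈ GammaInf := hδ ▸ hrel
  have hδC : blockC δ = 0 := hδI
  have hδg : lowerUnipotent m * (γ' : Sp2Z) = δ * (lowerUnipotent m * (γ : Sp2Z)) := by
    rw [hδ, inv_mul_cancel_right]
  have hdet : (blockA δ).det * (blockD δ).det = 1 := by
    have := blockA_mul_blockD_transpose δ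
    rw [hδC, Matrix.transpose_zero, Matrix.mul_zero, sub_zero] at this
    rw [← Matrix.det_transpose (blockD δ), ← Matrix.det_mul, this, Matrix.det_one]
  obtain ⟨η, hη'⟩ : ∃ η : Gamma0 n, η = γ' * γ⁻¹ := ⟨_, rfl⟩
  have hη : lowerUnipotent m * (η : Sp2Z) = δ * lowerUnipotent m := by
    rw [hδ, hη']
    simp only [Subgroup.coe_mul, Subgroup.coe_inv]
    group
  have hγ' : γ' = η * γ := by rw [hη', inv_mul_cancel_right]
  have hC := congrArg blockC hη
  have hD := congrArg blockD hη
  have gA : blockA (lowerUnipotent m) = 1 := toBlocks_fromBlocks₁₁ _ _ _ _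
  have gB : blockB (lowerUnipotent m) = 0 := toBlocks_fromBlocks₁₂ _ _ _ _
  have gC : blockC (lowerUnipotent m) = diagonal m := toBlocks_fromBlocks₂₁ _ _ _ _
  have gD : blockD (lowerUnipotent m) = 1 := toBlocks_fromBlocks₂₂ _ _ _ _
  rw [blockC_mul, blockC_mul, hδC, gC, gD, Matrix.one_mul, Matrix.zero_mul, zero_add] at hC
  rw [blockD_mul, blockD_mul, hδC, gC, gD, Matrix.one_mul, Matrix.zero_mul, zero_add,
    Matrix.mul_one] at hD
  have hsq : IsSquare (((blockD (η : Sp2Z)).det * (blockD δ).det : ℤ) : ZMod N) := by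
    apply isSquare_of_forall_prime hN
    intro p hp hpN
    have := Fact.mk hp
    have hdiag : (diagonal m).map (Int.cast : ℤ → ZMod p) =
        diagonal ![(m 0 : ZMod p), (m 1 : ZMod p)] := by
      ext i j
      fin_cases i <;> fin_cases j <;> simp [Matrix.diagonal]
    have h0 := map_cast_blockC (hpN.trans hn) η
    have hC' := congrArg (fun X => X.map (Int.cast : ℤ → ZMod p)) hC
    have hD' := congrArg (fun X => X.map (Int.cast : ℤ → ZMod p)) hD
    have hA' := map_cast_blockA_mul (hpN.trans hn) η
    simp only [map_cast_add, map_cast_mul, hdiag, h0, add_zero] at hC' hD'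
    rw [Int.cast_mul, map_cast_det, map_cast_det]
    refine isSquare_of_field _ _ _ _ _ _ hC' hD'
      (map_cast_det_mul (hpN.trans hn) η) hA'
  obtain ⟨s, hs⟩ := hsq
  have hε : (blockD δ).det = 1 ∨ (blockD δ).det = -1 :=
    Int.isUnit_iff.1 (IsUnit.of_mul_eq_one_right _ hdet)
  have hχη : χ (((blockD (η : Sp2Z)).det : ℤ) : ZMod N) * χ (((blockD δ).det : ℤ) : ZMod N) = 1 := by
    have hu : IsUnit (((blockD (η : Sp2Z)).det * (blockD δ).det : ℤ) : ZMod N) := by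
      rw [Int.cast_mul]
      refine IsUnit.mul ?_ ((IsUnit.of_mul_eq_one_right _ hdet).map (Int.castRingHom (ZMod N)))
      rw [map_cast_det]
      exact IsUnit.of_mul_eq_one_right _ (map_cast_det_mul hn η)
    rw [hs] at hu
    rw [← map_mul, ← Int.cast_mul, hs, map_mul, ← pow_two, ← MulChar.pow_apply' χ two_ne_zero, hχ,
      MulChar.one_apply (isUnit_of_mul_isUnit_left hu)]
  have hχδ : χ (((blockD δ).det : ℤ) : ZMod N) = (((blockD δ).det : ℤ) : ℂ) ^ k := by
    rcases hε with h1 | h1 <;> simp [h1, hχk]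
  have hδ2 : (((blockD δ).det : ℤ) : ℂ) ^ k * (((blockD δ).det : ℤ) : ℂ) ^ k = 1 := by
    rw [← mul_pow]
    rcases hε with h1 | h1 <;> simp [h1]
  have hχη' : χ (((blockD (η : Sp2Z)).det : ℤ) : ZMod N) = (((blockD δ).det : ℤ) : ℂ) ^ k := by
    rw [hχδ] at hχη
    linear_combination (((blockD δ).det : ℤ) : ℂ) ^ k * hχη -
      χ (((blockD (η : Sp2Z)).det : ℤ) : ZMod N) * hδ2
  have hstar : star ((((blockD δ).det : ℤ) : ℂ) ^ k) = (((blockD δ).det : ℤ) : ℂ) ^ k := by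
    simp
  have hne : (((blockD δ).det : ℤ) : ℂ) ^ k ≠ 0 := left_ne_zero_of_mul_eq_one hδ2
  rw [summand, summand, hδg, oneSlash_mul hδI, hγ', blockD_det_mul hn, map_mul, hχη', star_mul',
    hstar]
  field_simp

/-- The defining property of `χ_d`. -/
theorem component_apply {N : ℕ} (χ : DirichletCharacter ℂ N) {d : ℕ} (hd : d ∣ N)
    (hc : d.Coprime (N / d)) (y : ℤ) (hy : (y : ZMod (N / d)) = 1) :
    component χ d (y : ZMod d) = χ (y : ZMod N) := by
  have key : ZMod.castHom (Nat.mul_div_cancel' hd).symm.dvd (ZMod N)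
      ((ZMod.chineseRemainder hc).symm ((y : ZMod d), 1)) = (y : ZMod N) := by
    have : (ZMod.chineseRemainder hc).symm ((y : ZMod d), 1) = (y : ZMod (d * (N / d))) := by
      rw [RingEquiv.symm_apply_eq, map_intCast]
      exact Prod.ext rfl hy.symm
    rw [this, map_intCast]
  rw [component, dif_pos ⟨hd, hc⟩]
  by_cases hu : IsUnit (y : ZMod d)
  · obtain ⟨u, hu⟩ := hu
    rw [← hu, MulChar.ofUnitHom_coe]
    rw [← key, ← hu]
    rfl
  · rw [MulChar.map_nonunit _ hu, MulChar.map_nonunit]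
    intro h
    apply hu
    have := h.map (ZMod.castHom hd (ZMod d))
    rwa [map_intCast] at this

end SiegelEisenstein

open SiegelEisenstein

/-! Each Eisenstein series is rewritten (`siegelEisenstein_eq_tsum`) as a sum over all of Γ_∞ \
Sp₂(ℤ): the summand at a bottom row (C, D) is det(Cτ + D)^{-k} times a coefficient depending only on
(C, D) modulo the level n. The coefficient vanishes unless (C, D) lies in the orbit SL₂ · (M, 1) · P
over ℤ/n, where P is the Siegel parabolic. On the orbit it is χ(x), where the parameter x is the
determinant of the lower right block of the element of P. Modulo each prime dividing N, x is
determined up to squares; as χ is quadratic and N square-free, χ(x) is well defined.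

Replacing τ by qτ turns (C, D) into (qC, D) = Q (C', D') with (C', D') again the bottom row of a
symplectic matrix. After a change of representative, Q is 1, diag(1, q) or q · 1 according as D has
rank 2, 1 or 0 modulo q. Hence det Q = q^j with j = 0, 1, 2, which produces the factor q^{-jk}, and
the passage from (C, D) to (C', D') is a bijection of cosets (`exists_shift_equiv`). The identities
thus reduce to identities between coefficients (`cosetTerm_shift`), and these factor by the Chinese
remainder theorem.

Away from q (`localCoeff_shift`), Q multiplies the parameter by q^j, and scaling C by q contributes
a further q where M is diag(1, 0), but only a square where M is 0 or I. This gives χ_{N₁}(q) for j =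
0, 2 and χ_{N₀N₂}(q) for j = 1.

At q, if D is invertible, the orbit is read off from the symmetric matrix C Dᵀ modulo q under
SL₂-congruence, and q C Dᵀ modulo q² carries the same information (`localCoeff_of_det_ne_zero`). In
rank one the base diag(1, w) modulo q becomes diag(1, qw) modulo q² (`localCoeff_of_rank_one`). If D
vanishes, C is invertible and both pairs lie in the orbit of I with parameter det C
(`localCoeff_of_dvd`). A coefficient modulo q therefore splits into coefficients modulo q² weighted
by χ_q(ω) or χ_q(α); the two cases of the theorem are χ_q(ω) = -1 and χ_q(ω) = 1.

Absolute convergence (`summable_oneSlash`) comes from the five Plücker coordinates of (C, D). They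
lie on a quadric, det(Cτ + D) is a linear form in them with no nonzero real zero on the quadric, so
it is bounded below by a multiple of their norm, and the sum of the inverse fourth powers of the
norm over the integral points converges. -/

namespace SiegelEisenstein

/-! ### The Siegel parabolic and its orbits on pairs (C, D) over a ring. -/

section Parabolic
variable {R S T : Type*} [CommRing R] [CommRing S] [CommRing T]

/-- The blocks `A, B, E` of an element `(A, B; 0, E)` of the Siegel parabolic subgroup. -/
def IsParabolic (A B E : Matrix (Fin 2) (Fin 2) R) : Prop :=
  A * Eᵀ = 1 ∧ A * Bᵀ = B * Aᵀ

theorem IsParabolic.mul {A B E A' B' E' : Matrix (Fin 2) (Fin 2) R} (h : IsParabolic A B E)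
    (h' : IsParabolic A' B' E') : IsParabolic (A * A') (A * B' + B * E') (E * E') := by
  constructor
  · rw [transpose_mul, Matrix.mul_assoc, ← Matrix.mul_assoc A', h'.1, Matrix.one_mul, h.1]
  · have e := h'.1
    have e2 : E' * A'ᵀ = 1 := by
      rw [← transpose_one, ← e, transpose_mul, transpose_transpose]
    simp only [transpose_add, transpose_mul, Matrix.mul_add, Matrix.add_mul]
    congr 1
    · calc A * A' * (B'ᵀ * Aᵀ) = A * (A' * B'ᵀ) * Aᵀ := by simp only [Matrix.mul_assoc]
        _ = A * B' * (A'ᵀ * Aᵀ) := by rw [h'.2]; simp only [Matrix.mul_assoc]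
    · calc A * A' * (E'ᵀ * Bᵀ) = A * (A' * E'ᵀ) * Bᵀ := by simp only [Matrix.mul_assoc]
        _ = B * (E' * A'ᵀ) * Aᵀ := by rw [e, e2, Matrix.mul_one, Matrix.mul_one, h.2]
        _ = B * E' * (A'ᵀ * Aᵀ) := by simp only [Matrix.mul_assoc]

theorem IsParabolic.transpose_mul_eq_one {A B E : Matrix (Fin 2) (Fin 2) R}
    (h : IsParabolic A B E) : Eᵀ * A = 1 := mul_eq_one_comm.1 h.1

theorem IsParabolic.mul_transpose_eq_one {A B E : Matrix (Fin 2) (Fin 2) R}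
    (h : IsParabolic A B E) : E * Aᵀ = 1 := by
  rw [← transpose_one, ← h.1, transpose_mul, transpose_transpose]

theorem IsParabolic.transpose_mul_eq_one' {A B E : Matrix (Fin 2) (Fin 2) R}
    (h : IsParabolic A B E) : Aᵀ * E = 1 := mul_eq_one_comm.1 h.mul_transpose_eq_one

theorem IsParabolic.inv {A B E : Matrix (Fin 2) (Fin 2) R} (h : IsParabolic A B E) :
    IsParabolic Eᵀ (-Bᵀ) Aᵀ := by
  refine ⟨by rw [transpose_transpose]; exact h.transpose_mul_eq_one, ?_⟩
  have key : Eᵀ * B = Bᵀ * E := by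
    calc Eᵀ * B = Eᵀ * B * (Aᵀ * E) := by rw [h.transpose_mul_eq_one', Matrix.mul_one]
      _ = Eᵀ * (B * Aᵀ) * E := by simp only [Matrix.mul_assoc]
      _ = (Eᵀ * A) * Bᵀ * E := by rw [← h.2]; simp only [Matrix.mul_assoc]
      _ = Bᵀ * E := by rw [h.transpose_mul_eq_one, Matrix.one_mul]
  rw [transpose_neg, transpose_transpose, transpose_transpose, Matrix.mul_neg, Matrix.neg_mul, key]

theorem IsParabolic.det_mul_det {A B E : Matrix (Fin 2) (Fin 2) R} (h : IsParabolic A B E) :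
    A.det * E.det = 1 := by
  rw [← det_transpose E, ← det_mul, h.1, det_one]

/-- `(C, D)` lies in `SL₂ · (M, 1) · P`, where the lower right block of the element of the Siegel
parabolic `P` has determinant `x` up to squares. -/
def OrbitRel (M C D : Matrix (Fin 2) (Fin 2) R) (x : R) : Prop :=
  ∃ U A B E : Matrix (Fin 2) (Fin 2) R, U.det = 1 ∧ IsParabolic A B E ∧ U * C = M * A ∧
    U * D = M * B + E ∧ ∃ s, E.det = x * s ^ 2

theorem OrbitRel.isUnit {M C D : Matrix (Fin 2) (Fin 2) R} {x : R} (h : OrbitRel M C D x) :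
    IsUnit x := by
  obtain ⟨U, A, B, E, -, hP, -, -, s, hs⟩ := h
  have := hP.det_mul_det
  rw [hs] at this
  exact IsUnit.of_mul_eq_one (A.det * s ^ 2) (by linear_combination this)

theorem OrbitRel.mul_sq {M C D : Matrix (Fin 2) (Fin 2) R} {x y s : R} (h : OrbitRel M C D x)
    (hxy : x = y * s ^ 2) : OrbitRel M C D y := by
  obtain ⟨U, A, B, E, hU, hP, h1, h2, t, ht⟩ := h
  exact ⟨U, A, B, E, hU, hP, h1, h2, s * t, by rw [ht, hxy]; ring⟩

theorem OrbitRel.mul_left {M C D : Matrix (Fin 2) (Fin 2) R} {x : R} (h : OrbitRel M C D x)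
    (V : Matrix (Fin 2) (Fin 2) R) (hV : V.det = 1) : OrbitRel M (V * C) (V * D) x := by
  obtain ⟨U, A, B, E, hU, hP, h1, h2, hs⟩ := h
  have hVV : V.adjugate * V = 1 := by rw [adjugate_mul, hV, one_smul]
  refine ⟨U * V.adjugate, A, B, E, ?_, hP, ?_, ?_, hs⟩
  · rw [det_mul, hU, det_adjugate, hV]; simp
  · rw [← h1, Matrix.mul_assoc, ← Matrix.mul_assoc _ V, hVV, Matrix.one_mul]
  · rw [← h2, Matrix.mul_assoc, ← Matrix.mul_assoc _ V, hVV, Matrix.one_mul]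

theorem OrbitRel.mul_right {M C D : Matrix (Fin 2) (Fin 2) R} {x : R} (h : OrbitRel M C D x)
    {A' B' E' : Matrix (Fin 2) (Fin 2) R} (hP' : IsParabolic A' B' E') :
    OrbitRel M (C * A') (C * B' + D * E') (x * E'.det) := by
  obtain ⟨U, A, B, E, hU, hP, h1, h2, s, hs⟩ := h
  refine ⟨U, A * A', A * B' + B * E', E * E', hU, hP.mul hP', ?_, ?_, s, ?_⟩
  · rw [← Matrix.mul_assoc, h1, Matrix.mul_assoc]
  · rw [Matrix.mul_add, ← Matrix.mul_assoc, h1, ← Matrix.mul_assoc, h2, Matrix.add_mul,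
      Matrix.mul_add]
    simp only [Matrix.mul_assoc, add_assoc]
  · rw [det_mul, hs]; ring

/-- Applying the inverse of the first parabolic element to the second relation carries (C, D) back
to (M, 1). The inverse has lower right block Aᵀ, and det A = (det E)⁻¹ equals det E up to a square,
so the parameters multiply. This is the tool for showing that two base matrices have different
orbits. -/
theorem OrbitRel.compare {M M' C D : Matrix (Fin 2) (Fin 2) R} {x x' : R}
    (h : OrbitRel M C D x) (h' : OrbitRel M' C D x') : OrbitRel M' M 1 (x' * x) := by
  obtain ⟨U, A, B, E, hU, hP, h1, h2, s, hs⟩ := h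
  have hd := hP.det_mul_det
  have hUU : U.adjugate * U = 1 := by rw [adjugate_mul, hU, one_smul]
  have hU' : U.adjugate.det = 1 := by rw [det_adjugate, hU]; simp
  have h3 := (h'.mul_right hP.inv).mul_left U hU
  have e1 : U * (C * Eᵀ) = M := by
    rw [← Matrix.mul_assoc, h1, Matrix.mul_assoc, hP.1, Matrix.mul_one]
  have e2 : U * (C * -Bᵀ + D * Aᵀ) = 1 := by
    rw [Matrix.mul_add, ← Matrix.mul_assoc, h1, ← Matrix.mul_assoc, h2, Matrix.add_mul,
      Matrix.mul_neg, Matrix.mul_assoc, hP.2, Matrix.mul_assoc, hP.mul_transpose_eq_one]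
    abel
  rw [e1, e2, det_transpose] at h3
  refine h3.mul_sq (s := A.det * s) ?_
  rw [hs] at hd
  linear_combination (-(x' * A.det)) * hd

theorem OrbitRel.of_base {M M' C D : Matrix (Fin 2) (Fin 2) R} {x y : R}
    (h : OrbitRel M C D x) (h' : OrbitRel M' M 1 y) : OrbitRel M' C D (y * x) := by
  obtain ⟨U, A, B, E, hU, hP, h1, h2, s, hs⟩ := h
  have hUU : U.adjugate * U = 1 := by rw [adjugate_mul, hU, one_smul]
  have hU' : U.adjugate.det = 1 := by rw [det_adjugate, hU]; simp
  have h3 := (h'.mul_right hP).mul_left U.adjugate hU'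
  rw [← h1, Matrix.one_mul, ← h2, ← Matrix.mul_assoc, hUU, Matrix.one_mul, ← Matrix.mul_assoc,
    hUU, Matrix.one_mul, hs] at h3
  exact h3.mul_sq (s := s) (by ring)

theorem OrbitRel.map (f : R →+* S) {M C D : Matrix (Fin 2) (Fin 2) R} {x : R}
    (h : OrbitRel M C D x) : OrbitRel (M.map f) (C.map f) (D.map f) (f x) := by
  obtain ⟨U, A, B, E, hU, hP, h1, h2, s, hs⟩ := h
  have hd : ∀ X : Matrix (Fin 2) (Fin 2) R, (X.map f).det = f X.det := fun X => (f.map_det X).symm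
  refine ⟨U.map f, A.map f, B.map f, E.map f, ?_, ⟨?_, ?_⟩, ?_, ?_, f s, ?_⟩
  · rw [hd, hU, map_one]
  · rw [← transpose_map, ← Matrix.map_mul, hP.1, Matrix.map_one _ (map_zero f) (map_one f)]
  · rw [← transpose_map, ← transpose_map, ← Matrix.map_mul, hP.2, Matrix.map_mul]
  · rw [← Matrix.map_mul, h1, Matrix.map_mul]
  · rw [← Matrix.map_mul, h2, Matrix.map_add _ (map_add f), Matrix.map_mul]
  · rw [hd, hs, map_mul, map_pow]

/-- The relation holds over a ring `T` if it holds over `R` and over `S`, where `T = R × S`. -/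
theorem OrbitRel.glue (f : T →+* R) (g : T →+* S)
    (hinj : ∀ t t', f t = f t' → g t = g t' → t = t') (hsurj : ∀ r s, ∃ t, f t = r ∧ g t = s)
    {M C D : Matrix (Fin 2) (Fin 2) T} {x : T}
    (h : OrbitRel (M.map f) (C.map f) (D.map f) (f x))
    (h' : OrbitRel (M.map g) (C.map g) (D.map g) (g x)) : OrbitRel M C D x := by
  obtain ⟨U, A, B, E, hU, hP, h1, h2, s, hs⟩ := h
  obtain ⟨U', A', B', E', hU', hP', h1', h2', s', hs'⟩ := h'
  have key : ∀ (X : Matrix (Fin 2) (Fin 2) R) (X' : Matrix (Fin 2) (Fin 2) S),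
      ∃ Y : Matrix (Fin 2) (Fin 2) T, Y.map f = X ∧ Y.map g = X' := by
    intro X X'
    choose Y hY using fun i j => hsurj (X i j) (X' i j)
    exact ⟨Matrix.of Y, by ext i j; exact (hY i j).1, by ext i j; exact (hY i j).2⟩
  have inj : ∀ Y Y' : Matrix (Fin 2) (Fin 2) T, Y.map f = Y'.map f → Y.map g = Y'.map g →
      Y = Y' := by
    intro Y Y' e e'
    ext i j
    exact hinj _ _ (congrFun (congrFun e i) j) (congrFun (congrFun e' i) j)
  have hd : ∀ X : Matrix (Fin 2) (Fin 2) T, (X.map f).det = f X.det := fun X => (f.map_det X).symm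
  have hd' : ∀ X : Matrix (Fin 2) (Fin 2) T, (X.map g).det = g X.det := fun X => (g.map_det X).symm
  obtain ⟨U, rfl, rfl⟩ := key U U'
  obtain ⟨A, rfl, rfl⟩ := key A A'
  obtain ⟨B, rfl, rfl⟩ := key B B'
  obtain ⟨E, rfl, rfl⟩ := key E E'
  obtain ⟨s, rfl, rfl⟩ := hsurj s s'
  simp only [IsParabolic, ← Matrix.map_mul, ← transpose_map, hd, hd',
    ← Matrix.map_add _ (map_add f), ← Matrix.map_add _ (map_add g)] at *
  refine ⟨U, A, B, E, hinj _ _ ?_ ?_, ⟨inj _ _ ?_ ?_, inj _ _ hP.2 hP'.2⟩, inj _ _ h1 h1',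
    inj _ _ h2 h2', s, hinj _ _ ?_ ?_⟩
  · rw [hU, map_one]
  · rw [hU', map_one]
  · rw [hP.1, Matrix.map_one _ (map_zero f) (map_one f)]
  · rw [hP'.1, Matrix.map_one _ (map_zero g) (map_one g)]
  · rw [hs, map_mul, map_pow]
  · rw [hs', map_mul, map_pow]

/-- The relation for diagonal pairs. -/
theorem OrbitRel.diagonal_pair {m m' t a b e : Fin 2 → R} (hae : ∀ i, a i * e i = 1)
    (hm : ∀ i, m' i = m i * a i) (hb : ∀ i, m i * b i + e i = t i) :
    OrbitRel (diagonal m) (diagonal m') (diagonal t) (e 0 * e 1) := by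
  refine ⟨1, diagonal a, diagonal b, diagonal e, det_one, ⟨?_, ?_⟩, ?_, ?_, 1, ?_⟩
  · rw [diagonal_transpose, diagonal_mul_diagonal, ← diagonal_one]
    exact congrArg _ (funext hae)
  · simp [diagonal_mul_diagonal, mul_comm]
  · rw [diagonal_mul_diagonal, Matrix.one_mul]
    exact congrArg _ (funext hm)
  · rw [diagonal_mul_diagonal, diagonal_add, Matrix.one_mul]
    exact congrArg _ (funext fun i => (hb i).symm)
  · simp

/-- Change of the base matrix by a diagonal element of the parabolic. -/
theorem OrbitRel.diagonal_base {m m' a b e : Fin 2 → R} (hae : ∀ i, a i * e i = 1)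
    (hm : ∀ i, m' i = m i * a i) (hb : ∀ i, m i * b i + e i = 1) :
    OrbitRel (diagonal m) (diagonal m') 1 (e 0 * e 1) := by
  simpa using OrbitRel.diagonal_pair (t := fun _ => 1) hae hm hb

/-- Over a field, the parameter of `OrbitRel` is determined up to squares. -/
theorem OrbitRel.isSquare {F : Type*} [Field F] {m : Fin 2 → F} {C D : Matrix (Fin 2) (Fin 2) F}
    {x x' : F} (h : OrbitRel (Matrix.diagonal m) C D x) (h' : OrbitRel (Matrix.diagonal m) C D x') :
    IsSquare (x * x') := by
  obtain ⟨U, A, B, E, hU, hP, h1, h2, s, hs⟩ := h.compare h'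
  have hm : m = ![m 0, m 1] := by ext i; fin_cases i <;> rfl
  rw [hm] at h1 h2
  rw [Matrix.mul_one] at h2
  -- Comparing the two relations gives an element of P which, together with U, stabilises (M, 1); as
  -- det U = 1, its E has square determinant.
  obtain ⟨y, hy⟩ := isSquare_of_field _ _ A B E U h1.symm h2.symm hP.det_mul_det hP.1
  rw [hU, mul_one, hs] at hy
  have hs0 : s ≠ 0 := by
    rintro rfl
    have := hP.det_mul_det
    rw [hs] at this
    simp at this
  refine ⟨y / s, ?_⟩
  field_simp
  linear_combination hy

end Parabolic

/-- Surjectivity of SL₂(ℤ) → SL₂(ℤ/n): the bottom row of an arbitrary lift is moved within its class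
to a primitive row, completed to determinant one, and the top row is corrected by a multiple of the
bottom one. -/
theorem exists_int_det_eq_one_lift {n : ℕ} (U : Matrix (Fin 2) (Fin 2) (ZMod n))
    (hU : U.det = 1) :
    ∃ V : Matrix (Fin 2) (Fin 2) ℤ, V.det = 1 ∧ V.map (Int.cast : ℤ → ZMod n) = U := by
  obtain ⟨a, ha⟩ := ZMod.intCast_surjective (U 0 0)
  obtain ⟨b, hb⟩ := ZMod.intCast_surjective (U 0 1)
  obtain ⟨c, hc⟩ := ZMod.intCast_surjective (U 1 0)
  obtain ⟨d, hd⟩ := ZMod.intCast_surjective (U 1 1)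
  have hdet : ((a * d - b * c : ℤ) : ZMod n) = 1 := by
    push_cast
    rw [ha, hb, hc, hd, ← hU, det_fin_two]
  obtain ⟨e, he⟩ : ∃ e, a * d - b * c = 1 + n * e := by
    have : (((a * d - b * c) - 1 : ℤ) : ZMod n) = 0 := by rw [Int.cast_sub, hdet]; simp
    obtain ⟨e, he⟩ := (ZMod.intCast_zmod_eq_zero_iff_dvd _ _).1 this
    exact ⟨e, by linarith⟩
  obtain ⟨g, c₀, d₀, u, v, hc₀, hd₀, huv⟩ : ∃ g c₀ d₀ u v : ℤ, c = g * c₀ ∧ d = g * d₀ ∧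
      u * c₀ + v * d₀ = 1 := by
    rcases Nat.eq_zero_or_pos (Int.gcd c d) with h0 | h0
    · obtain ⟨rfl, rfl⟩ := Int.gcd_eq_zero_iff.1 h0
      exact ⟨0, 1, 0, 1, 0, by simp, by simp, by simp⟩
    · obtain ⟨c₀, d₀, h1, h2, h3⟩ := Int.exists_gcd_one h0
      obtain ⟨u, v, huv⟩ := Int.isCoprime_iff_gcd_eq_one.2 h1
      exact ⟨(c.gcd d : ℤ), c₀, d₀, u, v, h2.trans (mul_comm _ _), h3.trans (mul_comm _ _), huv⟩
  -- With these choices a'd' - b'c' = gk - ne, and gk = ad - bc = 1 + ne.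
  obtain ⟨k, hk⟩ : ∃ k, k = a * d₀ - b * c₀ := ⟨_, rfl⟩
  obtain ⟨c', hc'⟩ : ∃ c', c' = c + n * v := ⟨_, rfl⟩
  obtain ⟨d', hd'⟩ : ∃ d', d' = d - n * u := ⟨_, rfl⟩
  obtain ⟨a', ha'⟩ : ∃ a', a' = v * k + c₀ * e := ⟨_, rfl⟩
  obtain ⟨b', hb'⟩ : ∃ b', b' = -(u * k - d₀ * e) := ⟨_, rfl⟩
  have hdet' : a' * d' - b' * c' = 1 := by
    rw [ha', hb', hc', hd', hk, hc₀, hd₀]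
    rw [hc₀, hd₀] at he
    linear_combination he + (g * (a * d₀ - b * c₀) - n * e) * huv
  have z : ((n : ℤ) : ZMod n) = 0 := by simp
  have hcast : ((a' * d - b' * c : ℤ) : ZMod n) = 1 := by
    have := congrArg (Int.cast : ℤ → ZMod n) hdet'
    rw [hc', hd'] at this
    push_cast at this ⊢
    simp only [ZMod.natCast_self, zero_mul, add_zero, sub_zero] at this
    exact this
  -- Modulo n both ad - bc and a'd - b'c are 1, so adding ba' - ab' times the bottom row to (a', b')
  -- recovers (a, b).
  refine ⟨!![a' + (b * a' - a * b') * c', b' + (b * a' - a * b') * d'; c', d'], ?_, ?_⟩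
  · rw [det_fin_two_of]; linear_combination hdet'
  · have e1 : (c' : ZMod n) = c := by rw [hc']; push_cast; simp
    have e2 : (d' : ZMod n) = d := by rw [hd']; push_cast; simp
    push_cast at hdet hcast
    ext i j
    fin_cases i <;> fin_cases j <;> simp [e1, e2, ← ha, ← hb, ← hc, ← hd]
    · linear_combination (a : ZMod n) * hcast - (a' : ZMod n) * hdet
    · linear_combination (b : ZMod n) * hcast - (b' : ZMod n) * hdet

/-! ### Block identities, and cosets of Γ_∞ as coprime symmetric pairs. -/

theorem blockA_mul (γ δ : Sp2Z) :
    blockA (γ * δ) = blockA γ * blockA δ + blockB γ * blockC δ := by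
  have h : ((γ * δ : Sp2Z) : Matrix (Fin 2 ⊕ Fin 2) (Fin 2 ⊕ Fin 2) ℤ) =
      (γ : Matrix (Fin 2 ⊕ Fin 2) (Fin 2 ⊕ Fin 2) ℤ) * δ := rfl
  rw [blockA, h, eq_fromBlocks γ, eq_fromBlocks δ, fromBlocks_multiply, toBlocks_fromBlocks₁₁]

theorem blockB_mul (γ δ : Sp2Z) :
    blockB (γ * δ) = blockA γ * blockB δ + blockB γ * blockD δ := by
  have h : ((γ * δ : Sp2Z) : Matrix (Fin 2 ⊕ Fin 2) (Fin 2 ⊕ Fin 2) ℤ) =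
      (γ : Matrix (Fin 2 ⊕ Fin 2) (Fin 2 ⊕ Fin 2) ℤ) * δ := rfl
  rw [blockB, h, eq_fromBlocks γ, eq_fromBlocks δ, fromBlocks_multiply, toBlocks_fromBlocks₁₂]

theorem coe_inv_eq (γ : Sp2Z) : ((γ⁻¹ : Sp2Z) : Matrix (Fin 2 ⊕ Fin 2) (Fin 2 ⊕ Fin 2) ℤ) =
    fromBlocks (blockD γ)ᵀ (-(blockB γ)ᵀ) (-(blockC γ)ᵀ) (blockA γ)ᵀ := by
  rw [SymplecticGroup.coe_inv, eq_fromBlocks γ, J, fromBlocks_transpose, fromBlocks_neg,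
    fromBlocks_multiply, fromBlocks_multiply]
  simp

theorem blockA_inv (γ : Sp2Z) : blockA γ⁻¹ = (blockD γ)ᵀ := by
  rw [blockA, coe_inv_eq, toBlocks_fromBlocks₁₁]

theorem blockB_inv (γ : Sp2Z) : blockB γ⁻¹ = -(blockB γ)ᵀ := by
  rw [blockB, coe_inv_eq, toBlocks_fromBlocks₁₂]

theorem blockD_inv (γ : Sp2Z) : blockD γ⁻¹ = (blockA γ)ᵀ := by
  rw [blockD, coe_inv_eq, toBlocks_fromBlocks₂₂]

theorem blockC_mul_blockD_transpose (γ : Sp2Z) :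
    blockC γ * (blockD γ)ᵀ = blockD γ * (blockC γ)ᵀ := by
  have h := blockC_mul γ γ⁻¹
  rw [mul_inv_cancel, blockC_one, blockA_inv, blockC_inv, Matrix.mul_neg] at h
  exact (add_neg_eq_zero.1 h.symm)

theorem blockB_one : blockB 1 = 0 := by
  ext i j
  simp [blockB, toBlocks₁₂]

theorem blockA_mul_blockB_transpose (γ : Sp2Z) :
    blockA γ * (blockB γ)ᵀ = blockB γ * (blockA γ)ᵀ := by
  have h := blockB_mul γ γ⁻¹
  rw [mul_inv_cancel, blockB_one, blockB_inv, blockD_inv, Matrix.mul_neg] at h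
  exact (neg_add_eq_zero.1 h.symm)

theorem blockD_mul_blockA_transpose (γ : Sp2Z) :
    blockD γ * (blockA γ)ᵀ - blockC γ * (blockB γ)ᵀ = 1 := by
  have h := congrArg transpose (blockA_mul_blockD_transpose γ)
  simpa using h

/-- Two elements have the same bottom row up to `GL₂(ℤ)` if and only if they define the same
coset of `Γ_∞`. -/
theorem mul_inv_mem_GammaInf (g h : Sp2Z) :
    g * h⁻¹ ∈ GammaInf ↔ blockC g * (blockD h)ᵀ = blockD g * (blockC h)ᵀ := by
  change blockC (g * h⁻¹) = 0 ↔ _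
  rw [blockC_mul, blockA_inv, blockC_inv, Matrix.mul_neg, add_neg_eq_zero]

/-- A coprime symmetric pair is the bottom row of a symplectic matrix. -/
theorem exists_blockC_blockD {C D X Y : Matrix (Fin 2) (Fin 2) ℤ} (hs : C * Dᵀ = D * Cᵀ)
    (h : C * X + D * Y = 1) : ∃ g : Sp2Z, blockC g = C ∧ blockD g = D := by
  have hT := congrArg transpose h
  simp only [transpose_add, transpose_mul, transpose_one] at hT
  obtain ⟨K, hK⟩ : ∃ K, K = Yᵀ * X := ⟨_, rfl⟩
  -- The top row (Yᵀ, -Xᵀ) satisfies A Dᵀ - B Cᵀ = 1, but A Bᵀ need not be symmetric. Adding Z (C,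
  -- D) keeps the first relation and repairs the second when Z - Zᵀ is the defect Kᵀ - K.
  obtain ⟨Z, hZ⟩ : ∃ Z : Matrix (Fin 2) (Fin 2) ℤ, Z - Zᵀ = Kᵀ - K :=
    ⟨!![0, K 1 0 - K 0 1; 0, 0], by ext i j; fin_cases i <;> fin_cases j <;> simp⟩
  have m1 : (Yᵀ + Z * C) * Dᵀ - (-Xᵀ + Z * D) * Cᵀ = 1 := by
    rw [← hT, Matrix.add_mul, Matrix.add_mul, Matrix.mul_assoc, Matrix.mul_assoc, hs,
      Matrix.neg_mul]
    abel
  have m2 : (Yᵀ + Z * C) * (-Xᵀ + Z * D)ᵀ = (-Xᵀ + Z * D) * (Yᵀ + Z * C)ᵀ := by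
    have e1 : (Yᵀ + Z * C) * (-Xᵀ + Z * D)ᵀ - (-Xᵀ + Z * D) * (Yᵀ + Z * C)ᵀ =
        (Xᵀ * Y - Yᵀ * X) + (Yᵀ * Dᵀ + Xᵀ * Cᵀ) * Zᵀ - Z * (C * X + D * Y) +
          Z * (C * Dᵀ - D * Cᵀ) * Zᵀ := by
      simp only [transpose_add, transpose_neg, transpose_mul, transpose_transpose]
      noncomm_ring
    have e2 : Xᵀ * Y = Kᵀ := by rw [hK, transpose_mul, transpose_transpose]
    rw [← sub_eq_zero, e1, h, add_comm (Yᵀ * Dᵀ), hT, hs, sub_self, e2, ← hK]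
    simp only [Matrix.mul_zero, Matrix.zero_mul, Matrix.one_mul, Matrix.mul_one, add_zero]
    rw [add_sub_assoc, ← neg_sub Z, hZ]
    abel
  refine ⟨⟨(fromBlocks (Yᵀ + Z * C) (-Xᵀ + Z * D) C D), ?_⟩, toBlocks_fromBlocks₂₁ _ _ _ _,
    toBlocks_fromBlocks₂₂ _ _ _ _⟩
  have m1' := congrArg transpose m1
  simp only [transpose_sub, transpose_mul, transpose_transpose, transpose_one] at m1'
  rw [← SymplecticGroup.transpose_mem_iff, fromBlocks_transpose, SymplecticGroup.fromBlocks_mem_iff]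
  simp only [transpose_transpose]
  exact ⟨m2, hs, m1⟩

/-- The element of `Γ_∞` with blocks `(ᵗV⁻¹, T V; 0, V)`. -/
def upperParabolic (V T : Matrix (Fin 2) (Fin 2) ℤ) (hV : V.det = 1) (hT : Tᵀ = T) : Sp2Z :=
  ⟨fromBlocks V.adjugateᵀ (T * V) 0 V, by
    rw [SymplecticGroup.fromBlocks_mem_iff]
    refine ⟨by simp, ?_, ?_⟩
    · rw [transpose_mul, hT, Matrix.mul_assoc]
    · rw [transpose_transpose, adjugate_mul, hV]; simp⟩

theorem upperParabolic_mem (V T : Matrix (Fin 2) (Fin 2) ℤ) (hV : V.det = 1) (hT : Tᵀ = T) :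
    upperParabolic V T hV hT ∈ GammaInf := toBlocks_fromBlocks₂₁ _ _ _ _

/-! ### The orbit relation modulo n for integral pairs. -/

section
variable {n : ℕ}

/-- `OrbitRel` for the reductions modulo `n` of integral data. -/
def OrbitRelMod (n : ℕ) (m : Fin 2 → ℤ) (C D : Matrix (Fin 2) (Fin 2) ℤ) (x : ℤ) : Prop :=
  OrbitRel ((diagonal m).map (Int.cast : ℤ → ZMod n)) (C.map (Int.cast : ℤ → ZMod n))
    (D.map (Int.cast : ℤ → ZMod n)) (x : ZMod n)

theorem isParabolic_of_mem_Gamma0 (γ : Gamma0 n) :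
    IsParabolic ((blockA (γ : Sp2Z)).map (Int.cast : ℤ → ZMod n))
      ((blockB (γ : Sp2Z)).map (Int.cast : ℤ → ZMod n))
      ((blockD (γ : Sp2Z)).map (Int.cast : ℤ → ZMod n)) := by
  refine ⟨map_cast_blockA_mul dvd_rfl γ, ?_⟩
  rw [← transpose_map, ← transpose_map, ← map_cast_mul, ← map_cast_mul,
    blockA_mul_blockB_transpose]

theorem blockA_lowerUnipotent (m : Fin 2 → ℤ) : blockA (lowerUnipotent m) = 1 :=
  toBlocks_fromBlocks₁₁ _ _ _ _
theorem blockC_lowerUnipotent (m : Fin 2 → ℤ) : blockC (lowerUnipotent m) = diagonal m :=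
  toBlocks_fromBlocks₂₁ _ _ _ _
theorem blockD_lowerUnipotent (m : Fin 2 → ℤ) : blockD (lowerUnipotent m) = 1 :=
  toBlocks_fromBlocks₂₂ _ _ _ _

/-- Modulo n the matrix γ is itself parabolic, with lower right block `blockD γ`. Hence the
parameter of γ_M γ is the argument of χ in the summand of the Eisenstein series. -/
theorem orbitRelMod_lowerUnipotent_mul (m : Fin 2 → ℤ) (γ : Gamma0 n) :
    OrbitRelMod n m (blockC (lowerUnipotent m * (γ : Sp2Z)))
      (blockD (lowerUnipotent m * (γ : Sp2Z))) (blockD (γ : Sp2Z)).det := by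
  refine ⟨1, _, _, _, det_one, isParabolic_of_mem_Gamma0 γ, ?_, ?_, 1, ?_⟩
  · rw [blockC_mul, blockC_lowerUnipotent, blockD_lowerUnipotent, map_cast_add, map_cast_mul,
      map_cast_mul, map_cast_blockC dvd_rfl]
    simp
  · rw [blockD_mul, blockC_lowerUnipotent, blockD_lowerUnipotent, map_cast_add, map_cast_mul,
      map_cast_mul]
    simp
  · rw [map_cast_det]; simp

theorem OrbitRelMod.mul_left {m : Fin 2 → ℤ} {C D : Matrix (Fin 2) (Fin 2) ℤ} {x : ℤ}
    (h : OrbitRelMod n m C D x) (V : Matrix (Fin 2) (Fin 2) ℤ) (hV : V.det = 1) :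
    OrbitRelMod n m (V * C) (V * D) x := by
  have := OrbitRel.mul_left h (V.map (Int.cast : ℤ → ZMod n)) (by rw [← map_cast_det, hV]; simp)
  rwa [← map_cast_mul, ← map_cast_mul] at this

/-- Elements satisfying the orbit relation modulo `n` are in `Γ_∞ γ_M Γ₀(n)`. -/
theorem OrbitRelMod.exists_mul_eq {m : Fin 2 → ℤ} {g : Sp2Z} {x : ℤ}
    (h : OrbitRelMod n m (blockC g) (blockD g) x) :
    ∃ δ ∈ GammaInf, ∃ γ : Gamma0 n, δ * g = lowerUnipotent m * (γ : Sp2Z) := by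
  obtain ⟨U, A, B, E, hU, hP, h1, h2, -⟩ := h
  obtain ⟨V, hV, rfl⟩ := exists_int_det_eq_one_lift U hU
  obtain ⟨g', hg'⟩ : ∃ g', g' = upperParabolic V 0 hV transpose_zero * g := ⟨_, rfl⟩
  have hC : blockC g' = V * blockC g := by
    rw [hg', blockC_mul, show blockC (upperParabolic V 0 hV _) = 0 from
      toBlocks_fromBlocks₂₁ _ _ _ _, show blockD (upperParabolic V 0 hV _) = V from
      toBlocks_fromBlocks₂₂ _ _ _ _, Matrix.zero_mul, zero_add]
  have hD : blockD g' = V * blockD g := by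
    rw [hg', blockD_mul, show blockC (upperParabolic V 0 hV _) = 0 from
      toBlocks_fromBlocks₂₁ _ _ _ _, show blockD (upperParabolic V 0 hV _) = V from
      toBlocks_fromBlocks₂₂ _ _ _ _, Matrix.zero_mul, zero_add]
  rw [← map_cast_mul, ← hC] at h1
  rw [← map_cast_mul, ← hD] at h2
  obtain ⟨M, hM⟩ : ∃ M, M = (diagonal m).map (Int.cast : ℤ → ZMod n) := ⟨_, rfl⟩
  have hMT : Mᵀ = M := by rw [hM, ← transpose_map, diagonal_transpose]
  rw [← hM] at h1 h2
  have i1 := congrArg (fun X => X.map (Int.cast : ℤ → ZMod n)) (eq_add_of_sub_eq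
    (blockA_mul_blockD_transpose g'))
  have i2 := congrArg (fun X => X.map (Int.cast : ℤ → ZMod n)) (eq_add_of_sub_eq
    (blockD_mul_blockA_transpose g'))
  have i3 := congrArg (fun X => X.map (Int.cast : ℤ → ZMod n)) (blockA_mul_blockB_transpose g')
  have i4 := congrArg (fun X => X.map (Int.cast : ℤ → ZMod n)) (blockC_mul_blockD_transpose g')
  have i5 := congrArg blockA (inv_mul_cancel g')
  have i6 := congrArg blockB (inv_mul_cancel g')
  have i7 := congrArg blockC (inv_mul_cancel g')
  have i8 := congrArg blockD (inv_mul_cancel g')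
  have b1 : blockA 1 = 1 := by ext i j; simp [blockA, toBlocks₁₁, Matrix.one_apply]
  have b2 : blockD 1 = 1 := by ext i j; simp [blockD, toBlocks₂₂, Matrix.one_apply]
  rw [blockA_mul, blockA_inv, blockB_inv, b1] at i5
  rw [blockB_mul, blockA_inv, blockB_inv, blockB_one] at i6
  rw [blockC_mul, blockC_inv, blockD_inv, blockC_one] at i7
  rw [blockD_mul, blockC_inv, blockD_inv, b2] at i8
  replace i5 := congrArg (fun X => X.map (Int.cast : ℤ → ZMod n)) i5
  replace i6 := congrArg (fun X => X.map (Int.cast : ℤ → ZMod n)) i6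
  replace i7 := congrArg (fun X => X.map (Int.cast : ℤ → ZMod n)) i7
  replace i8 := congrArg (fun X => X.map (Int.cast : ℤ → ZMod n)) i8
  have hneg : ∀ X : Matrix (Fin 2) (Fin 2) ℤ, (-X).map (Int.cast : ℤ → ZMod n) =
    -(X.map (Int.cast : ℤ → ZMod n)) := fun X => Matrix.map_neg _ (fun _ => Int.cast_neg _) X
  simp only [map_cast_add, map_cast_mul, transpose_map, hneg,
    Matrix.map_one _ Int.cast_zero Int.cast_one, Matrix.map_zero _ Int.cast_zero] at i1 i2 i3 i4 i5 i6 i7 i8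
  obtain ⟨a, ha⟩ : ∃ a, a = (blockA g').map (Int.cast : ℤ → ZMod n) := ⟨_, rfl⟩
  obtain ⟨b, hb⟩ : ∃ a, a = (blockB g').map (Int.cast : ℤ → ZMod n) := ⟨_, rfl⟩
  obtain ⟨c, hc⟩ : ∃ a, a = (blockC g').map (Int.cast : ℤ → ZMod n) := ⟨_, rfl⟩
  obtain ⟨d, hd⟩ : ∃ a, a = (blockD g').map (Int.cast : ℤ → ZMod n) := ⟨_, rfl⟩
  simp only [← ha, ← hb, ← hc, ← hd] at i1 i2 i3 i4 i5 i6 i7 i8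
  rw [← hc] at h1
  rw [← hd] at h2
  -- Both (a, b) and (A, B) complete the bottom row (c, d) to a symplectic matrix modulo n, so they
  -- differ by T (c, d) with T symmetric. A lift of T gives the element δ of Γ_∞ that changes one
  -- top row into the other.
  obtain ⟨T, hT⟩ : ∃ T, T = B * aᵀ - A * bᵀ := ⟨_, rfl⟩
  have hone : A * dᵀ - B * cᵀ = 1 := by
    rw [h1, h2, transpose_add, transpose_mul, transpose_mul, hMT, Matrix.mul_add, hP.1,
      ← Matrix.mul_assoc, hP.2]
    simp [Matrix.mul_assoc]
  have hA : A = a + T * c := by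
    calc A = A * (dᵀ * a + -bᵀ * c) + B * (-cᵀ * a + aᵀ * c) := by rw [i5, i7]; simp
      _ = (A * dᵀ - B * cᵀ) * a + T * c := by rw [hT]; noncomm_ring
      _ = a + T * c := by rw [hone, Matrix.one_mul]
  have hB : B = b + T * d := by
    calc B = A * (dᵀ * b + -bᵀ * d) + B * (-cᵀ * b + aᵀ * d) := by rw [i6, i8]; simp
      _ = (A * dᵀ - B * cᵀ) * b + T * d := by rw [hT]; noncomm_ring
      _ = b + T * d := by rw [hone, Matrix.one_mul]
  have hTs : Tᵀ = T := by
    have h4 := hP.2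
    rw [hA, hB] at h4
    have e1 : (a + T * c) * (b + T * d)ᵀ - (b + T * d) * (a + T * c)ᵀ =
        (a * bᵀ - b * aᵀ) + (a * dᵀ - b * cᵀ) * Tᵀ - T * (d * aᵀ - c * bᵀ) +
          T * (c * dᵀ - d * cᵀ) * Tᵀ := by
      simp only [transpose_add, transpose_mul]
      noncomm_ring
    rw [h4, i3, i4, i1, i2] at e1
    simp only [sub_self, add_sub_cancel_right, Matrix.mul_zero, Matrix.zero_mul, Matrix.one_mul,
      Matrix.mul_one, zero_add, add_zero] at e1
    exact (sub_eq_zero.1 e1.symm)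
  obtain ⟨T', hT's, hT'⟩ : ∃ T' : Matrix (Fin 2) (Fin 2) ℤ, T'ᵀ = T' ∧
      T'.map (Int.cast : ℤ → ZMod n) = T := by
    obtain ⟨x, hx⟩ := ZMod.intCast_surjective (T 0 0)
    obtain ⟨y, hy⟩ := ZMod.intCast_surjective (T 0 1)
    obtain ⟨z, hz⟩ := ZMod.intCast_surjective (T 1 1)
    have h10 : T 1 0 = T 0 1 := congrFun (congrFun hTs 0) 1
    refine ⟨!![x, y; y, z], ?_, ?_⟩
    · ext i j; fin_cases i <;> fin_cases j <;> rfl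
    · ext i j; fin_cases i <;> fin_cases j <;> simp [hx, hy, hz, h10]
  obtain ⟨δ, hδ⟩ : ∃ δ, δ = upperParabolic 1 T' det_one hT's := ⟨_, rfl⟩
  have hδm : δ ∈ GammaInf := hδ ▸ upperParabolic_mem _ _ _ _
  have hδA : blockA δ = 1 := by
    rw [hδ]; refine (toBlocks_fromBlocks₁₁ _ _ _ _).trans ?_; simp
  have hδB : blockB δ = T' := by
    rw [hδ]; refine (toBlocks_fromBlocks₁₂ _ _ _ _).trans ?_; simp
  have hδC : blockC δ = 0 := hδm
  have hδD : blockD δ = 1 := by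
    rw [hδ]; exact (toBlocks_fromBlocks₂₂ _ _ _ _)
  refine ⟨δ * upperParabolic V 0 hV transpose_zero, mul_mem hδm (upperParabolic_mem _ _ _ _),
    ⟨(lowerUnipotent m)⁻¹ * (δ * g'), ?_⟩, ?_⟩
  -- Modulo n the lower left block is -M (a + T c) + c = -M A + c = 0.
  · have key : (blockC ((lowerUnipotent m)⁻¹ * (δ * g'))).map (Int.cast : ℤ → ZMod n) = 0 := by
      rw [blockC_mul, blockC_inv, blockD_inv, blockC_lowerUnipotent, blockA_lowerUnipotent,
        blockA_mul, blockC_mul, hδA, hδB, hδC, hδD]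
      simp only [map_cast_add, map_cast_mul, hneg, diagonal_transpose, transpose_one,
        Matrix.one_mul, Matrix.zero_mul, zero_add]
      rw [← ha, ← hc, hT', ← hM, ← hA, h1, Matrix.neg_mul, neg_add_cancel]
    intro i j
    rw [← ZMod.intCast_zmod_eq_zero_iff_dvd]
    exact congrFun (congrFun key i) j
  · change _ = lowerUnipotent m * ((lowerUnipotent m)⁻¹ * (δ * g'))
    rw [mul_inv_cancel_left, hg', mul_assoc]

end

theorem DiagModEq.map_eq {n : ℕ} {m m' : Fin 2 → ℤ} (h : DiagModEq n m m') :
    (diagonal m).map (Int.cast : ℤ → ZMod n) = (diagonal m').map (Int.cast : ℤ → ZMod n) := by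
  rw [diagonal_map Int.cast_zero, diagonal_map Int.cast_zero]
  exact congrArg _ (funext fun i => (ZMod.intCast_eq_intCast_iff _ _ _).2 (h i))

theorem OrbitRelMod.congr_right {n : ℕ} {m : Fin 2 → ℤ} {C D : Matrix (Fin 2) (Fin 2) ℤ} {x y : ℤ}
    (h : OrbitRelMod n m C D x) (hxy : (x : ZMod n) = y) : OrbitRelMod n m C D y := by
  rw [OrbitRelMod, ← hxy]; exact h

theorem map_castHom_map {d n : ℕ} (h : d ∣ n) (X : Matrix (Fin 2) (Fin 2) ℤ) :
    (X.map (Int.cast : ℤ → ZMod n)).map (ZMod.castHom h (ZMod d)) =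
      X.map (Int.cast : ℤ → ZMod d) := by
  ext i j
  simp

theorem OrbitRelMod.of_dvd {d n : ℕ} (hd : d ∣ n) {m : Fin 2 → ℤ} {C D : Matrix (Fin 2) (Fin 2) ℤ}
    {x : ℤ} (h : OrbitRelMod n m C D x) : OrbitRelMod d m C D x := by
  have := OrbitRel.map (ZMod.castHom hd (ZMod d)) h
  rw [map_castHom_map, map_castHom_map, map_castHom_map, map_intCast] at this
  exact this

theorem exists_int_crt {a b : ℕ} (hab : a.Coprime b) (x y : ℤ) :
    ∃ z : ℤ, (z : ZMod a) = x ∧ (z : ZMod b) = y := by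
  obtain ⟨t, ht⟩ := (ZMod.chineseRemainder hab).surjective ((x : ZMod a), (y : ZMod b))
  obtain ⟨z, rfl⟩ := ZMod.intCast_surjective t
  rw [map_intCast] at ht
  exact ⟨z, congrArg Prod.fst ht, congrArg Prod.snd ht⟩

theorem OrbitRelMod.mul {a b : ℕ} (hab : a.Coprime b) {m : Fin 2 → ℤ}
    {C D : Matrix (Fin 2) (Fin 2) ℤ} {x : ℤ} (h : OrbitRelMod a m C D x)
    (h' : OrbitRelMod b m C D x) : OrbitRelMod (a * b) m C D x := by
  refine OrbitRel.glue (ZMod.castHom (dvd_mul_right a b) (ZMod a))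
    (ZMod.castHom (dvd_mul_left b a) (ZMod b)) ?_ ?_ ?_ ?_
  · intro t t' h1 h2
    obtain ⟨t, rfl⟩ := ZMod.intCast_surjective t
    obtain ⟨t', rfl⟩ := ZMod.intCast_surjective t'
    rw [map_intCast, map_intCast] at h1 h2
    apply (ZMod.chineseRemainder hab).injective
    rw [map_intCast, map_intCast]
    exact Prod.ext h1 h2
  · intro r s
    obtain ⟨r, rfl⟩ := ZMod.intCast_surjective r
    obtain ⟨s, rfl⟩ := ZMod.intCast_surjective s
    obtain ⟨z, h1, h2⟩ := exists_int_crt hab r s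
    exact ⟨z, by rw [map_intCast, h1], by rw [map_intCast, h2]⟩
  · rw [map_castHom_map, map_castHom_map, map_castHom_map, map_intCast]
    exact h
  · rw [map_castHom_map, map_castHom_map, map_castHom_map, map_intCast]
    exact h'

theorem OrbitRelMod.of_forall_prime {n : ℕ} (hn : Squarefree n) {m : Fin 2 → ℤ}
    {C D : Matrix (Fin 2) (Fin 2) ℤ} {x : ℤ}
    (h : ∀ p : ℕ, p.Prime → p ∣ n → OrbitRelMod p m C D x) : OrbitRelMod n m C D x := by
  induction n using Nat.recOnPosPrimePosCoprime with
  | zero => exact absurd hn not_squarefree_zero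
  | one =>
    have key : ∀ X Y : Matrix (Fin 2) (Fin 2) (ZMod 1), X = Y := fun X Y => by
      ext i j; exact Subsingleton.elim (α := ZMod 1) _ _
    exact ⟨1, 1, 0, 1, Subsingleton.elim (α := ZMod 1) _ _, ⟨key _ _, key _ _⟩, key _ _, key _ _, 1,
      Subsingleton.elim (α := ZMod 1) _ _⟩
  | prime_pow p n hp hn' =>
    have : n = 1 := by
      rcases (Nat.squarefree_pow_iff hp.ne_one hn'.ne').1 hn with ⟨-, h1⟩
      exact h1
    subst this
    rw [pow_one]
    exact h p hp (by simp)
  | coprime a b ha hb hab iha ihb =>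
    exact OrbitRelMod.mul hab
      (iha (hn.squarefree_of_dvd (Dvd.intro _ rfl)) fun p hp hpa => h p hp (hpa.mul_right _))
      (ihb (hn.squarefree_of_dvd (Dvd.intro_left _ rfl)) fun p hp hpb => h p hp (hpb.mul_left _))

theorem sq_eq_one_of_isUnit {d : ℕ} {ψ : DirichletCharacter ℂ d} (hψ : ψ ^ 2 = 1) {x : ZMod d}
    (hx : IsUnit x) : ψ x ^ 2 = 1 := by
  rw [← MulChar.pow_apply' ψ two_ne_zero, hψ, MulChar.one_apply hx]

theorem OrbitRelMod.isUnit {n : ℕ} {m : Fin 2 → ℤ} {C D : Matrix (Fin 2) (Fin 2) ℤ} {x : ℤ}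
    (h : OrbitRelMod n m C D x) : IsUnit (x : ZMod n) := OrbitRel.isUnit h

/-- The value of a quadratic character at the parameter of the orbit relation is well defined. -/
theorem OrbitRelMod.char_eq {d n : ℕ} (hd : Squarefree d) (hdn : d ∣ n)
    {ψ : DirichletCharacter ℂ d} (hψ : ψ ^ 2 = 1) {m : Fin 2 → ℤ}
    {C D : Matrix (Fin 2) (Fin 2) ℤ} {x x' : ℤ} (h : OrbitRelMod n m C D x)
    (h' : OrbitRelMod n m C D x') : ψ (x : ZMod d) = ψ (x' : ZMod d) := by
  obtain ⟨s, hs⟩ : IsSquare ((x * x' : ℤ) : ZMod d) := by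
    apply isSquare_of_forall_prime hd
    intro p hp hpd
    have := Fact.mk hp
    have h1 := h.of_dvd (hpd.trans hdn)
    have h2 := h'.of_dvd (hpd.trans hdn)
    rw [OrbitRelMod, diagonal_map Int.cast_zero] at h1 h2
    push_cast
    exact OrbitRel.isSquare h1 h2
  have hu := (h.of_dvd hdn).isUnit
  have hu' := (h'.of_dvd hdn).isUnit
  have hsu : IsUnit s := by
    have : IsUnit (s * s) := by rw [← hs, Int.cast_mul]; exact hu.mul hu'
    exact isUnit_of_mul_isUnit_left this
  have e1 : ψ (x : ZMod d) * ψ (x' : ZMod d) = 1 := by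
    rw [← map_mul, ← Int.cast_mul, hs, map_mul, ← pow_two, sq_eq_one_of_isUnit hψ hsu]
  have e2 := sq_eq_one_of_isUnit hψ hu'
  linear_combination ψ (x' : ZMod d) * e1 - ψ (x : ZMod d) * e2

open Classical in
/-- The value of `ψ` at the parameter of the orbit relation modulo `n`, or zero if the pair
`(C, D)` is not in the orbit. -/
noncomputable def localCoeff {d : ℕ} (ψ : DirichletCharacter ℂ d) (n : ℕ) (m : Fin 2 → ℤ)
    (C D : Matrix (Fin 2) (Fin 2) ℤ) : ℂ :=
  if h : ∃ x : ℤ, OrbitRelMod n m C D x then ψ (h.choose : ZMod d) else 0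

theorem localCoeff_eq {d n : ℕ} (hd : Squarefree d) (hdn : d ∣ n)
    {ψ : DirichletCharacter ℂ d} (hψ : ψ ^ 2 = 1) {m : Fin 2 → ℤ}
    {C D : Matrix (Fin 2) (Fin 2) ℤ} {x : ℤ} (h : OrbitRelMod n m C D x) :
    localCoeff ψ n m C D = ψ (x : ZMod d) := by
  have h' : ∃ x : ℤ, OrbitRelMod n m C D x := ⟨x, h⟩
  rw [localCoeff, dif_pos h']
  exact OrbitRelMod.char_eq hd hdn hψ h'.choose_spec h

theorem localCoeff_eq_zero {d n : ℕ} {ψ : DirichletCharacter ℂ d} {m : Fin 2 → ℤ}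
    {C D : Matrix (Fin 2) (Fin 2) ℤ} (h : ∀ x : ℤ, ¬ OrbitRelMod n m C D x) :
    localCoeff ψ n m C D = 0 := by
  rw [localCoeff, dif_neg (not_exists.2 h)]

theorem localCoeff_congr {d n : ℕ} {ψ : DirichletCharacter ℂ d} {m m' : Fin 2 → ℤ}
    (h : DiagModEq n m m') (C D : Matrix (Fin 2) (Fin 2) ℤ) :
    localCoeff ψ n m C D = localCoeff ψ n m' C D := by
  unfold localCoeff OrbitRelMod
  rw [h.map_eq]

/-! ### Components of χ and multiplicativity of the coefficient in the level. -/

section component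
variable {N d e : ℕ} {χ : DirichletCharacter ℂ N}

theorem component_mul_component (h : d * e = N) (hN : N ≠ 0) (hc : d.Coprime e) (x : ℤ) :
    component χ d (x : ZMod d) * component χ e (x : ZMod e) = χ (x : ZMod N) := by
  subst h
  have hd : 0 < d := Nat.pos_of_ne_zero (left_ne_zero_of_mul hN)
  have he : 0 < e := Nat.pos_of_ne_zero (right_ne_zero_of_mul hN)
  have e1 : d * e / d = e := Nat.mul_div_cancel_left e hd
  have e2 : d * e / e = d := Nat.mul_div_cancel d he
  obtain ⟨y, hy1, hy2⟩ := exists_int_crt hc x 1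
  obtain ⟨z, hz1, hz2⟩ := exists_int_crt hc 1 x
  rw [← hy1, ← hz2, component_apply χ (dvd_mul_right d e) (by rwa [e1]) y
    (by rw [e1, hy2, Int.cast_one]), component_apply χ (dvd_mul_left e d) (by rw [e2]; exact hc.symm)
    z (by rw [e2, hz1, Int.cast_one]), ← map_mul, ← Int.cast_mul]
  congr 1
  apply (ZMod.chineseRemainder hc).injective
  rw [map_intCast, map_intCast]
  refine Prod.ext ?_ ?_
  · change ((y * z : ℤ) : ZMod d) = (x : ZMod d)
    rw [Int.cast_mul, hy1, hz1, Int.cast_one, mul_one]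
  · change ((y * z : ℤ) : ZMod e) = (x : ZMod e)
    rw [Int.cast_mul, hy2, hz2, Int.cast_one, one_mul]

theorem component_sq (h : d * e = N) (hN : N ≠ 0) (hc : d.Coprime e) (hχ : χ ^ 2 = 1) :
    component χ d ^ 2 = 1 := by
  subst h
  have hd : 0 < d := Nat.pos_of_ne_zero (left_ne_zero_of_mul hN)
  have e1 : d * e / d = e := Nat.mul_div_cancel_left e hd
  refine MulChar.ext fun u => ?_
  obtain ⟨x, hx⟩ := ZMod.intCast_surjective (u : ZMod d)
  obtain ⟨y, hy1, hy2⟩ := exists_int_crt hc x 1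
  have hyu : IsUnit (y : ZMod (d * e)) := by
    rw [← MulEquiv.isUnit_map (ZMod.chineseRemainder hc), map_intCast, Prod.isUnit_iff]
    refine ⟨?_, ?_⟩
    · change IsUnit (y : ZMod d)
      rw [hy1, hx]; exact u.isUnit
    · change IsUnit (y : ZMod e)
      rw [hy2]; simp
  rw [MulChar.pow_apply' _ two_ne_zero, ← hx, ← hy1, component_apply χ (dvd_mul_right d e)
    (by rwa [e1]) y (by rw [e1, hy2, Int.cast_one]), sq_eq_one_of_isUnit hχ hyu, hy1, hx,
    MulChar.one_apply u.isUnit]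

/-- The coefficient at a product of coprime levels is the product of the coefficients. -/
theorem localCoeff_mul {a b : ℕ} (h : d * e = N) (hN : Squarefree N) (hχ : χ ^ 2 = 1)
    (hda : d ∣ a) (heb : e ∣ b) (hab : a.Coprime b) (m : Fin 2 → ℤ)
    (C D : Matrix (Fin 2) (Fin 2) ℤ) :
    localCoeff χ (a * b) m C D =
      localCoeff (component χ d) a m C D * localCoeff (component χ e) b m C D := by
  have hc : d.Coprime e := Nat.Coprime.of_dvd hda heb hab
  have hd : Squarefree d := hN.squarefree_of_dvd (h ▸ dvd_mul_right d e)
  have he : Squarefree e := hN.squarefree_of_dvd (h ▸ dvd_mul_left e d)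
  by_cases hx : ∃ x : ℤ, OrbitRelMod (a * b) m C D x
  · obtain ⟨x, hx⟩ := hx
    rw [localCoeff_eq hN (h ▸ mul_dvd_mul hda heb) hχ hx,
      localCoeff_eq hd hda (component_sq h hN.ne_zero hc hχ) (hx.of_dvd (dvd_mul_right a b)),
      localCoeff_eq he heb (component_sq ((mul_comm e d).trans h) hN.ne_zero hc.symm hχ)
        (hx.of_dvd (dvd_mul_left b a)), component_mul_component h hN.ne_zero hc]
  · rw [localCoeff_eq_zero (not_exists.1 hx), eq_comm, mul_eq_zero]
    by_contra! hne
    apply hx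
    have h1 : ∃ x : ℤ, OrbitRelMod a m C D x := by
      by_contra hcon
      exact hne.1 (localCoeff_eq_zero (not_exists.1 hcon))
    have h2 : ∃ x : ℤ, OrbitRelMod b m C D x := by
      by_contra hcon
      exact hne.2 (localCoeff_eq_zero (not_exists.1 hcon))
    obtain ⟨x, hx⟩ := h1
    obtain ⟨y, hy⟩ := h2
    -- The parameters at the two levels are unrelated; an integer congruent to both is a parameter
    -- at the product level.
    obtain ⟨z, hz1, hz2⟩ := exists_int_crt hab x y
    exact ⟨z, (hx.congr_right hz1.symm).mul hab (hy.congr_right hz2.symm)⟩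

end component

/-! ### Effect of (C, D) ↦ Q⁻¹ (qC, D) at primes different from q. -/

section scaling
variable {F : Type*} [Field F]

/-- Conjugation by the similitude diag(l, 1) preserves P: it divides B by l and leaves A and E
alone, so the parameter is unchanged while the base becomes l M. -/
theorem OrbitRel.smul_left {R : Type*} [CommRing R] {M C D : Matrix (Fin 2) (Fin 2) R} {x l l' : R}
    (hl : l * l' = 1) (h : OrbitRel M C D x) : OrbitRel (l • M) (l • C) D x := by
  obtain ⟨U, A, B, E, hU, hP, h1, h2, hs⟩ := h
  refine ⟨U, A, l' • B, E, hU, ⟨hP.1, ?_⟩, ?_, ?_, hs⟩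
  · rw [transpose_smul, Matrix.mul_smul, hP.2, Matrix.smul_mul]
  · rw [Matrix.mul_smul, h1, Matrix.smul_mul]
  · rw [h2, Matrix.mul_smul, Matrix.smul_mul, smul_smul, mul_comm, hl, one_smul]

/-- The effect of scaling `C` on the parameter, for the base matrices `0`, `diag(1, 0)`, `1`. -/
theorem OrbitRel.scale {m : Fin 2 → F} {C D : Matrix (Fin 2) (Fin 2) F} {x l f : F} (hl : l ≠ 0)
    (hm : (m = ![0, 0] ∧ f = 1) ∨ (m = ![1, 0] ∧ f = l) ∨ (m = ![1, 1] ∧ f = 1))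
    (h : OrbitRel (Matrix.diagonal m) C D x) :
    OrbitRel (Matrix.diagonal m) (l • C) D (x * f) := by
  have h1 := h.smul_left (mul_inv_cancel₀ hl)
  rw [← diagonal_smul] at h1
  rcases hm with ⟨rfl, rfl⟩ | ⟨rfl, rfl⟩ | ⟨rfl, rfl⟩
  · refine (h1.of_base (OrbitRel.diagonal_base (a := ![1, 1]) (b := ![0, 0]) (e := ![1, 1])
      ?_ ?_ ?_)).mul_sq (s := 1) (by simp) <;> intro i <;> fin_cases i <;> simp
  -- Returning from diag(l, 0) to diag(1, 0) costs l⁻¹, that is l up to a square; in the next case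
  -- the two entries together cost l⁻², a square.
  · refine (h1.of_base (OrbitRel.diagonal_base (a := ![f, 1]) (b := ![1 - f⁻¹, 0])
      (e := ![f⁻¹, 1]) ?_ ?_ ?_)).mul_sq (s := f⁻¹) (by simp; field_simp) <;>
      intro i <;> fin_cases i <;> simp [hl]
  · refine (h1.of_base (OrbitRel.diagonal_base (a := ![l, l]) (b := ![1 - l⁻¹, 1 - l⁻¹])
      (e := ![l⁻¹, l⁻¹]) ?_ ?_ ?_)).mul_sq (s := l⁻¹) (by simp; field_simp) <;>
      intro i <;> fin_cases i <;> simp [hl]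

/-- The effect of left multiplication by a matrix of arbitrary determinant. -/
theorem OrbitRel.mul_left_of_det_ne_zero {m : Fin 2 → F} {C D Q : Matrix (Fin 2) (Fin 2) F} {x : F}
    (hm : m = ![0, 0] ∨ m = ![1, 0] ∨ m = ![1, 1]) (hQ : Q.det ≠ 0)
    (h : OrbitRel (Matrix.diagonal m) C D x) :
    OrbitRel (Matrix.diagonal m) (Q * C) (Q * D) (x * Q.det) := by
  obtain ⟨U, A, B, E, hU, hP, h1, h2, s, hs⟩ := h
  obtain ⟨t, ht⟩ : ∃ t, t = Q.det := ⟨_, rfl⟩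
  rw [← ht] at hQ ⊢
  -- Since Q = W · diag(1, t) · U with det W = 1, only diag(1, t) has to be treated, and there
  -- everything is diagonal. For M = 1 the parameter comes out as t⁻¹, which is t up to a square.
  have hbase : OrbitRel (Matrix.diagonal m) (Matrix.diagonal ![1, t] * Matrix.diagonal m)
      (Matrix.diagonal ![1, t]) t := by
    rw [diagonal_mul_diagonal]
    rcases hm with rfl | rfl | rfl
    · refine (OrbitRel.diagonal_pair (a := ![1, t⁻¹]) (b := ![0, 0]) (e := ![1, t])
        ?_ ?_ ?_).mul_sq (s := 1) (by simp) <;> intro i <;> fin_cases i <;> simp [hQ]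
    · refine (OrbitRel.diagonal_pair (a := ![1, t⁻¹]) (b := ![0, 0]) (e := ![1, t])
        ?_ ?_ ?_).mul_sq (s := 1) (by simp) <;> intro i <;> fin_cases i <;> simp [hQ]
    · refine (OrbitRel.diagonal_pair (a := ![1, t]) (b := ![0, t - t⁻¹]) (e := ![1, t⁻¹])
        ?_ ?_ ?_).mul_sq (s := t⁻¹) (by simp; field_simp) <;> intro i <;> fin_cases i <;> simp [hQ]
  obtain ⟨W, hW⟩ : ∃ W, W = Q * U.adjugate * Matrix.diagonal ![1, t⁻¹] := ⟨_, rfl⟩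
  have hWdet : W.det = 1 := by
    rw [hW, det_mul, det_mul, det_adjugate, hU, ← ht]
    simp [hQ]
  have hd : Matrix.diagonal ![1, t⁻¹] * Matrix.diagonal ![1, t] = (1 : Matrix (Fin 2) (Fin 2) F) := by
    rw [diagonal_mul_diagonal, ← diagonal_one]
    congr 1
    ext i; fin_cases i <;> simp [hQ]
  have hUU : U.adjugate * U = 1 := by rw [adjugate_mul, hU, one_smul]
  have hkey : W * Matrix.diagonal ![1, t] * U = Q := by
    rw [hW, Matrix.mul_assoc (Q * U.adjugate), hd, Matrix.mul_one, Matrix.mul_assoc, hUU,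
      Matrix.mul_one]
  have h3 := (hbase.mul_right hP).mul_left W hWdet
  have e1 : W * (Matrix.diagonal ![1, t] * Matrix.diagonal m * A) = Q * C := by
    rw [← hkey, Matrix.mul_assoc _ U, h1]; simp only [Matrix.mul_assoc]
  have e2 : W * (Matrix.diagonal ![1, t] * Matrix.diagonal m * B + Matrix.diagonal ![1, t] * E) =
      Q * D := by
    rw [← hkey, Matrix.mul_assoc _ U, h2, Matrix.mul_add, Matrix.mul_add]
    simp only [Matrix.mul_assoc]
  rw [e1, e2, hs] at h3
  exact h3.mul_sq (s := s) (by ring)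

/-- The pair (C', D') is Q⁻¹ (l C, D): the scaling contributes f, and Q⁻¹ contributes (det Q)⁻¹,
equal to det Q up to a square. -/
theorem OrbitRel.shift {m : Fin 2 → F} {C D C' D' Q : Matrix (Fin 2) (Fin 2) F} {x l f : F}
    (hl : l ≠ 0) (hQ : Q.det ≠ 0)
    (hm : (m = ![0, 0] ∧ f = 1) ∨ (m = ![1, 0] ∧ f = l) ∨ (m = ![1, 1] ∧ f = 1))
    (hC : l • C = Q * C') (hD : D = Q * D') (h : OrbitRel (Matrix.diagonal m) C D x) :
    OrbitRel (Matrix.diagonal m) C' D' (x * (f * Q.det)) := by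
  have hm' : m = ![0, 0] ∨ m = ![1, 0] ∨ m = ![1, 1] := by
    rcases hm with h | h | h <;> simp [h.1]
  have hu : IsUnit Q.det := isUnit_iff_ne_zero.2 hQ
  have h1 := (h.scale hl hm).mul_left_of_det_ne_zero hm' (Q := Q⁻¹)
    (by rw [det_nonsing_inv]; simpa using hQ)
  rw [hC, hD, nonsing_inv_mul_cancel_left _ _ hu, nonsing_inv_mul_cancel_left _ _ hu,
    det_nonsing_inv, Ring.inverse_eq_inv'] at h1
  exact h1.mul_sq (s := Q.det⁻¹) (by field_simp)

/-- The converse direction, needed so that the coefficients of (C, D) and (C', D') vanish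
simultaneously. -/
theorem OrbitRel.exists_of_shift {m : Fin 2 → F} {C D C' D' Q : Matrix (Fin 2) (Fin 2) F} {x l : F}
    (hl : l ≠ 0) (hQ : Q.det ≠ 0) (hm : m = ![0, 0] ∨ m = ![1, 0] ∨ m = ![1, 1])
    (hC : l • C = Q * C') (hD : D = Q * D') (h : OrbitRel (Matrix.diagonal m) C' D' x) :
    ∃ y, OrbitRel (Matrix.diagonal m) C D y := by
  have h1 := h.mul_left_of_det_ne_zero hm hQ
  obtain ⟨f, hf⟩ : ∃ f, (m = ![0, 0] ∧ f = 1) ∨ (m = ![1, 0] ∧ f = l⁻¹) ∨ (m = ![1, 1] ∧ f = 1) := by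
    rcases hm with h | h | h
    · exact ⟨1, Or.inl ⟨h, rfl⟩⟩
    · exact ⟨_, Or.inr (Or.inl ⟨h, rfl⟩)⟩
    · exact ⟨1, Or.inr (Or.inr ⟨h, rfl⟩)⟩
  have h2 := h1.scale (inv_ne_zero hl) hf
  rw [← hC, ← hD, smul_smul, inv_mul_cancel₀ hl, one_smul] at h2
  exact ⟨_, h2⟩

end scaling

theorem map_cast_smul (n : ℕ) (a : ℤ) (X : Matrix (Fin 2) (Fin 2) ℤ) :
    (a • X).map (Int.cast : ℤ → ZMod n) = (a : ZMod n) • X.map (Int.cast : ℤ → ZMod n) := by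
  ext i j
  rw [Matrix.map_apply, Matrix.smul_apply, smul_eq_mul, Int.cast_mul]
  rfl

/-- The base matrix of a type at a prime. -/
theorem IsTypeMatrix.cases {N₀ N₁ N₂ : ℕ} {m : Fin 2 → ℤ} (hm : IsTypeMatrix N₀ N₁ N₂ m) {p : ℕ}
    (hp : p.Prime) (hpN : p ∣ N₀ * N₁ * N₂) :
    (p ∣ N₀ * N₂ ∧ (fun i => (m i : ZMod p)) = ![0, 0]) ∨
    (p ∣ N₁ ∧ (fun i => (m i : ZMod p)) = ![1, 0]) ∨
    (p ∣ N₀ * N₂ ∧ (fun i => (m i : ZMod p)) = ![1, 1]) := by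
  have key : ∀ a b : ℤ, DiagModEq p m ![a, b] →
      (fun i => (m i : ZMod p)) = ![(a : ZMod p), (b : ZMod p)] := by
    intro a b h
    funext i
    have := (ZMod.intCast_eq_intCast_iff _ _ _).2 (h i)
    rw [this]
    fin_cases i <;> rfl
  obtain ⟨h0, h1, h2⟩ := hm p hp
  rcases (Nat.Prime.dvd_mul hp).1 hpN with h | h
  · rcases (Nat.Prime.dvd_mul hp).1 h with h | h
    · exact Or.inl ⟨h.mul_right _, by simpa using key _ _ (h0 h)⟩
    · exact Or.inr (Or.inl ⟨h, by simpa using key _ _ (h1 h)⟩)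
  · exact Or.inr (Or.inr ⟨h.mul_left _, by simpa using key _ _ (h2 h)⟩)

section
variable {N₀ N₁ N₂ q j : ℕ} {m : Fin 2 → ℤ} {C D C' D' Q : Matrix (Fin 2) (Fin 2) ℤ}

/-- The factor is q^j = det Q at primes dividing N₀N₂; at primes dividing N₁ the scaling of diag(1,
0) adds one more q. The integer y interpolates these values. -/
theorem OrbitRelMod.shift (hsq : Squarefree (N₀ * N₁ * N₂)) (hq : q.Coprime (N₀ * N₁ * N₂))
    (hm : IsTypeMatrix N₀ N₁ N₂ m) (hC : (q : ℤ) • C = Q * C') (hD : D = Q * D')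
    (hQ : Q.det = (q : ℤ) ^ j) {x y : ℤ}
    (hy₀₂ : (y : ZMod (N₀ * N₂)) = (q : ZMod (N₀ * N₂)) ^ j)
    (hy₁ : (y : ZMod N₁) = (q : ZMod N₁) ^ (j + 1)) (h : OrbitRelMod (N₀ * N₁ * N₂) m C D x) :
    OrbitRelMod (N₀ * N₁ * N₂) m C' D' (x * y) := by
  refine OrbitRelMod.of_forall_prime hsq fun p hp hpN => ?_
  have := Fact.mk hp
  have hqp : (q : ZMod p) ≠ 0 := by
    rw [Ne, ZMod.natCast_eq_zero_iff]
    intro hpq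
    exact hp.one_lt.ne' (Nat.dvd_one.1 (hq ▸ Nat.dvd_gcd hpq hpN))
  have h' := h.of_dvd hpN
  have hC' := congrArg (fun X => X.map (Int.cast : ℤ → ZMod p)) hC
  have hD' := congrArg (fun X => X.map (Int.cast : ℤ → ZMod p)) hD
  have hQ' := congrArg (Int.cast : ℤ → ZMod p) hQ
  simp only [map_cast_smul, map_cast_mul, map_cast_det, Int.cast_pow, Int.cast_natCast] at hC' hD' hQ'
  have hQ0 : (Q.map (Int.cast : ℤ → ZMod p)).det ≠ 0 := by rw [hQ']; exact pow_ne_zero _ hqp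
  have cast_eq : ∀ {d : ℕ}, p ∣ d → ∀ {i : ℕ}, (y : ZMod d) = (q : ZMod d) ^ i →
      (y : ZMod p) = (q : ZMod p) ^ i := by
    intro d hd i hi
    have := congrArg (ZMod.castHom hd (ZMod p)) hi
    rwa [map_intCast, map_pow, map_natCast] at this
  rw [OrbitRelMod, diagonal_map Int.cast_zero] at h' ⊢
  rw [Int.cast_mul]
  rcases hm.cases hp hpN with ⟨h1, h2⟩ | ⟨h1, h2⟩ | ⟨h1, h2⟩
  · refine (OrbitRel.shift hqp hQ0 (Or.inl ⟨h2, rfl⟩) hC' hD' h').mul_sq (s := 1) ?_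
    rw [hQ', cast_eq h1 hy₀₂]; ring
  · refine (OrbitRel.shift hqp hQ0 (Or.inr (Or.inl ⟨h2, rfl⟩)) hC' hD' h').mul_sq (s := 1) ?_
    rw [hQ', cast_eq h1 hy₁]; ring
  · refine (OrbitRel.shift hqp hQ0 (Or.inr (Or.inr ⟨h2, rfl⟩)) hC' hD' h').mul_sq (s := 1) ?_
    rw [hQ', cast_eq h1 hy₀₂]; ring

/-- The parameter is found at each prime separately, and the Chinese remainder theorem assembles the
parameters, as the modulus is square-free. -/
theorem OrbitRelMod.exists_of_shift (hsq : Squarefree (N₀ * N₁ * N₂))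
    (hq : q.Coprime (N₀ * N₁ * N₂))
    (hm : IsTypeMatrix N₀ N₁ N₂ m) (hC : (q : ℤ) • C = Q * C') (hD : D = Q * D')
    (hQ : Q.det = (q : ℤ) ^ j) {x : ℤ} (h : OrbitRelMod (N₀ * N₁ * N₂) m C' D' x) :
    ∃ y : ℤ, OrbitRelMod (N₀ * N₁ * N₂) m C D y := by
  have key : ∀ p : ℕ, p.Prime → p ∣ N₀ * N₁ * N₂ → ∃ y : ZMod p,
      OrbitRel ((diagonal m).map (Int.cast : ℤ → ZMod p)) (C.map (Int.cast : ℤ → ZMod p))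
        (D.map (Int.cast : ℤ → ZMod p)) y := by
    intro p hp hpN
    have := Fact.mk hp
    have hqp : (q : ZMod p) ≠ 0 := by
      rw [Ne, ZMod.natCast_eq_zero_iff]
      intro hpq
      exact hp.one_lt.ne' (Nat.dvd_one.1 (hq ▸ Nat.dvd_gcd hpq hpN))
    have h' := h.of_dvd hpN
    have hC' := congrArg (fun X => X.map (Int.cast : ℤ → ZMod p)) hC
    have hD' := congrArg (fun X => X.map (Int.cast : ℤ → ZMod p)) hD
    have hQ' := congrArg (Int.cast : ℤ → ZMod p) hQ
    simp only [map_cast_smul, map_cast_mul, map_cast_det, Int.cast_pow, Int.cast_natCast] at hC' hD' hQ'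
    have hQ0 : (Q.map (Int.cast : ℤ → ZMod p)).det ≠ 0 := by rw [hQ']; exact pow_ne_zero _ hqp
    rw [OrbitRelMod, diagonal_map Int.cast_zero] at h'
    rw [diagonal_map Int.cast_zero]
    refine OrbitRel.exists_of_shift hqp hQ0 ?_ hC' hD' h'
    rcases hm.cases hp hpN with h | h | h
    · exact Or.inl h.2
    · exact Or.inr (Or.inl h.2)
    · exact Or.inr (Or.inr h.2)
  clear h hm hq hQ hC hD
  generalize N₀ * N₁ * N₂ = n at *
  induction n using Nat.recOnPosPrimePosCoprime with
  | zero => exact absurd hsq not_squarefree_zero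
  | one =>
    exact ⟨0, OrbitRelMod.of_forall_prime hsq fun p hp hp1 => absurd (Nat.dvd_one.1 hp1) hp.ne_one⟩
  | prime_pow p n hp hn' =>
    have : n = 1 := by
      rcases (Nat.squarefree_pow_iff hp.ne_one hn'.ne').1 hsq with ⟨-, h1⟩
      exact h1
    subst this
    rw [pow_one]
    obtain ⟨y, hy⟩ := key p hp (by simp)
    obtain ⟨y, rfl⟩ := ZMod.intCast_surjective y
    exact ⟨y, hy⟩
  | coprime a b ha hb hab iha ihb =>
    obtain ⟨y, hy⟩ := iha (hsq.squarefree_of_dvd (Dvd.intro _ rfl))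
      fun p hp hpa => key p hp (hpa.mul_right _)
    obtain ⟨z, hz⟩ := ihb (hsq.squarefree_of_dvd (Dvd.intro_left _ rfl))
      fun p hp hpb => key p hp (hpb.mul_left _)
    obtain ⟨w, hw1, hw2⟩ := exists_int_crt hab y z
    exact ⟨w, (hy.congr_right hw1.symm).mul hab (hz.congr_right hw2.symm)⟩

/-- The prime-to-`q` part of the coefficient changes under the shift by values of components of
the character at `q`. -/
theorem localCoeff_shift {N : ℕ} {χ : DirichletCharacter ℂ N} (hN : Squarefree N) (hχ : χ ^ 2 = 1)
    (hqN : q * (N₀ * N₁ * N₂) = N)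
    (hm : IsTypeMatrix N₀ N₁ N₂ m) (hC : (q : ℤ) • C = Q * C') (hD : D = Q * D')
    (hQ : Q.det = (q : ℤ) ^ j) :
    localCoeff (component χ (N₀ * N₁ * N₂)) (N₀ * N₁ * N₂) m C' D' =
      component χ (N₀ * N₂) (q : ZMod (N₀ * N₂)) ^ j * component χ N₁ (q : ZMod N₁) ^ (j + 1) *
        localCoeff (component χ (N₀ * N₁ * N₂)) (N₀ * N₁ * N₂) m C D := by
  have hsq : Squarefree (N₀ * N₁ * N₂) := hN.squarefree_of_dvd (hqN ▸ dvd_mul_left _ _)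
  have hq : q.Coprime (N₀ * N₁ * N₂) := Nat.coprime_of_squarefree_mul (hqN ▸ hN)
  have hN' : N ≠ 0 := hN.ne_zero
  have hψ := component_sq ((mul_comm _ _).trans hqN) hN' hq.symm hχ
  have e₁ : N₁ * (q * (N₀ * N₂)) = N := by rw [← hqN]; ring
  have e₂ : N₀ * N₂ * (q * N₁) = N := by rw [← hqN]; ring
  have hc₁ : N₁.Coprime (q * (N₀ * N₂)) := Nat.coprime_of_squarefree_mul (e₁ ▸ hN)
  have hc₂ : (N₀ * N₂).Coprime (q * N₁) := Nat.coprime_of_squarefree_mul (e₂ ▸ hN)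
  have hpos : ∀ {a b : ℕ}, a * b = N → N / a = b := by
    intro a b hab
    rw [← hab]
    exact Nat.mul_div_cancel_left b (Nat.pos_of_ne_zero (left_ne_zero_of_mul (hab ▸ hN')))
  -- These integers are q on one part of N and 1 on the complement, so χ takes on them the values of
  -- the components at q. Their combination y below is q^j modulo N₀N₂, q^(j+1) modulo N₁ and 1
  -- modulo q.
  obtain ⟨z₁, hz₁, hz₁'⟩ := exists_int_crt hc₁ q 1
  obtain ⟨z₂, hz₂, hz₂'⟩ := exists_int_crt hc₂ q 1
  have cast_one : ∀ {a b : ℕ}, a ∣ b → ∀ {z : ℤ}, (z : ZMod b) = (1 : ℤ) → (z : ZMod a) = 1 := by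
    intro a b hab z hz
    have := congrArg (ZMod.castHom hab (ZMod a)) hz
    rwa [map_intCast, map_intCast, Int.cast_one] at this
  have hχ₁ : component χ N₁ (q : ZMod N₁) = χ (z₁ : ZMod N) := by
    rw [← component_apply χ (Dvd.intro _ e₁) (by rwa [hpos e₁]) z₁
      (by rw [hpos e₁, hz₁', Int.cast_one]), hz₁, Int.cast_natCast]
  have hχ₂ : component χ (N₀ * N₂) (q : ZMod (N₀ * N₂)) = χ (z₂ : ZMod N) := by
    rw [← component_apply χ (Dvd.intro _ e₂) (by rwa [hpos e₂]) z₂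
      (by rw [hpos e₂, hz₂', Int.cast_one]), hz₂, Int.cast_natCast]
  obtain ⟨y, hy⟩ : ∃ y : ℤ, y = z₂ ^ j * z₁ ^ (j + 1) := ⟨_, rfl⟩
  have e₃ : N₀ * N₁ * N₂ * q = N := by rw [← hqN]; ring
  have hχy : component χ (N₀ * N₁ * N₂) (y : ZMod (N₀ * N₁ * N₂)) =
      component χ (N₀ * N₂) (q : ZMod (N₀ * N₂)) ^ j * component χ N₁ (q : ZMod N₁) ^ (j + 1) := by
    rw [component_apply χ (Dvd.intro _ e₃) (by rw [hpos e₃]; exact hq.symm) y ?_, hχ₁, hχ₂, hy]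
    · push_cast; simp only [map_mul, map_pow]
    · rw [hpos e₃, hy]
      push_cast
      rw [cast_one (dvd_mul_right q _) hz₁', cast_one (dvd_mul_right q _) hz₂']
      simp
  rw [← hχy]
  by_cases hx : ∃ x : ℤ, OrbitRelMod (N₀ * N₁ * N₂) m C D x
  · obtain ⟨x, hx⟩ := hx
    have hx' := hx.shift (y := y) hsq hq hm hC hD hQ (by
      rw [hy]; push_cast
      rw [hz₂, cast_one (dvd_mul_left (N₀ * N₂) q) hz₁']; simp) (by
      rw [hy]; push_cast
      rw [hz₁, cast_one (dvd_mul_left N₁ q) hz₂']; simp)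
    rw [localCoeff_eq hsq dvd_rfl hψ hx, localCoeff_eq hsq dvd_rfl hψ hx', Int.cast_mul, map_mul,
      mul_comm]
  · rw [localCoeff_eq_zero (not_exists.1 hx), mul_zero, localCoeff_eq_zero]
    exact fun x hx' => hx (OrbitRelMod.exists_of_shift hsq hq hm hC hD hQ hx')

end

/-! ### Normal forms at q: symmetric matrices over 𝔽_q, and pairs with C or D of full rank or a unit
row. -/

section normalForms

theorem isSquare_or_eq_mul_sq {q : ℕ} [Fact q.Prime] {ω : ℤ} (hω : legendreSym q ω = -1)
    {a : ZMod q} (ha : a ≠ 0) : ∃ b : ZMod q, b ≠ 0 ∧ (a = b ^ 2 ∨ a = (ω : ZMod q) * b ^ 2) := by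
  have hω0 : (ω : ZMod q) ≠ 0 := by
    intro h
    rw [(legendreSym.eq_zero_iff q ω).2 h] at hω
    norm_num at hω
  rcases quadraticChar_dichotomy ha with h | h
  · obtain ⟨b, hb⟩ := (quadraticChar_one_iff_isSquare ha).1 h
    exact ⟨b, fun h0 => ha (by rw [hb, h0, mul_zero]), Or.inl (by rw [hb, pow_two])⟩
  · have h1 : quadraticChar (ZMod q) (a * (ω : ZMod q)) = 1 := by
      rw [map_mul, h, show quadraticChar (ZMod q) (ω : ZMod q) = -1 from hω]
      norm_num
    obtain ⟨s, hs⟩ := (quadraticChar_one_iff_isSquare (mul_ne_zero ha hω0)).1 h1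
    refine ⟨s / ω, div_ne_zero ?_ hω0, Or.inr ?_⟩
    · rintro rfl
      rw [mul_zero] at hs
      exact mul_ne_zero ha hω0 hs
    · field_simp
      rw [hs, pow_two]

/-- A nondegenerate binary form over 𝔽_q represents 1, by counting values. Consequently it is
SL₂-equivalent to diag(1, det). -/
theorem exists_mul_sq_add_mul_sq {q : ℕ} [Fact q.Prime] (hq : Odd q) {a d : ZMod q} (ha : a ≠ 0)
    (hd : d ≠ 0) : ∃ x y : ZMod q, a * x ^ 2 + d * y ^ 2 = 1 := by
  obtain ⟨x, y, h⟩ := FiniteField.exists_root_sum_quadratic (R := ZMod q)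
    (f := Polynomial.C a * Polynomial.X ^ 2 + Polynomial.C 0 * Polynomial.X + Polynomial.C (-1))
    (g := Polynomial.C d * Polynomial.X ^ 2 + Polynomial.C 0 * Polynomial.X + Polynomial.C 0)
    (Polynomial.degree_quadratic ha) (Polynomial.degree_quadratic hd)
    (by rw [ZMod.card]; exact Nat.odd_iff.1 hq)
  refine ⟨x, y, ?_⟩
  simp at h
  linear_combination h

/-- The representatives of the symmetric `2 × 2` matrices over `𝔽_q` modulo `SL₂`. -/
def IsReducedForm (q : ℕ) (ω : ℤ) (t : Fin 2 → ℤ) : Prop :=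
  t = ![0, 0] ∨ t = ![1, 0] ∨ t = ![ω, 0] ∨ ∃ α : (ZMod q)ˣ, t = ![1, ((α : ZMod q).val : ℤ)]

/-- Symmetric matrices over `𝔽_q` are diagonalized by elements of `SL₂`. -/
theorem exists_diagonalization {q : ℕ} [Fact q.Prime] (hq : Odd q) {ω : ℤ}
    (hω : legendreSym q ω = -1) (S : Matrix (Fin 2) (Fin 2) (ZMod q)) (hS : Sᵀ = S) :
    ∃ U : Matrix (Fin 2) (Fin 2) (ZMod q), U.det = 1 ∧ ∃ t, IsReducedForm q ω t ∧
      U * S * Uᵀ = (diagonal t).map (Int.cast : ℤ → ZMod q) := by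
  have two : (2 : ZMod q) ≠ 0 := by
    have : ((2 : ℕ) : ZMod q) ≠ 0 := by
      rw [Ne, ZMod.natCast_eq_zero_iff, Nat.prime_dvd_prime_iff_eq Fact.out Nat.prime_two]
      rintro rfl
      exact absurd hq (by decide)
    exact_mod_cast this
  have hstep : ∀ (S V : Matrix (Fin 2) (Fin 2) (ZMod q)), V.det = 1 →
      (∃ U : Matrix (Fin 2) (Fin 2) (ZMod q), U.det = 1 ∧ ∃ t, IsReducedForm q ω t ∧
        U * (V * S * Vᵀ) * Uᵀ = (diagonal t).map (Int.cast : ℤ → ZMod q)) →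
      ∃ U : Matrix (Fin 2) (Fin 2) (ZMod q), U.det = 1 ∧ ∃ t, IsReducedForm q ω t ∧
        U * S * Uᵀ = (diagonal t).map (Int.cast : ℤ → ZMod q) := by
    rintro S V hV ⟨U, hU, t, ht, h⟩
    refine ⟨U * V, by rw [det_mul, hU, hV, one_mul], t, ht, ?_⟩
    rw [← h, transpose_mul]
    simp only [Matrix.mul_assoc]
  have hdiag : ∀ a d : ZMod q, a ≠ 0 → ∃ U : Matrix (Fin 2) (Fin 2) (ZMod q), U.det = 1 ∧
      ∃ t, IsReducedForm q ω t ∧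
        U * !![a, 0; 0, d] * Uᵀ = (diagonal t).map (Int.cast : ℤ → ZMod q) := by
    intro a d ha
    by_cases hd : d = 0
    · subst hd
      obtain ⟨b, hb, h | h⟩ := isSquare_or_eq_mul_sq hω ha
      · refine ⟨!![b⁻¹, 0; 0, b], by simp [hb], ![1, 0], Or.inr (Or.inl rfl), ?_⟩
        ext i j
        fin_cases i <;> fin_cases j <;> simp [Matrix.mul_apply, h]
        field_simp
      · refine ⟨!![b⁻¹, 0; 0, b], by simp [hb], ![ω, 0], Or.inr (Or.inr (Or.inl rfl)), ?_⟩
        ext i j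
        fin_cases i <;> fin_cases j <;> simp [Matrix.mul_apply, h]
        field_simp
    · obtain ⟨x, y, hxy⟩ := exists_mul_sq_add_mul_sq hq ha hd
      -- The first row is a vector of value 1 and the second is orthogonal to it for the form; the
      -- determinant is ax² + dy² = 1, and the second value is ad(ax² + dy²) = ad.
      refine ⟨!![x, y; -(d * y), a * x], by rw [det_fin_two_of]; linear_combination hxy,
        ![1, ((a * d : ZMod q).val : ℤ)], Or.inr (Or.inr (Or.inr
          ⟨Units.mk0 (a * d) (mul_ne_zero ha hd), rfl⟩)), ?_⟩
      ext i j
      fin_cases i <;> fin_cases j <;> simp [Matrix.mul_apply]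
      · linear_combination hxy
      · ring
      · ring
      · linear_combination a * d * hxy
  have hmain : ∀ a b c : ZMod q, a ≠ 0 → ∃ U : Matrix (Fin 2) (Fin 2) (ZMod q), U.det = 1 ∧
      ∃ t, IsReducedForm q ω t ∧
        U * !![a, b; b, c] * Uᵀ = (diagonal t).map (Int.cast : ℤ → ZMod q) := by
    intro a b c ha
    -- Completing the square.
    refine hstep _ !![1, 0; -(b / a), 1] (by simp) ?_
    have : !![1, 0; -(b / a), 1] * !![a, b; b, c] * (!![1, 0; -(b / a), 1] : Matrix _ _ (ZMod q))ᵀ =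
        !![a, 0; 0, c - b ^ 2 / a] := by
      ext i j
      fin_cases i <;> fin_cases j <;> simp [Matrix.mul_apply] <;> field_simp <;> ring
    rw [this]
    exact hdiag _ _ ha
  obtain ⟨a, b, c, rfl⟩ : ∃ a b c : ZMod q, S = !![a, b; b, c] := by
    refine ⟨S 0 0, S 0 1, S 1 1, ?_⟩
    have h10 : S 1 0 = S 0 1 := congrFun (congrFun hS 0) 1
    ext i j
    fin_cases i <;> fin_cases j <;> simp [h10]
  by_cases ha : a = 0
  · by_cases hc : c = 0
    · by_cases hb : b = 0
      · subst ha hb hc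
        refine ⟨1, det_one, ![0, 0], Or.inl rfl, ?_⟩
        ext i j
        fin_cases i <;> fin_cases j <;> simp
      · subst ha hc
        -- For a hyperbolic form this makes the first entry 2b, nonzero because q is odd.
        refine hstep _ !![1, 1; 0, 1] (by simp) ?_
        have : !![1, 1; 0, 1] * !![0, b; b, 0] * (!![1, 1; 0, 1] : Matrix _ _ (ZMod q))ᵀ =
            !![2 * b, b; b, 0] := by
          ext i j
          fin_cases i <;> fin_cases j <;> simp [Matrix.mul_apply]
          ring
        rw [this]
        exact hmain _ _ _ (mul_ne_zero two hb)
    · refine hstep _ !![0, 1; -1, 0] (by simp) ?_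
      have : !![0, 1; -1, 0] * !![a, b; b, c] * (!![0, 1; -1, 0] : Matrix _ _ (ZMod q))ᵀ =
          !![c, -b; -b, a] := by
        ext i j
        fin_cases i <;> fin_cases j <;> simp [Matrix.mul_apply]
      rw [this]
      exact hmain _ _ _ hc
  · exact hmain _ _ _ ha

variable {R : Type*} [CommRing R]

/-- From U C = (U C Dᵀ Uᵀ) · ((U D)ᵀ)⁻¹ the block B can be taken to be 0 and E to be U D. So for
invertible D the orbit is governed by the symmetric matrix C Dᵀ under congruence. -/
theorem OrbitRel.of_isUnit_det_right {M C D U : Matrix (Fin 2) (Fin 2) R} (hU : U.det = 1)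
    (hD : IsUnit D.det) (h : U * (C * Dᵀ) * Uᵀ = M) : OrbitRel M C D D.det := by
  have hE : IsUnit (U * D)ᵀ.det := by rw [det_transpose, det_mul, hU, one_mul]; exact hD
  refine ⟨U, ((U * D)ᵀ)⁻¹, 0, U * D, hU, ⟨nonsing_inv_mul _ hE, by simp⟩, ?_, by simp, 1, ?_⟩
  · rw [← h, transpose_mul] at *
    calc U * C = U * C * ((Dᵀ * Uᵀ) * (Dᵀ * Uᵀ)⁻¹) := by rw [mul_nonsing_inv _ hE, Matrix.mul_one]
      _ = _ := by simp only [Matrix.mul_assoc]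
  · rw [det_mul, hU]; ring

/-- Here A = C and E = (Cᵀ)⁻¹, whose determinant is det C up to a square; D only enters B. -/
theorem OrbitRel.of_isUnit_det_left {C D : Matrix (Fin 2) (Fin 2) R} (hC : IsUnit C.det)
    (hs : C * Dᵀ = D * Cᵀ) : OrbitRel 1 C D C.det := by
  have hC' : IsUnit Cᵀ.det := by rwa [det_transpose]
  obtain ⟨c, hc⟩ := hC
  refine ⟨1, C, D - (Cᵀ)⁻¹, (Cᵀ)⁻¹, det_one, ⟨?_, ?_⟩, by simp, by simp, (↑c⁻¹ : R), ?_⟩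
  · rw [← transpose_nonsing_inv, transpose_transpose, mul_nonsing_inv _ (by rw [← hc]; exact c.isUnit)]
  · rw [transpose_sub, Matrix.mul_sub, Matrix.sub_mul, hs, nonsing_inv_mul _ hC',
      ← transpose_nonsing_inv, transpose_transpose, mul_nonsing_inv _ (by rw [← hc]; exact c.isUnit)]
  · rw [det_nonsing_inv, det_transpose, ← hc, Ring.inverse_unit, pow_two, ← mul_assoc,
      Units.mul_inv, one_mul]

/-- The normal form of a pair whose `C` has unit elementary divisor in its first row, in terms of
the rows `c₁, c₂` and `d₁, d₂`. -/
theorem OrbitRel.of_rows {p c₁₁ c₁₂ c₂₁ c₂₂ d₁₁ d₁₂ d₂₁ d₂₂ u v δ : R}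
    (h : u * c₂₁ + v * c₂₂ = 1) (hs : d₁₁ * c₂₁ + d₁₂ * c₂₂ = p * (c₁₁ * d₂₁ + c₁₂ * d₂₂))
    (hδ : δ = d₁₁ * v - d₁₂ * u + p * ((c₁₁ * u + c₁₂ * v) * (d₂₂ * u - d₂₁ * v)))
    (hu : IsUnit δ) :
    OrbitRel (diagonal ![1, p * ((c₁₁ * c₂₂ - c₁₂ * c₂₁) * δ)])
      !![p * c₁₁, p * c₁₂; c₂₁, c₂₂] !![d₁₁, d₁₂; d₂₁, d₂₂] δ := by
  obtain ⟨i, hi⟩ := hu.exists_right_inv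
  obtain ⟨e, he⟩ : ∃ e, e = d₂₂ * u - d₂₁ * v := ⟨_, rfl⟩
  obtain ⟨f, hf⟩ : ∃ f, f = d₂₁ * c₂₁ + d₂₂ * c₂₂ := ⟨_, rfl⟩
  -- The row c₂, which pairs to 1 with w = (u, v), is moved to the top. The other row of C is
  -- negated and p (c₁ · w) c₂ is added; it is then orthogonal to w, hence equals p (c₁₁c₂₂ -
  -- c₁₂c₂₁) (-v, u). The rows of E are dual to those of A, and δ is the factor that the second row
  -- of U D requires.
  refine ⟨!![0, 1; -1, p * (c₁₁ * u + c₁₂ * v)], !![c₂₁, c₂₂; -(v * i), u * i],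
    !![(f - 1) * u - e * c₂₂, (f - 1) * v + e * c₂₁; i * e * u, i * e * v],
    !![u, v; -(δ * c₂₂), δ * c₂₁], by simp, ⟨?_, ?_⟩, ?_, ?_, 1, ?_⟩
  · ext k l
    fin_cases k <;> fin_cases l <;> simp [Matrix.mul_apply]
    · linear_combination h
    · ring
    · ring
    · linear_combination δ * i * h + hi
  · ext k l
    fin_cases k <;> fin_cases l <;> simp [Matrix.mul_apply]
    · ring
    · ring
    · ring
    · ring
  · ext k l
    fin_cases k <;> fin_cases l <;> simp [Matrix.mul_apply]
    · linear_combination (p * c₁₁) * h + (p * (c₁₁ * c₂₂ - c₁₂ * c₂₁) * v) * hi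
    · linear_combination (p * c₁₂) * h - (p * (c₁₁ * c₂₂ - c₁₂ * c₂₁) * u) * hi
  · ext k l
    fin_cases k <;> fin_cases l <;> simp [Matrix.mul_apply]
    · rw [he, hf]; linear_combination -d₂₁ * h
    · rw [he, hf]; linear_combination -d₂₂ * h
    · rw [hδ] at hi ⊢
      rw [he]
      linear_combination (d₁₁ + p * (d₂₂ * u - d₂₁ * v) * c₁₂) * h - u * hs -
        (p * (c₁₁ * c₂₂ - c₁₂ * c₂₁) * (d₂₂ * u - d₂₁ * v) * u) * hi
    · rw [hδ] at hi ⊢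
      rw [he]
      linear_combination (d₁₂ - p * (d₂₂ * u - d₂₁ * v) * c₁₁) * h - v * hs -
        (p * (c₁₁ * c₂₂ - c₁₂ * c₂₁) * (d₂₂ * u - d₂₁ * v) * v) * hi
  · rw [det_fin_two_of]; linear_combination δ * h

/-- The analogue of `OrbitRel.of_rows` when the second row of `D` vanishes. -/
theorem OrbitRel.of_rows_zero {c₁₁ c₁₂ c₂₁ c₂₂ d₁₁ d₁₂ u v δ : R}
    (h : u * c₂₁ + v * c₂₂ = 1) (hs : d₁₁ * c₂₁ + d₁₂ * c₂₂ = 0)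
    (hδ : δ = d₁₁ * v - d₁₂ * u) (hu : IsUnit δ) :
    OrbitRel (diagonal ![1, (c₁₁ * c₂₂ - c₁₂ * c₂₁) * δ])
      !![c₁₁, c₁₂; c₂₁, c₂₂] !![d₁₁, d₁₂; 0, 0] δ := by
  have := OrbitRel.of_rows (p := 1) (c₁₁ := c₁₁) (c₁₂ := c₁₂) (d₁₁ := d₁₁) (d₁₂ := d₁₂)
    (d₂₁ := 0) (d₂₂ := 0) (δ := δ) h (by rw [hs]; ring) (by rw [hδ]; ring) hu
  simpa using this

/-- The second elementary divisor matters only up to squares. -/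
theorem OrbitRel.normalize {p w τ b b' x : R} {C D : Matrix (Fin 2) (Fin 2) R} (hb : b * b' = 1)
    (hw : p * w = p * (τ * b ^ 2)) (h : OrbitRel (diagonal ![1, p * w]) C D x) :
    OrbitRel (diagonal ![1, p * τ]) C D x := by
  -- The parabolic element has E = b' · 1, of square determinant; multiplication by diag(b', b), of
  -- determinant one, then restores the base diag(1, pw).
  have h1 : OrbitRel (diagonal ![1, p * τ]) (diagonal ![b, p * w * b']) (diagonal ![b, b'])
      (b' * b') := by
    refine OrbitRel.diagonal_pair (a := ![b, b]) (b := ![b - b', 0]) (e := ![b', b']) ?_ ?_ ?_ <;>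
      intro i <;> fin_cases i <;> simp [hb]
    linear_combination b' * hw + p * τ * b * hb
  have h2 := h1.mul_left (diagonal ![b', b]) (by simp; rw [mul_comm]; exact hb)
  have e1 : diagonal ![b', b] * diagonal ![b, p * w * b'] = diagonal ![1, p * w] := by
    rw [diagonal_mul_diagonal]
    congr 1
    funext i
    fin_cases i <;> simp
    · rw [mul_comm]; exact hb
    · linear_combination p * w * hb
  have e2 : diagonal ![b', b] * diagonal ![b, b'] = 1 := by
    rw [diagonal_mul_diagonal, ← diagonal_one]
    congr 1
    funext i
    fin_cases i <;> simp
    · rw [mul_comm]; exact hb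
    · exact hb
  rw [e1, e2] at h2
  exact (h.of_base h2).mul_sq (s := b') (by ring)

/-- Over a field, the ranks of two base matrices in the same orbit agree. -/
theorem OrbitRel.rank_eq {F : Type*} [Field F] {m m' : Fin 2 → F} {y : F}
    (h : OrbitRel (diagonal m') (diagonal m) 1 y) :
    (m = 0 ↔ m' = 0) ∧ (m 0 * m 1 = 0 ↔ m' 0 * m' 1 = 0) := by
  obtain ⟨U, A, B, E, hU, hP, h1, -, -⟩ := h
  have hd : ∀ m : Fin 2 → F, (diagonal m).det = m 0 * m 1 := fun m => by
    rw [det_diagonal, Fin.prod_univ_two]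
  have hz : ∀ m : Fin 2 → F, diagonal m = 0 ↔ m = 0 := fun m => by
    rw [← diagonal_zero, diagonal_injective.eq_iff]; rfl
  have hA : A.det ≠ 0 := left_ne_zero_of_mul_eq_one hP.det_mul_det
  constructor
  · constructor
    · rintro rfl
      rw [show (0 : Fin 2 → F) = fun _ => 0 from rfl, diagonal_zero, Matrix.mul_zero] at h1
      rw [← hz]
      calc diagonal m' = diagonal m' * A * Eᵀ := by rw [Matrix.mul_assoc, hP.1, Matrix.mul_one]
        _ = 0 := by rw [← h1, Matrix.zero_mul]
    · rintro rfl
      rw [show (0 : Fin 2 → F) = fun _ => 0 from rfl, diagonal_zero, Matrix.zero_mul] at h1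
      rw [← hz]
      calc diagonal m = U.adjugate * (U * diagonal m) := by
            rw [← Matrix.mul_assoc, adjugate_mul, hU, one_smul, Matrix.one_mul]
        _ = 0 := by rw [h1, Matrix.mul_zero]
  · have := congrArg det h1
    rw [det_mul, det_mul, hU, one_mul, hd, hd] at this
    rw [this, mul_eq_zero, or_iff_left hA]

end normalForms

/-! ### Separating orbits modulo q². -/

section primeSquare
variable {q : ℕ} [Fact q.Prime]

theorem castHom_eq_zero_of_mul_eq_zero {z : ZMod (q ^ 2)} (h : (q : ZMod (q ^ 2)) * z = 0) :
    ZMod.castHom (dvd_pow_self q two_ne_zero) (ZMod q) z = 0 := by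
  obtain ⟨z, rfl⟩ := ZMod.intCast_surjective z
  have hq : (q : ℤ) ≠ 0 := by exact_mod_cast (Fact.out : q.Prime).ne_zero
  rw [← Int.cast_natCast, ← Int.cast_mul, ZMod.intCast_zmod_eq_zero_iff_dvd] at h
  rw [map_intCast, ZMod.intCast_zmod_eq_zero_iff_dvd]
  push_cast at h
  rw [pow_two] at h
  exact Int.dvd_of_mul_dvd_mul_left hq h

/-- Multiplying W (qT) = (qT') A by Wᵀ = q Bᵀ T' + Eᵀ gives q W T Wᵀ = q T' modulo q², since A Eᵀ =
1 and the other term carries q². Cancelling q leaves a congruence modulo q. -/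
theorem OrbitRelMod.exists_congruence {t t' : Fin 2 → ℤ} {y : ℤ}
    (h : OrbitRelMod (q ^ 2) ((q : ℤ) • t') (diagonal ((q : ℤ) • t)) 1 y) :
    ∃ W : Matrix (Fin 2) (Fin 2) (ZMod q), W.det = 1 ∧
      W * (diagonal t).map (Int.cast : ℤ → ZMod q) * Wᵀ =
        (diagonal t').map (Int.cast : ℤ → ZMod q) := by
  obtain ⟨W, A, B, E, hW, hP, h1, h2, -⟩ := h
  have hqt : ∀ t : Fin 2 → ℤ, (diagonal ((q : ℤ) • t)).map (Int.cast : ℤ → ZMod (q ^ 2)) =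
      (q : ZMod (q ^ 2)) • (diagonal t).map (Int.cast : ℤ → ZMod (q ^ 2)) := by
    intro t
    rw [diagonal_smul, map_cast_smul, Int.cast_natCast]
  obtain ⟨T, hT⟩ : ∃ T, T = (diagonal t).map (Int.cast : ℤ → ZMod (q ^ 2)) := ⟨_, rfl⟩
  obtain ⟨T', hT'⟩ : ∃ T', T' = (diagonal t').map (Int.cast : ℤ → ZMod (q ^ 2)) := ⟨_, rfl⟩
  have hT't : T'ᵀ = T' := by rw [hT', ← transpose_map, diagonal_transpose]
  rw [hqt, hqt, ← hT, ← hT'] at h1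
  rw [hqt, ← hT', Matrix.map_one _ Int.cast_zero Int.cast_one, Matrix.mul_one] at h2
  have hqq : (q : ZMod (q ^ 2)) * q = 0 := by
    rw [← pow_two, ← Nat.cast_pow, ZMod.natCast_self]
  have key : (q : ZMod (q ^ 2)) • (W * T * Wᵀ - T') = 0 := by
    calc (q : ZMod (q ^ 2)) • (W * T * Wᵀ - T') =
        W * ((q : ZMod (q ^ 2)) • T) * Wᵀ - (q : ZMod (q ^ 2)) • T' := by
          rw [smul_sub, Matrix.mul_smul, Matrix.smul_mul]
      _ = ((q : ZMod (q ^ 2)) * q) • (T' * A * Bᵀ * T') := by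
          rw [h1, h2, transpose_add, transpose_mul, transpose_smul, hT't, Matrix.mul_add,
            Matrix.mul_assoc _ A Eᵀ, hP.1]
          simp [mul_smul, Matrix.mul_assoc]
      _ = 0 := by rw [hqq, zero_smul]
  refine ⟨W.map (ZMod.castHom (dvd_pow_self q two_ne_zero) (ZMod q)), ?_, ?_⟩
  · have := congrArg (ZMod.castHom (dvd_pow_self q two_ne_zero) (ZMod q)) hW
    rw [RingHom.map_det, map_one] at this
    exact this
  · have e := map_castHom_map (dvd_pow_self q two_ne_zero) (diagonal t)
    have e' := map_castHom_map (dvd_pow_self q two_ne_zero) (diagonal t')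
    rw [← hT] at e
    rw [← hT'] at e'
    rw [← e, ← e', ← transpose_map, ← Matrix.map_mul, ← Matrix.map_mul, ← sub_eq_zero,
      ← Matrix.map_sub _ (map_sub _)]
    ext i j
    exact castHom_eq_zero_of_mul_eq_zero (congrFun (congrFun key i) j)

/-- Modulo q the matrices W and E are upper triangular with the same last entry e, and A has last
entry e⁻¹. The last entries of W · diag(1, qw) = diag(1, qw') · A, divided by q, then give w' = w
e². -/
theorem OrbitRelMod.eq_mul_sq {w w' y : ℤ}
    (h : OrbitRelMod (q ^ 2) ![1, q * w'] (diagonal ![1, q * w]) 1 y) :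
    ∃ b : ZMod q, b ≠ 0 ∧ (w' : ZMod q) = w * b ^ 2 := by
  obtain ⟨W, A, B, E, hW, hP, h1, h2, -⟩ := h
  rw [diagonal_map Int.cast_zero, diagonal_map Int.cast_zero] at h1
  rw [diagonal_map Int.cast_zero, Matrix.map_one _ Int.cast_zero Int.cast_one, Matrix.mul_one] at h2
  have a1 := congrFun (congrFun h1 1) 0
  have a2 := congrFun (congrFun h1 1) 1
  have a3 := congrFun (congrFun h2 1) 0
  have a4 := congrFun (congrFun h2 1) 1
  have a5 := congrFun (congrFun hP.1 1) 1
  obtain ⟨f, hf⟩ : ∃ f, f = ZMod.castHom (dvd_pow_self q two_ne_zero) (ZMod q) := ⟨_, rfl⟩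
  have hfq : f (q : ZMod (q ^ 2)) = 0 := by rw [map_natCast, ZMod.natCast_self]
  simp [Matrix.mul_apply] at a1 a2 a3 a4 a5
  have b0 : f (W 1 0) = 0 := by rw [a1]; simp [hfq]
  have b1 : f (E 1 0) = 0 := by
    have := congrArg f a3
    simpa [b0, hfq] using this.symm
  have b2 : f (W 1 1) = f (E 1 1) := by
    have := congrArg f a4
    simpa [hfq] using this
  have b3 : f (A 1 1) * f (E 1 1) = 1 := by
    have := congrArg f a5
    simpa [b1] using this
  have b4 : f (W 1 1) * w - w' * f (A 1 1) = 0 := by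
    have : f (W 1 1 * w - w' * A 1 1) = 0 := by
      rw [hf]
      apply castHom_eq_zero_of_mul_eq_zero
      linear_combination a2
    simpa using this
  refine ⟨f (E 1 1), right_ne_zero_of_mul_eq_one b3, ?_⟩
  rw [b2] at b4
  linear_combination (w' : ZMod q) * (-b3) - f (E 1 1) * b4

end primeSquare

theorem OrbitRelMod.compare {n : ℕ} {m m' : Fin 2 → ℤ} {C D : Matrix (Fin 2) (Fin 2) ℤ} {x x' : ℤ}
    (h : OrbitRelMod n m C D x) (h' : OrbitRelMod n m' C D x') :
    OrbitRelMod n m' (diagonal m) 1 (x' * x) := by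
  have := OrbitRel.compare h h'
  rw [OrbitRelMod, Matrix.map_one _ Int.cast_zero Int.cast_one, Int.cast_mul]
  exact this

/-! ### The local identities at q. -/

section
variable {q n : ℕ} [Fact q.Prime] {m m' : Fin 2 → ℤ} {C D C' D' : Matrix (Fin 2) (Fin 2) ℤ} {x y : ℤ}
  {ω : ℤ} {ψ : DirichletCharacter ℂ q}

theorem OrbitRelMod.rank_eq (hq : q ∣ n) (h : OrbitRelMod n m' (diagonal m) 1 y) :
    (((m 0 : ZMod q) = 0 ∧ (m 1 : ZMod q) = 0) ↔ ((m' 0 : ZMod q) = 0 ∧ (m' 1 : ZMod q) = 0)) ∧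
    ((m 0 : ZMod q) * m 1 = 0 ↔ (m' 0 : ZMod q) * m' 1 = 0) := by
  have h1 := h.of_dvd hq
  rw [OrbitRelMod, diagonal_map Int.cast_zero, diagonal_map Int.cast_zero,
    Matrix.map_one _ Int.cast_zero Int.cast_one] at h1
  have h2 := OrbitRel.rank_eq h1
  refine ⟨?_, h2.2⟩
  have key : ∀ m : Fin 2 → ZMod q, m = 0 ↔ m 0 = 0 ∧ m 1 = 0 := by
    intro m
    constructor
    · rintro rfl; exact ⟨rfl, rfl⟩
    · rintro ⟨h0, h1⟩; funext i; fin_cases i <;> assumption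
  rw [key, key] at h2
  exact h2.1

omit [Fact q.Prime] in
theorem localCoeff_eq_zero_of_ne (h : OrbitRelMod n m C D x)
    (hne : ∀ y, ¬ OrbitRelMod n m' (diagonal m) 1 y) : localCoeff ψ n m' C D = 0 :=
  localCoeff_eq_zero fun _ h' => hne _ (h.compare h')

theorem localCoeff_eq_zero_of_rank (hq : q ∣ n) (h : OrbitRelMod n m C D x)
    (hne : ¬ ((((m 0 : ZMod q) = 0 ∧ (m 1 : ZMod q) = 0) ↔
        ((m' 0 : ZMod q) = 0 ∧ (m' 1 : ZMod q) = 0)) ∧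
      ((m 0 : ZMod q) * m 1 = 0 ↔ (m' 0 : ZMod q) * m' 1 = 0))) :
    localCoeff ψ n m' C D = 0 :=
  localCoeff_eq_zero_of_ne h fun _ h' => hne (h'.rank_eq hq)

theorem cast_ne_zero_of_legendreSym (hω : legendreSym q ω = -1) : (ω : ZMod q) ≠ 0 := by
  intro h
  rw [(legendreSym.eq_zero_iff q ω).2 h] at hω
  norm_num at hω

theorem not_eq_sq_of_legendreSym (hω : legendreSym q ω = -1) (b : ZMod q) :
    (ω : ZMod q) ≠ b ^ 2 := by
  intro h
  exact (legendreSym.eq_neg_one_iff q).1 hω ⟨b, by rw [h, pow_two]⟩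

/-- As det W = 1, the determinant is an exact invariant, not merely one up to squares, so every α
counts; in rank one the square class of the first entry separates 1 from ω. -/
theorem IsReducedForm.eq_of_congruence (hω : legendreSym q ω = -1) {t t' : Fin 2 → ℤ}
    (ht : IsReducedForm q ω t) (ht' : IsReducedForm q ω t')
    (h : ∃ W : Matrix (Fin 2) (Fin 2) (ZMod q), W.det = 1 ∧
      W * (diagonal t).map (Int.cast : ℤ → ZMod q) * Wᵀ =
        (diagonal t').map (Int.cast : ℤ → ZMod q)) : t = t' := by
  obtain ⟨W, hW, h⟩ := h
  have hω0 := cast_ne_zero_of_legendreSym hω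
  have hω2 := not_eq_sq_of_legendreSym hω
  rw [diagonal_map Int.cast_zero, diagonal_map Int.cast_zero] at h
  have hdet := congrArg det h
  rw [det_mul, det_mul, det_transpose, hW, det_diagonal, det_diagonal, Fin.prod_univ_two,
    Fin.prod_univ_two] at hdet
  have h00 := congrFun (congrFun h 0) 0
  simp [Matrix.mul_apply, diagonal_apply] at h00 hdet
  have hWt : (t 0 : ZMod q) = 0 → (t 1 : ZMod q) = 0 → (t' 0 : ZMod q) = 0 := by
    intro h0 h1
    rw [← h00, h0, h1]; ring
  have hWt' : (t' 0 : ZMod q) = 0 → (t' 1 : ZMod q) = 0 → (t 0 : ZMod q) = 0 := by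
    intro h0 h1
    have : (diagonal fun i => (t' i : ZMod q)) = 0 := by
      ext i j; fin_cases i <;> fin_cases j <;> simp [h0, h1]
    rw [this] at h
    have h2 : W.adjugate * (W * (diagonal fun i => (t i : ZMod q)) * Wᵀ) * W.adjugateᵀ = 0 := by
      rw [show W * (diagonal fun i => (t i : ZMod q)) * Wᵀ = 0 from h]; simp
    rw [← Matrix.mul_assoc, ← Matrix.mul_assoc, adjugate_mul, hW, one_smul, Matrix.one_mul,
      Matrix.mul_assoc, ← transpose_mul, adjugate_mul, hW, one_smul, transpose_one,
      Matrix.mul_one] at h2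
    simpa using congrFun (congrFun h2 0) 0
  rcases ht with rfl | rfl | rfl | ⟨α, rfl⟩ <;> rcases ht' with rfl | rfl | rfl | ⟨β, rfl⟩ <;>
    simp [hω0] at hWt hWt' hdet h00 ⊢
  · exact absurd (by rw [← h00]; ring) (hω2 (W 0 0))
  · exact absurd hdet.symm β.ne_zero
  · exfalso
    apply hω2 (W 0 0)⁻¹
    have : W 0 0 ≠ 0 := by rintro h0; simp [h0] at h00
    field_simp
    linear_combination h00
  · exact absurd hdet.symm β.ne_zero
  · rw [hdet]

theorem localCoeff_smul_eq_zero (hω : legendreSym q ω = -1) {t t' : Fin 2 → ℤ}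
    (ht : IsReducedForm q ω t) (ht' : IsReducedForm q ω t') (hne : t ≠ t')
    (h : OrbitRelMod (q ^ 2) ((q : ℤ) • t) C D x) :
    localCoeff ψ (q ^ 2) ((q : ℤ) • t') C D = 0 :=
  localCoeff_eq_zero_of_ne h fun _ h' => hne (ht.eq_of_congruence hω ht' h'.exists_congruence)

/-- Modulo q, diag(ω, 0) and diag(1, 0) share an orbit, and the change of base costs ω. This, with
`OrbitRelMod.base_one_one`, is the source of the weights χ_q(ω) and χ_q(α). -/
theorem OrbitRelMod.base_one_zero (hω : (ω : ZMod q) ≠ 0) (h : OrbitRelMod q ![ω, 0] C D x) :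
    OrbitRelMod q ![1, 0] C D (ω * x) := by
  have h0 : OrbitRel ((diagonal ![1, 0]).map (Int.cast : ℤ → ZMod q))
      ((diagonal ![ω, 0]).map (Int.cast : ℤ → ZMod q)) 1 (ω : ZMod q) := by
    rw [diagonal_map Int.cast_zero, diagonal_map Int.cast_zero]
    refine (OrbitRel.diagonal_base (a := ![(ω : ZMod q), 1]) (b := ![1 - (ω : ZMod q)⁻¹, 0])
      (e := ![(ω : ZMod q)⁻¹, 1]) ?_ ?_ ?_).mul_sq (s := (ω : ZMod q)⁻¹) (by simp; field_simp) <;>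
      intro i <;> fin_cases i <;> simp [hω]
  have h1 := OrbitRel.of_base h h0
  rw [OrbitRelMod, Int.cast_mul]
  exact h1

theorem OrbitRelMod.base_one_one {u : ℤ} (hu : (u : ZMod q) ≠ 0) (h : OrbitRelMod q ![1, u] C D x) :
    OrbitRelMod q ![1, 1] C D (u * x) := by
  have h0 : OrbitRel ((diagonal ![1, 1]).map (Int.cast : ℤ → ZMod q))
      ((diagonal ![1, u]).map (Int.cast : ℤ → ZMod q)) 1 (u : ZMod q) := by
    rw [diagonal_map Int.cast_zero, diagonal_map Int.cast_zero]
    refine (OrbitRel.diagonal_base (a := ![1, (u : ZMod q)]) (b := ![0, 1 - (u : ZMod q)⁻¹])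
      (e := ![1, (u : ZMod q)⁻¹]) ?_ ?_ ?_).mul_sq (s := (u : ZMod q)⁻¹) (by simp; field_simp) <;>
      intro i <;> fin_cases i <;> simp [hu]
  have h1 := OrbitRel.of_base h h0
  rw [OrbitRelMod, Int.cast_mul]
  exact h1

theorem isUnit_intCast_sq {a : ℤ} (ha : (a : ZMod q) ≠ 0) : IsUnit (a : ZMod (q ^ 2)) := by
  have : IsCoprime a ((q ^ 2 : ℕ) : ℤ) := by
    push_cast
    refine IsCoprime.pow_right ?_
    rw [isCoprime_comm, Prime.coprime_iff_not_dvd (Nat.prime_iff_prime_int.1 Fact.out),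
      ← ZMod.intCast_zmod_eq_zero_iff_dvd]
    exact ha
  exact (ZMod.coe_int_isUnit_iff_isCoprime a (q ^ 2)).2 this.symm

/-- One U diagonalises C Dᵀ modulo q, and (qC) Dᵀ modulo q² depends only on C Dᵀ modulo q, so a lift
of U works there too. Both relations have the same parameter det D. -/
theorem exists_orbitRelMod_of_det_ne_zero (hq : Odd q) (hω : legendreSym q ω = -1)
    (hs : C * Dᵀ = D * Cᵀ) (hD : (D.det : ZMod q) ≠ 0) :
    ∃ t, IsReducedForm q ω t ∧ OrbitRelMod q t C D D.det ∧
      OrbitRelMod (q ^ 2) ((q : ℤ) • t) ((q : ℤ) • C) D D.det := by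
  obtain ⟨U, hU, t, ht, hUt⟩ := exists_diagonalization hq hω
    ((C * Dᵀ).map (Int.cast : ℤ → ZMod q)) (by
      rw [← transpose_map, transpose_mul, transpose_transpose, hs])
  refine ⟨t, ht, ?_, ?_⟩
  · rw [OrbitRelMod, map_cast_det]
    refine OrbitRel.of_isUnit_det_right hU ?_ ?_
    · rw [← map_cast_det]; exact isUnit_iff_ne_zero.2 hD
    · rw [← hUt, map_cast_mul, transpose_map]
  · obtain ⟨V, hV, rfl⟩ := exists_int_det_eq_one_lift U hU
    rw [OrbitRelMod, map_cast_det]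
    refine OrbitRel.of_isUnit_det_right (U := V.map (Int.cast : ℤ → ZMod (q ^ 2))) ?_ ?_ ?_
    · rw [← map_cast_det, hV, Int.cast_one]
    · rw [← map_cast_det]; exact isUnit_intCast_sq hD
    · rw [← transpose_map, ← transpose_map, ← map_cast_mul, ← map_cast_mul, ← map_cast_mul,
        ← sub_eq_zero]
      rw [← transpose_map, ← map_cast_mul, ← map_cast_mul] at hUt
      ext i j
      have := congrFun (congrFun hUt i) j
      rw [Matrix.map_apply, Matrix.map_apply, ZMod.intCast_eq_intCast_iff_dvd_sub] at this
      rw [Matrix.sub_apply, Matrix.map_apply, Matrix.map_apply, ← Int.cast_sub, Matrix.zero_apply,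
        ZMod.intCast_zmod_eq_zero_iff_dvd]
      have e : (V * ((q : ℤ) • C * Dᵀ) * Vᵀ) i j - diagonal ((q : ℤ) • t) i j =
          -(q * (diagonal t i j - (V * (C * Dᵀ) * Vᵀ) i j)) := by
        rw [diagonal_smul, Matrix.smul_mul, Matrix.mul_smul, Matrix.smul_mul, Matrix.smul_apply,
          Matrix.smul_apply, smul_eq_mul, smul_eq_mul]
        ring
      rw [e, dvd_neg]
      push_cast
      rw [pow_two]
      exact mul_dvd_mul_left _ this

/-- The local identities at `q` when `D` is invertible modulo `q`. -/
theorem localCoeff_of_det_ne_zero (hq : Odd q) (hω : legendreSym q ω = -1) (hψ : ψ ^ 2 = 1)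
    (hs : C * Dᵀ = D * Cᵀ) (hD : (D.det : ZMod q) ≠ 0) :
    (localCoeff ψ q ![0, 0] C D = localCoeff ψ (q ^ 2) ![0, 0] ((q : ℤ) • C) D) ∧
    (localCoeff ψ q ![1, 0] C D = localCoeff ψ (q ^ 2) ![(q : ℤ), 0] ((q : ℤ) • C) D +
      ψ (ω : ZMod q) * localCoeff ψ (q ^ 2) ![(q : ℤ) * ω, 0] ((q : ℤ) • C) D ∧
      localCoeff ψ (q ^ 2) ![1, 0] ((q : ℤ) • C) D = 0) ∧
    (localCoeff ψ q ![1, 1] C D = ∑ α : (ZMod q)ˣ, ψ (α : ZMod q) *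
        localCoeff ψ (q ^ 2) ![(q : ℤ), (q : ℤ) * ((α : ZMod q).val : ℤ)] ((q : ℤ) • C) D ∧
      localCoeff ψ (q ^ 2) ![1, (q : ℤ)] ((q : ℤ) • C) D = 0 ∧
      localCoeff ψ (q ^ 2) ![1, (q : ℤ) * ω] ((q : ℤ) • C) D = 0 ∧
      localCoeff ψ q ![1, 1] ((q : ℤ) • C) D = 0) := by
  obtain ⟨t, ht, h1, h2⟩ := exists_orbitRelMod_of_det_ne_zero hq hω hs hD
  have hqq : q ∣ q ^ 2 := dvd_pow_self q two_ne_zero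
  have hqs : Squarefree q := (Fact.out : q.Prime).squarefree
  have hω0 := cast_ne_zero_of_legendreSym hω
  have hω1 : ω ≠ 1 := by
    rintro rfl
    exact not_eq_sq_of_legendreSym hω 1 (by simp)
  have hωz : ω ≠ 0 := by
    rintro rfl
    simp at hω0
  have e0 : (![0, 0] : Fin 2 → ℤ) = (q : ℤ) • ![0, 0] := by simp
  have e1 : (![(q : ℤ), 0] : Fin 2 → ℤ) = (q : ℤ) • ![1, 0] := by simp
  have e2 : (![(q : ℤ) * ω, 0] : Fin 2 → ℤ) = (q : ℤ) • ![ω, 0] := by simp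
  have e3 : ∀ α : (ZMod q)ˣ, (![(q : ℤ), (q : ℤ) * ((α : ZMod q).val : ℤ)] : Fin 2 → ℤ) =
    (q : ℤ) • ![1, ((α : ZMod q).val : ℤ)] := by intro α; simp
  have r0 : IsReducedForm q ω ![0, 0] := Or.inl rfl
  have r1 : IsReducedForm q ω ![1, 0] := Or.inr (Or.inl rfl)
  have r2 : IsReducedForm q ω ![ω, 0] := Or.inr (Or.inr (Or.inl rfl))
  have r3 : ∀ α : (ZMod q)ˣ, IsReducedForm q ω ![1, ((α : ZMod q).val : ℤ)] :=
    fun α => Or.inr (Or.inr (Or.inr ⟨α, rfl⟩))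
  have z := fun t' (ht' : IsReducedForm q ω t') (hne : t ≠ t') =>
    localCoeff_smul_eq_zero (ψ := ψ) hω ht ht' hne h2
  have nz : ∀ t', IsReducedForm q ω t' → t' = t →
      localCoeff ψ (q ^ 2) ((q : ℤ) • t') ((q : ℤ) • C) D = ψ (D.det : ZMod q) := by
    rintro t' - rfl
    exact localCoeff_eq hqs hqq hψ h2
  have z' := fun t' => localCoeff_eq_zero_of_rank (ψ := ψ) (m' := t') hqq h2
  have zq := fun t' => localCoeff_eq_zero_of_rank (ψ := ψ) (m' := t') dvd_rfl h1
  have zq' := fun t' => localCoeff_eq_zero_of_rank (ψ := ψ) (m' := t') dvd_rfl (h2.of_dvd hqq)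
  have hval : ∀ α : (ZMod q)ˣ, ((α : ZMod q).cast : ℤ) ≠ 0 := by
    intro α h
    rw [← ZMod.natCast_val, Nat.cast_eq_zero] at h
    exact α.ne_zero ((ZMod.val_eq_zero _).1 h)
  -- The block qC vanishes modulo q, so base matrices that are nonzero modulo q cannot contribute.
  rw [z' ![1, 0] (by simp), z' ![1, (q : ℤ)] (by simp), z' ![1, (q : ℤ) * ω] (by simp),
    zq' ![1, 1] (by simp), e0, e1, e2]
  simp only [e3]
  refine ⟨?_, ⟨?_, trivial⟩, ?_, trivial, trivial, trivial⟩
  · rw [← e0]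
    by_cases htt : t = ![0, 0]
    · rw [e0, nz _ r0 htt.symm, ← e0]
      subst htt
      exact localCoeff_eq hqs dvd_rfl hψ h1
    · rw [e0, z _ r0 htt, ← e0, zq]
      rcases ht with rfl | rfl | rfl | ⟨α, rfl⟩
      · exact absurd rfl htt
      · simp
      · simp [hω0]
      · simp
  · rcases ht with rfl | rfl | rfl | ⟨α, rfl⟩
    · rw [z _ r1 (by simp), z _ r2 (by simp [hωz.symm]), zq _ (by simp)]; simp
    · rw [nz _ r1 rfl, z _ r2 (by simp [hω1.symm]), localCoeff_eq hqs dvd_rfl hψ h1]; simp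
    · rw [nz _ r2 rfl, z _ r1 (by simp [hω1]),
        localCoeff_eq hqs dvd_rfl hψ (h1.base_one_zero hω0), Int.cast_mul, map_mul, zero_add]
    · rw [z _ r1 (by simp [hval]), z _ r2 (by simp [hval]), zq _ (by simp)]; simp
  · rcases ht with rfl | rfl | rfl | ⟨α, rfl⟩
    · rw [zq _ (by simp), Finset.sum_eq_zero]
      intro α _
      rw [z _ (r3 α) (by simp), mul_zero]
    · rw [zq _ (by simp), Finset.sum_eq_zero]
      intro α _
      rw [z _ (r3 α) (by simp [(hval α).symm]), mul_zero]
    · rw [zq _ (by simp), Finset.sum_eq_zero]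
      intro α _
      rw [z _ (r3 α) (by simp [(hval α).symm]), mul_zero]
    · have hα : ((((α : ZMod q).val : ℤ)) : ZMod q) = α := by simp
      rw [Finset.sum_eq_single α, nz _ (r3 α) rfl,
        localCoeff_eq hqs dvd_rfl hψ (h1.base_one_one (by rw [hα]; exact α.ne_zero)),
        Int.cast_mul, map_mul, hα]
      · intro β _ hβ
        rw [z _ (r3 β), mul_zero]
        intro h
        have := congrFun h 1
        simp only [cons_val_one, cons_val_fin_one, Nat.cast_inj] at this
        exact hβ (Units.ext (ZMod.val_injective q this.symm))
      · simp

/-- The local identities at `q` when `D` has rank one modulo `q`. -/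
theorem localCoeff_of_rank_one (hω : legendreSym q ω = -1) (hψ : ψ ^ 2 = 1)
    {c₁₁ c₁₂ c₂₁ c₂₂ d₁₁ d₁₂ d₂₁ d₂₂ : ℤ}
    (hs : d₁₁ * c₂₁ + d₁₂ * c₂₂ = q * (c₁₁ * d₂₁ + c₁₂ * d₂₂))
    (hc : ¬ ((c₂₁ : ZMod q) = 0 ∧ (c₂₂ : ZMod q) = 0))
    (hd : ¬ ((d₁₁ : ZMod q) = 0 ∧ (d₁₂ : ZMod q) = 0))
    (hC : C = !![c₁₁, c₁₂; c₂₁, c₂₂]) (hD : D = !![d₁₁, d₁₂; q * d₂₁, q * d₂₂])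
    (hC' : C' = !![q * c₁₁, q * c₁₂; c₂₁, c₂₂]) (hD' : D' = !![d₁₁, d₁₂; d₂₁, d₂₂]) :
    (localCoeff ψ q ![0, 0] C D = 0 ∧ localCoeff ψ (q ^ 2) ![0, 0] C' D' = 0) ∧
    (localCoeff ψ q ![1, 0] C D = localCoeff ψ (q ^ 2) ![1, 0] C' D' ∧
      localCoeff ψ (q ^ 2) ![(q : ℤ), 0] C' D' = 0 ∧
      localCoeff ψ (q ^ 2) ![(q : ℤ) * ω, 0] C' D' = 0) ∧
    (localCoeff ψ q ![1, 1] C D = localCoeff ψ (q ^ 2) ![1, (q : ℤ)] C' D' +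
        ψ (ω : ZMod q) * localCoeff ψ (q ^ 2) ![1, (q : ℤ) * ω] C' D' ∧
      (∀ a : ℤ, localCoeff ψ (q ^ 2) ![(q : ℤ), (q : ℤ) * a] C' D' = 0) ∧
      localCoeff ψ q ![1, 1] C' D' = 0) := by
  have hqq : q ∣ q ^ 2 := dvd_pow_self q two_ne_zero
  have hqs : Squarefree q := (Fact.out : q.Prime).squarefree
  have hω0 := cast_ne_zero_of_legendreSym hω
  obtain ⟨u, v, huv⟩ : ∃ u v : ℤ, ((u * c₂₁ + v * c₂₂ : ℤ) : ZMod (q ^ 2)) = 1 := by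
    by_cases h : (c₂₁ : ZMod q) = 0
    · have h' : (c₂₂ : ZMod q) ≠ 0 := fun h' => hc ⟨h, h'⟩
      obtain ⟨v, hv⟩ := (isUnit_intCast_sq h').exists_left_inv
      obtain ⟨v, rfl⟩ := ZMod.intCast_surjective v
      exact ⟨0, v, by push_cast; rw [hv]; ring⟩
    · obtain ⟨v, hv⟩ := (isUnit_intCast_sq h).exists_left_inv
      obtain ⟨v, rfl⟩ := ZMod.intCast_surjective v
      exact ⟨v, 0, by push_cast; rw [hv]; ring⟩
  have huv' : ((u * c₂₁ + v * c₂₂ : ℤ) : ZMod q) = 1 := by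
    have := congrArg (ZMod.castHom hqq (ZMod q)) huv
    rwa [map_intCast, map_one] at this
  obtain ⟨δ, hδ⟩ : ∃ δ, δ = d₁₁ * v - d₁₂ * u +
    q * ((c₁₁ * u + c₁₂ * v) * (d₂₂ * u - d₂₁ * v)) := ⟨_, rfl⟩
  have hδ' : (δ : ZMod q) = d₁₁ * v - d₁₂ * u := by rw [hδ]; push_cast; simp
  have hs' : (d₁₁ : ZMod q) * c₂₁ + d₁₂ * c₂₂ = 0 := by
    have := congrArg (Int.cast : ℤ → ZMod q) hs
    push_cast at this
    rw [this, ZMod.natCast_self, zero_mul]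
  push_cast at huv huv'
  -- Modulo q, d₁ pairs to 0 with c₂ and to δ with (v, -u). These two vectors form a basis because u
  -- c₂₁ + v c₂₂ = 1, so δ = 0 would force d₁ = 0.
  have hδ0 : (δ : ZMod q) ≠ 0 := by
    intro h0
    rw [hδ'] at h0
    apply hd
    constructor
    · linear_combination (-(d₁₁ : ZMod q)) * huv' + (u : ZMod q) * hs' + (c₂₂ : ZMod q) * h0
    · linear_combination (-(d₁₂ : ZMod q)) * huv' + (v : ZMod q) * hs' - (c₂₁ : ZMod q) * h0
  obtain ⟨w, hw⟩ : ∃ w, w = (c₁₁ * c₂₂ - c₁₂ * c₂₁) * δ := ⟨_, rfl⟩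
  have h1 : OrbitRelMod q ![1, w] C D δ := by
    have := OrbitRel.of_rows_zero (c₁₁ := (c₁₁ : ZMod q)) (c₁₂ := c₁₂) huv' hs' hδ'
      (isUnit_iff_ne_zero.2 hδ0)
    rw [OrbitRelMod, diagonal_map Int.cast_zero]
    convert this using 1
    · congr 1
      funext i; fin_cases i <;> simp [hw]
    · rw [hC]; ext i j; fin_cases i <;> fin_cases j <;> simp
    · rw [hD]; ext i j; fin_cases i <;> fin_cases j <;> simp
  have h2 : OrbitRelMod (q ^ 2) ![1, q * w] C' D' δ := by
    have hsR : (d₁₁ : ZMod (q ^ 2)) * c₂₁ + d₁₂ * c₂₂ = q * (c₁₁ * d₂₁ + c₁₂ * d₂₂) := by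
      exact_mod_cast congrArg (Int.cast : ℤ → ZMod (q ^ 2)) hs
    have hδR : (δ : ZMod (q ^ 2)) = d₁₁ * v - d₁₂ * u +
        q * ((c₁₁ * u + c₁₂ * v) * (d₂₂ * u - d₂₁ * v)) := by
      exact_mod_cast congrArg (Int.cast : ℤ → ZMod (q ^ 2)) hδ
    have := OrbitRel.of_rows huv hsR hδR (isUnit_intCast_sq hδ0)
    rw [OrbitRelMod, diagonal_map Int.cast_zero]
    convert this using 1
    · congr 1
      funext i; fin_cases i <;> simp [hw]
    · rw [hC']; ext i j; fin_cases i <;> fin_cases j <;> simp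
    · rw [hD']; ext i j; fin_cases i <;> fin_cases j <;> simp
  -- The same w governs diag(1, w) modulo q and diag(1, qw) modulo q². Its class up to nonzero
  -- squares decides which of diag(1, 0), diag(1, q), diag(1, qω) is the base of (C', D').
  have hnorm : ∃ τ : ℤ, (τ = 0 ∨ τ = 1 ∨ τ = ω) ∧ ∃ b : ZMod q, b ≠ 0 ∧ (w : ZMod q) = τ * b ^ 2 := by
    by_cases h : (w : ZMod q) = 0
    · exact ⟨0, Or.inl rfl, 1, one_ne_zero, by simpa using h⟩
    · obtain ⟨b, hb, h | h⟩ := isSquare_or_eq_mul_sq hω h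
      · exact ⟨1, Or.inr (Or.inl rfl), b, hb, by simpa using h⟩
      · exact ⟨ω, Or.inr (Or.inr rfl), b, hb, h⟩
  obtain ⟨τ, hτ, b, hb, hwb⟩ := hnorm
  have h3 : OrbitRelMod q ![1, τ] C D δ := by
    have hd : ∀ a : ℤ, (fun i => ((![1, a] i : ℤ) : ZMod q)) = ![1, 1 * (a : ZMod q)] := by
      intro a; funext i; fin_cases i <;> simp
    rw [OrbitRelMod, diagonal_map Int.cast_zero, hd] at h1 ⊢
    exact h1.normalize (mul_inv_cancel₀ hb) (by rw [hwb])
  have h4 : OrbitRelMod (q ^ 2) ![1, q * τ] C' D' δ := by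
    have hd : ∀ a : ℤ, (fun i => ((![1, q * a] i : ℤ) : ZMod (q ^ 2))) =
        ![1, (q : ZMod (q ^ 2)) * (a : ZMod (q ^ 2))] := by
      intro a; funext i; fin_cases i <;> simp
    rw [OrbitRelMod, diagonal_map Int.cast_zero, hd] at h2 ⊢
    obtain ⟨b, rfl⟩ := ZMod.intCast_surjective b
    obtain ⟨b', hb'⟩ := (isUnit_intCast_sq hb).exists_right_inv
    refine h2.normalize hb' ?_
    have hdvd : (q : ℤ) ∣ w - τ * b ^ 2 := by
      rw [← ZMod.intCast_zmod_eq_zero_iff_dvd]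
      push_cast
      rw [hwb, sub_self]
    have : (((q : ℤ) * (w - τ * b ^ 2) : ℤ) : ZMod (q ^ 2)) = 0 := by
      rw [ZMod.intCast_zmod_eq_zero_iff_dvd]
      push_cast
      rw [pow_two]
      exact mul_dvd_mul_left _ hdvd
    push_cast at this
    linear_combination this
  have z' := fun t' => localCoeff_eq_zero_of_rank (ψ := ψ) (m' := t') hqq h4
  have zq := fun t' => localCoeff_eq_zero_of_rank (ψ := ψ) (m' := t') dvd_rfl h3
  have zq' := fun t' => localCoeff_eq_zero_of_rank (ψ := ψ) (m' := t') dvd_rfl (h4.of_dvd hqq)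
  have zs : ∀ τ' : ℤ, (∀ b : ZMod q, b ≠ 0 → (τ' : ZMod q) ≠ τ * b ^ 2) →
      localCoeff ψ (q ^ 2) ![1, (q : ℤ) * τ'] C' D' = 0 := by
    intro τ' hne
    refine localCoeff_eq_zero_of_ne h4 fun _ h' => ?_
    obtain ⟨b, hb, h⟩ := h'.eq_mul_sq
    exact hne b hb h
  have hsq := not_eq_sq_of_legendreSym hω
  have hsq' : ∀ b : ZMod q, b ≠ 0 → (1 : ZMod q) ≠ ω * b ^ 2 := by
    intro b hb h
    apply hsq b⁻¹
    field_simp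
    rw [h]
  rw [zq _ (by simp), z' ![0, 0] (by simp), z' ![(q : ℤ), 0] (by simp),
    z' ![(q : ℤ) * ω, 0] (by simp), zq' ![1, 1] (by simp)]
  refine ⟨⟨rfl, rfl⟩, ⟨?_, rfl, rfl⟩, ?_, fun a => z' _ (by simp), rfl⟩
  · have e : (![1, 0] : Fin 2 → ℤ) = ![1, (q : ℤ) * 0] := by simp
    rcases hτ with rfl | rfl | rfl
    · rw [localCoeff_eq hqs dvd_rfl hψ h3, e, localCoeff_eq hqs hqq hψ h4]
    · rw [zq _ (by simp), e, zs]
      intro b hb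
      simpa using (pow_ne_zero 2 hb).symm
    · rw [zq _ (by simp [hω0]), e, zs]
      intro b hb
      simpa [hω0] using hb
  · have e : (![1, (q : ℤ)] : Fin 2 → ℤ) = ![1, (q : ℤ) * 1] := by simp
    rw [e]
    rcases hτ with rfl | rfl | rfl
    · rw [zq _ (by simp), zs _ (by simp), zs _ (by simp [hω0])]; simp
    · rw [localCoeff_eq hqs dvd_rfl hψ h3, localCoeff_eq hqs hqq hψ h4, zs ω
        (fun b _ => by simpa using hsq b)]
      simp
    · rw [localCoeff_eq hqs dvd_rfl hψ (h3.base_one_one hω0), localCoeff_eq hqs hqq hψ h4,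
        zs 1 (fun b hb => by simpa using hsq' b hb), Int.cast_mul, map_mul, zero_add]

/-- The local identities at `q` when `D` vanishes modulo `q`. -/
theorem localCoeff_of_dvd (hψ : ψ ^ 2 = 1) (hC : (C.det : ZMod q) ≠ 0)
    (hs : C * Dᵀ = D * Cᵀ) (hs' : C * D'ᵀ = D' * Cᵀ) :
    (∀ a : ℤ, localCoeff ψ q ![a, 0] C D = 0) ∧
    (∀ a b : ℤ, (a : ZMod q) * b = 0 → localCoeff ψ (q ^ 2) ![a, b] C D' = 0) ∧
    localCoeff ψ q ![1, 1] C D = localCoeff ψ q ![1, 1] C D' := by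
  have hqs : Squarefree q := (Fact.out : q.Prime).squarefree
  -- An invertible C puts the pair in the orbit of I with parameter det C, whatever D is; hence D
  -- and D' give the same value.
  have key : ∀ {n : ℕ} {D : Matrix (Fin 2) (Fin 2) ℤ}, IsUnit (C.det : ZMod n) →
      C * Dᵀ = D * Cᵀ → OrbitRelMod n ![1, 1] C D C.det := by
    intro n D hn hs
    rw [OrbitRelMod, map_cast_det, show diagonal ![(1 : ℤ), 1] = 1 from by
      rw [← diagonal_one]; congr 1; funext i; fin_cases i <;> rfl,
      Matrix.map_one _ Int.cast_zero Int.cast_one]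
    refine OrbitRel.of_isUnit_det_left ?_ ?_
    · rw [← map_cast_det]; exact hn
    · rw [← transpose_map, ← map_cast_mul, hs, map_cast_mul, transpose_map]
  have h1 := key (isUnit_iff_ne_zero.2 hC) hs
  have h2 := key (isUnit_iff_ne_zero.2 hC) hs'
  have h3 := key (isUnit_intCast_sq hC) hs'
  refine ⟨fun a => localCoeff_eq_zero_of_rank dvd_rfl h1 (by simp), fun a b hab =>
    localCoeff_eq_zero_of_rank (dvd_pow_self q two_ne_zero) h3 (by
      have := mul_eq_zero.1 hab
      simp
      tauto), ?_⟩
  rw [localCoeff_eq hqs dvd_rfl hψ h1, localCoeff_eq hqs dvd_rfl hψ h2]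

end

/-! ### Eisenstein series as sums over Γ_∞ \ Sp₂(ℤ). -/

/-- The coset space `Γ_∞ \ Sp₂(ℤ)`. -/
abbrev CosetSpace := Quotient (QuotientGroup.rightRel GammaInf)

theorem cosetSpace_eq_iff (g h : Sp2Z) :
    (Quotient.mk'' g : CosetSpace) = Quotient.mk'' h ↔ h * g⁻¹ ∈ GammaInf := by
  rw [Quotient.eq'', QuotientGroup.rightRel_apply]

theorem exists_out_eq (g : Sp2Z) :
    ∃ δ ∈ GammaInf, (Quotient.mk'' g : CosetSpace).out = δ * g := by
  refine ⟨(Quotient.mk'' g : CosetSpace).out * g⁻¹, ?_, by group⟩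
  rw [← cosetSpace_eq_iff]
  exact (Quotient.out_eq' _).symm

theorem blockC_mul_of_mem {δ : Sp2Z} (hδ : δ ∈ GammaInf) (g : Sp2Z) :
    blockC (δ * g) = blockD δ * blockC g := by
  have h : blockC δ = 0 := hδ
  rw [blockC_mul, h, Matrix.zero_mul, zero_add]

theorem blockD_mul_of_mem {δ : Sp2Z} (hδ : δ ∈ GammaInf) (g : Sp2Z) :
    blockD (δ * g) = blockD δ * blockD g := by
  have h : blockC δ = 0 := hδ
  rw [blockD_mul, h, Matrix.zero_mul, zero_add]

theorem blockD_det_eq {δ : Sp2Z} (hδ : δ ∈ GammaInf) :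
    (blockD δ).det = 1 ∨ (blockD δ).det = -1 := by
  have h : blockC δ = 0 := hδ
  have h1 := blockA_mul_blockD_transpose δ
  rw [h, transpose_zero, Matrix.mul_zero, sub_zero] at h1
  have h2 : (blockA δ).det * (blockD δ).det = 1 := by
    rw [← det_transpose (blockD δ), ← det_mul, h1, det_one]
  exact Int.isUnit_iff.1 (IsUnit.of_mul_eq_one_right _ h2)

/-- Cosets of Γ_∞ allow determinant -1 on the left, while `OrbitRel` uses SL₂. As diag(1, -1)
commutes with a diagonal base, it passes into the parabolic, where it changes the sign of det E. -/
theorem OrbitRel.neg_det {R : Type*} [CommRing R] {m : Fin 2 → R} {C D : Matrix (Fin 2) (Fin 2) R}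
    {x : R} (h : OrbitRel (Matrix.diagonal m) C D x) :
    OrbitRel (Matrix.diagonal m) (Matrix.diagonal ![1, -1] * C) (Matrix.diagonal ![1, -1] * D)
      (-x) := by
  obtain ⟨U, A, B, E, hU, hP, h1, h2, s, hs⟩ := h
  obtain ⟨e, he⟩ : ∃ e : Matrix (Fin 2) (Fin 2) R, e = Matrix.diagonal ![1, -1] := ⟨_, rfl⟩
  have hee : e * e = 1 := by
    rw [he, diagonal_mul_diagonal, ← diagonal_one]
    congr 1
    funext i; fin_cases i <;> simp
  have het : eᵀ = e := by rw [he, diagonal_transpose]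
  have hdet : e.det = -1 := by rw [he]; simp
  have hem : e * Matrix.diagonal m = Matrix.diagonal m * e := by
    rw [he, diagonal_mul_diagonal, diagonal_mul_diagonal]
    exact congrArg _ (funext fun _ => mul_comm _ _)
  rw [← he]
  have hPe : IsParabolic e 0 e := ⟨by rw [het, hee], by simp⟩
  have hP' := hPe.mul hP
  rw [Matrix.zero_mul, add_zero] at hP'
  refine ⟨e * U * e, e * A, e * B, e * E, ?_, hP', ?_, ?_, s, ?_⟩
  · rw [det_mul, det_mul, hU, hdet]; simp
  · rw [Matrix.mul_assoc, ← Matrix.mul_assoc e e, hee, Matrix.one_mul, Matrix.mul_assoc, h1,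
      ← Matrix.mul_assoc, hem, Matrix.mul_assoc]
  · rw [Matrix.mul_assoc, ← Matrix.mul_assoc e e, hee, Matrix.one_mul, Matrix.mul_assoc, h2,
      Matrix.mul_add, ← Matrix.mul_assoc, hem, Matrix.mul_assoc]
  · rw [det_mul, hdet, hs]; ring

theorem OrbitRelMod.mul_left_of_det {n : ℕ} {m : Fin 2 → ℤ} {C D V : Matrix (Fin 2) (Fin 2) ℤ} {x : ℤ}
    (h : OrbitRelMod n m C D x) (hV : V.det = 1 ∨ V.det = -1) :
    OrbitRelMod n m (V * C) (V * D) (V.det * x) := by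
  rcases hV with hV | hV
  · rw [hV, one_mul]; exact h.mul_left V hV
  · have h1 : OrbitRelMod n m (diagonal ![1, -1] * C) (diagonal ![1, -1] * D) (-x) := by
      rw [OrbitRelMod, diagonal_map Int.cast_zero] at h ⊢
      have e : (fun i => ((![1, -1] i : ℤ) : ZMod n)) = ![1, -1] := by
        funext i; fin_cases i <;> simp
      rw [map_cast_mul, map_cast_mul, diagonal_map Int.cast_zero, Int.cast_neg]
      exact (congrArg diagonal e) ▸ h.neg_det
    have h2 := h1.mul_left (V * diagonal ![1, -1]) (by rw [det_mul, hV]; simp)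
    have e : diagonal ![1, -1] * diagonal ![1, -1] = (1 : Matrix (Fin 2) (Fin 2) ℤ) := by
      rw [diagonal_mul_diagonal, ← diagonal_one]
      congr 1
      funext i; fin_cases i <;> simp
    rw [Matrix.mul_assoc, Matrix.mul_assoc, ← Matrix.mul_assoc _ _ C, ← Matrix.mul_assoc _ _ D, e,
      Matrix.one_mul, Matrix.one_mul] at h2
    rw [hV, neg_one_mul]
    exact h2

section
variable {N n k : ℕ} {χ : DirichletCharacter ℂ N} {m : Fin 2 → ℤ}

theorem localCoeff_mul_left (hN : Squarefree N) (hNn : N ∣ n) (hχ : χ ^ 2 = 1)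
    (C D : Matrix (Fin 2) (Fin 2) ℤ) {V : Matrix (Fin 2) (Fin 2) ℤ} (hV : V.det = 1 ∨ V.det = -1) :
    localCoeff χ n m (V * C) (V * D) = χ (V.det : ZMod N) * localCoeff χ n m C D := by
  by_cases hx : ∃ x, OrbitRelMod n m C D x
  · obtain ⟨x, hx⟩ := hx
    rw [localCoeff_eq hN hNn hχ hx, localCoeff_eq hN hNn hχ (hx.mul_left_of_det hV), Int.cast_mul,
      map_mul]
  · rw [localCoeff_eq_zero (not_exists.1 hx), mul_zero, localCoeff_eq_zero]
    intro x hx'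
    apply hx
    have hd : V.adjugate.det = 1 ∨ V.adjugate.det = -1 := by
      rw [det_adjugate]; simpa using hV
    have h2 := hx'.mul_left_of_det hd
    have hVV : V.adjugate * V = V.det • 1 := adjugate_mul V
    rw [← Matrix.mul_assoc, ← Matrix.mul_assoc, hVV] at h2
    have hV2 : V.det * V.det = 1 := by rcases hV with h | h <;> rw [h] <;> norm_num
    rcases hV with h | h
    · rw [h, one_smul, Matrix.one_mul, Matrix.one_mul] at h2
      exact ⟨_, h2⟩
    · rw [h] at h2
      have h3 := h2.mul_left (-1) (by simp [det_fin_two])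
      simp only [neg_smul, one_smul, Matrix.neg_mul, Matrix.one_mul, neg_neg] at h3
      exact ⟨_, h3⟩

/-- The summand of the Eisenstein series attached to the coset of `g`. -/
noncomputable def cosetTerm (k : ℕ) (χ : DirichletCharacter ℂ N) (n : ℕ) (m : Fin 2 → ℤ)
    (τ : Matrix (Fin 2) (Fin 2) ℂ) (g : Sp2Z) : ℂ :=
  localCoeff χ n m (blockC g) (blockD g) * oneSlash k g τ

/-- The sign χ(det) acquired by the coefficient cancels the sign det^k of the automorphy factor,
because χ(-1) = (-1)^k. -/
theorem cosetTerm_mul (hN : Squarefree N) (hNn : N ∣ n) (hχ : χ ^ 2 = 1) (hχk : χ (-1) = (-1) ^ k)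
    (τ : Matrix (Fin 2) (Fin 2) ℂ) {δ : Sp2Z} (hδ : δ ∈ GammaInf) (g : Sp2Z) :
    cosetTerm k χ n m τ (δ * g) = cosetTerm k χ n m τ g := by
  rw [cosetTerm, cosetTerm, blockC_mul_of_mem hδ, blockD_mul_of_mem hδ,
    localCoeff_mul_left hN hNn hχ _ _ (blockD_det_eq hδ), oneSlash_mul hδ]
  have h : χ (((blockD δ).det : ℤ) : ZMod N) * ((((blockD δ).det : ℤ) : ℂ) ^ k)⁻¹ = 1 := by
    rcases blockD_det_eq hδ with h | h <;> simp [h, hχk]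
  linear_combination localCoeff χ n m (blockC g) (blockD g) * oneSlash k g τ * h

theorem cosetTerm_out (hN : Squarefree N) (hNn : N ∣ n) (hχ : χ ^ 2 = 1) (hχk : χ (-1) = (-1) ^ k)
    (τ : Matrix (Fin 2) (Fin 2) ℂ) (g : Sp2Z) :
    cosetTerm k χ n m τ (Quotient.mk'' g : CosetSpace).out = cosetTerm k χ n m τ g := by
  obtain ⟨δ, hδ, h⟩ := exists_out_eq g
  rw [h, cosetTerm_mul hN hNn hχ hχk τ hδ]

/-- The coset in `Γ_∞ \ Sp₂(ℤ)` of an element of the orbit. -/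
def orbitToCoset (n : ℕ) (γ₀ : Sp2Z) : Quotient (orbitSetoid n γ₀) → CosetSpace :=
  Quotient.map' (fun γ : Gamma0 n => γ₀ * (γ : Sp2Z)) fun _ _ h => h

theorem orbitToCoset_injective (n : ℕ) (γ₀ : Sp2Z) : Function.Injective (orbitToCoset n γ₀) := by
  intro a b
  induction a using Quotient.inductionOn' with | h a => ?_
  induction b using Quotient.inductionOn' with | h b => ?_
  intro h
  have h' : (Quotient.mk'' (γ₀ * (a : Sp2Z)) : CosetSpace) = Quotient.mk'' (γ₀ * (b : Sp2Z)) := h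
  exact Quotient.sound' (show QuotientGroup.rightRel GammaInf _ _ from Quotient.exact' h')

theorem star_char (hχ : χ ^ 2 = 1) (x : ZMod N) : star (χ x) = χ x := by
  by_cases hx : IsUnit x
  · rcases mul_self_eq_one_iff.1 ((pow_two _).symm.trans (sq_eq_one_of_isUnit hχ hx)) with h | h <;> simp [h]
  · simp [MulChar.map_nonunit _ hx]

theorem cosetSummand_eq (hN : Squarefree N) (hNn : N ∣ n) (hχ : χ ^ 2 = 1)
    (hχk : χ (-1) = (-1) ^ k) (τ : Matrix (Fin 2) (Fin 2) ℂ)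
    (c : Quotient (orbitSetoid n (lowerUnipotent m))) :
    cosetSummand k χ n (lowerUnipotent m) τ c =
      cosetTerm k χ n m τ (orbitToCoset n (lowerUnipotent m) c).out := by
  have e : orbitToCoset n (lowerUnipotent m) c =
      (Quotient.mk'' (lowerUnipotent m * (c.out : Sp2Z)) : CosetSpace) := by
    conv_lhs => rw [← Quotient.out_eq' c]
    rfl
  rw [e, cosetTerm_out hN hNn hχ hχk, cosetSummand, summand, cosetTerm, star_char hχ,
    localCoeff_eq hN hNn hχ (orbitRelMod_lowerUnipotent_mul m c.out)]

/-- The Eisenstein series as a sum over `Γ_∞ \ Sp₂(ℤ)`. -/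
theorem siegelEisenstein_eq_tsum (hN : Squarefree N) (hNn : N ∣ n) (hχ : χ ^ 2 = 1)
    (hχk : χ (-1) = (-1) ^ k) (τ : Matrix (Fin 2) (Fin 2) ℂ) :
    siegelEisenstein k χ n (lowerUnipotent m) τ =
      ∑' c : CosetSpace, cosetTerm k χ n m τ c.out := by
  rw [siegelEisenstein, ← (orbitToCoset_injective n (lowerUnipotent m)).tsum_eq]
  · exact tsum_congr fun c => cosetSummand_eq hN hNn hχ hχk τ c
  -- A nonzero coefficient means that the orbit relation holds modulo n, and such a coset comes from
  -- some γ in Γ₀(n).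
  · intro c hc
    rw [Function.mem_support, cosetTerm] at hc
    have hx : ∃ x, OrbitRelMod n m (blockC c.out) (blockD c.out) x := by
      by_contra hx
      rw [localCoeff_eq_zero (not_exists.1 hx), zero_mul] at hc
      exact hc rfl
    obtain ⟨x, hx⟩ := hx
    obtain ⟨δ, hδ, γ, hγ⟩ := hx.exists_mul_eq
    refine ⟨Quotient.mk'' γ, ?_⟩
    rw [← Quotient.out_eq' c]
    change (Quotient.mk'' (lowerUnipotent m * (γ : Sp2Z)) : CosetSpace) = _
    rw [eq_comm, cosetSpace_eq_iff, ← hγ, mul_inv_cancel_right]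
    exact hδ

theorem norm_oneSlash_mul {δ : Sp2Z} (hδ : δ ∈ GammaInf) (g : Sp2Z)
    (τ : Matrix (Fin 2) (Fin 2) ℂ) : ‖oneSlash k (δ * g) τ‖ = ‖oneSlash k g τ‖ := by
  rw [oneSlash_mul hδ]
  rcases blockD_det_eq hδ with h | h <;> simp [h]

/-- The orbit of Γ_∞ γ₀ injects into Γ_∞ \ Sp₂(ℤ), the absolute value of 1|g depends only on the
coset of g, and |χ| ≤ 1; thus no condition on γ₀ or on representatives is needed. -/
theorem summable_cosetSummand {τ : Matrix (Fin 2) (Fin 2) ℂ}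
    (h : Summable fun c : CosetSpace => oneSlash k c.out τ) (γ₀ : Sp2Z) :
    Summable (cosetSummand k χ n γ₀ τ) := by
  have h1 := h.norm.comp_injective (orbitToCoset_injective n γ₀)
  refine Summable.of_norm_bounded h1 fun c => ?_
  have e : orbitToCoset n γ₀ c = (Quotient.mk'' (γ₀ * (c.out : Sp2Z)) : CosetSpace) := by
    conv_lhs => rw [← Quotient.out_eq' c]
    rfl
  obtain ⟨δ, hδ, hout⟩ := exists_out_eq (γ₀ * (c.out : Sp2Z))
  rw [Function.comp_apply, e, hout, norm_oneSlash_mul hδ, cosetSummand, summand, norm_mul, norm_star]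
  exact mul_le_of_le_one_left (norm_nonneg _) (χ.norm_le_one _)

theorem summable_cosetTerm {τ : Matrix (Fin 2) (Fin 2) ℂ}
    (h : Summable fun c : CosetSpace => oneSlash k c.out τ) :
    Summable fun c : CosetSpace => cosetTerm k χ n m τ c.out := by
  refine Summable.of_norm_bounded h.norm fun c => ?_
  rw [cosetTerm, norm_mul]
  refine mul_le_of_le_one_left (norm_nonneg _) ?_
  unfold localCoeff
  split_ifs
  · exact χ.norm_le_one _
  · simp

end

/-! ### The shift as a bijection of Γ_∞ \ Sp₂(ℤ). -/

section shift
variable {q : ℕ} {g g' g₁ g₂ : Sp2Z}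

/-- The Lagrangian attached to `g'` is the image of the Lagrangian attached to `g` under the
similitude `(C, D) ↦ (qC, D)`. -/
def IsShift (q : ℕ) (g g' : Sp2Z) : Prop :=
  (q : ℤ) • blockC g * (blockD g')ᵀ = blockD g * (blockC g')ᵀ

theorem isShift_of_eq {Q : Matrix (Fin 2) (Fin 2) ℤ} (hC : (q : ℤ) • blockC g = Q * blockC g')
    (hD : blockD g = Q * blockD g') : IsShift q g g' := by
  rw [IsShift, hC, hD, Matrix.mul_assoc, Matrix.mul_assoc, blockC_mul_blockD_transpose]

theorem IsShift.mul_left (h : IsShift q g g') {δ : Sp2Z} (hδ : δ ∈ GammaInf) :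
    IsShift q (δ * g) g' := by
  rw [IsShift, blockC_mul_of_mem hδ, blockD_mul_of_mem hδ, ← Matrix.mul_smul, Matrix.mul_assoc, h,
    Matrix.mul_assoc]

/-- The matrix Q = D A₁ᵀ - qC B₁ᵀ satisfies (qC, D) = Q (C₁, D₁) and is nonsingular, since q · 1 is
a right multiple of it. Cancelling Q in the relation with g₂ compares g₁ and g₂ directly. -/
theorem IsShift.unique (hq : q ≠ 0) (h₁ : IsShift q g g₁) (h₂ : IsShift q g g₂) :
    (Quotient.mk'' g₁ : CosetSpace) = Quotient.mk'' g₂ := by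
  rw [eq_comm, cosetSpace_eq_iff, mul_inv_mem_GammaInf]
  have i1 := congrArg blockA (inv_mul_cancel g₁)
  have i2 := congrArg blockB (inv_mul_cancel g₁)
  have i3 := congrArg blockC (inv_mul_cancel g₁)
  have i4 := congrArg blockD (inv_mul_cancel g₁)
  have b1 : blockA 1 = 1 := by ext i j; simp [blockA, toBlocks₁₁, Matrix.one_apply]
  have b2 : blockD 1 = 1 := by ext i j; simp [blockD, toBlocks₂₂, Matrix.one_apply]
  rw [blockA_mul, blockA_inv, blockB_inv, b1] at i1
  rw [blockB_mul, blockA_inv, blockB_inv, blockB_one] at i2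
  rw [blockC_mul, blockC_inv, blockD_inv, blockC_one] at i3
  rw [blockD_mul, blockC_inv, blockD_inv, b2] at i4
  obtain ⟨Q, hQ⟩ : ∃ Q, Q = blockD g * (blockA g₁)ᵀ - (q : ℤ) • blockC g * (blockB g₁)ᵀ := ⟨_, rfl⟩
  rw [IsShift] at h₁ h₂
  have hC : Q * blockC g₁ = (q : ℤ) • blockC g := by
    calc Q * blockC g₁ = blockD g * (-(blockC g₁)ᵀ * blockA g₁ + (blockA g₁)ᵀ * blockC g₁) +
          (q : ℤ) • blockC g * ((blockD g₁)ᵀ * blockA g₁ + -(blockB g₁)ᵀ * blockC g₁) -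
          ((q : ℤ) • blockC g * (blockD g₁)ᵀ - blockD g * (blockC g₁)ᵀ) * blockA g₁ := by
            rw [hQ]; noncomm_ring
      _ = _ := by rw [i1, i3, h₁]; simp
  have hD : Q * blockD g₁ = blockD g := by
    calc Q * blockD g₁ = blockD g * (-(blockC g₁)ᵀ * blockB g₁ + (blockA g₁)ᵀ * blockD g₁) +
          (q : ℤ) • blockC g * ((blockD g₁)ᵀ * blockB g₁ + -(blockB g₁)ᵀ * blockD g₁) -
          ((q : ℤ) • blockC g * (blockD g₁)ᵀ - blockD g * (blockC g₁)ᵀ) * blockB g₁ := by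
            rw [hQ]; noncomm_ring
      _ = _ := by rw [i2, i4, h₁]; simp
  have hQ0 : Q.det ≠ 0 := by
    have h1 : Q * (blockD g₁ * ((q : ℤ) • (blockA g)ᵀ) - blockC g₁ * (blockB g)ᵀ) = (q : ℤ) • 1 := by
      rw [Matrix.mul_sub, ← Matrix.mul_assoc, ← Matrix.mul_assoc, hC, hD, Matrix.mul_smul,
        Matrix.smul_mul, ← smul_sub, blockD_mul_blockA_transpose]
    intro h0
    have := congrArg det h1
    rw [det_mul, h0, zero_mul, det_smul, det_one, mul_one, Fintype.card_fin] at this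
    exact pow_ne_zero 2 (Int.natCast_ne_zero.2 hq) this.symm
  have h3 : Q * (blockC g₁ * (blockD g₂)ᵀ - blockD g₁ * (blockC g₂)ᵀ) = 0 := by
    rw [Matrix.mul_sub, ← Matrix.mul_assoc, ← Matrix.mul_assoc, hC, hD, h₂, sub_self]
  have h4 : Q.det • (blockC g₁ * (blockD g₂)ᵀ - blockD g₁ * (blockC g₂)ᵀ) = 0 := by
    have := congrArg (fun X => Q.adjugate * X) h3
    simpa [← Matrix.mul_assoc, adjugate_mul] using this
  exact sub_eq_zero.1 ((smul_eq_zero.1 h4).resolve_left hQ0)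

theorem blockC_mul_symJ (g : Sp2Z) : blockC (g * SymplecticGroup.symJ (Fin 2) ℤ) = blockD g := by
  rw [blockC_mul, show blockA (SymplecticGroup.symJ (Fin 2) ℤ) = 0 from toBlocks_fromBlocks₁₁ _ _ _ _,
    show blockC (SymplecticGroup.symJ (Fin 2) ℤ) = 1 from toBlocks_fromBlocks₂₁ _ _ _ _]
  simp

theorem blockD_mul_symJ (g : Sp2Z) : blockD (g * SymplecticGroup.symJ (Fin 2) ℤ) = -blockC g := by
  rw [blockD_mul, show blockB (SymplecticGroup.symJ (Fin 2) ℤ) = -1 from toBlocks_fromBlocks₁₂ _ _ _ _,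
    show blockD (SymplecticGroup.symJ (Fin 2) ℤ) = 0 from toBlocks_fromBlocks₂₂ _ _ _ _]
  simp

/-- J exchanges C and D up to sign and so reverses the shift relation. Existence and uniqueness of
shifts then yield surjectivity and injectivity. -/
theorem isShift_mul_symJ : IsShift q (g' * SymplecticGroup.symJ (Fin 2) ℤ)
    (g * SymplecticGroup.symJ (Fin 2) ℤ) ↔ IsShift q g g' := by
  rw [IsShift, IsShift, blockC_mul_symJ, blockC_mul_symJ, blockD_mul_symJ, blockD_mul_symJ,
    ← transpose_inj]
  simp only [transpose_mul, transpose_neg, transpose_smul, transpose_transpose,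
    Matrix.neg_mul, Matrix.mul_neg, Matrix.smul_mul, neg_inj]

theorem cosetSpace_mul_right (g h w : Sp2Z) :
    (Quotient.mk'' (g * w) : CosetSpace) = Quotient.mk'' (h * w) ↔
      (Quotient.mk'' g : CosetSpace) = Quotient.mk'' h := by
  rw [cosetSpace_eq_iff, cosetSpace_eq_iff, _root_.mul_inv_rev, mul_assoc, mul_inv_cancel_left]

/-- If every coset has a shift, shifting is a bijection of `Γ_∞ \ Sp₂(ℤ)`. -/
theorem exists_shift_equiv (hq : q ≠ 0) (h : ∀ g, ∃ g', IsShift q g g') :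
    ∃ φ : CosetSpace ≃ CosetSpace, ∀ g g', IsShift q g g' → φ (Quotient.mk'' g) = Quotient.mk'' g' := by
  choose f hf using h
  have key : ∀ g g', IsShift q g g' →
      (Quotient.mk'' (f (Quotient.mk'' g : CosetSpace).out) : CosetSpace) = Quotient.mk'' g' := by
    intro g g' hg
    obtain ⟨δ, hδ, hout⟩ := exists_out_eq g
    exact (hf _).unique hq (hout ▸ hg.mul_left hδ)
  refine ⟨Equiv.ofBijective (fun c => Quotient.mk'' (f c.out)) ⟨?_, ?_⟩, key⟩
  · intro c d hcd
    change (Quotient.mk'' (f c.out) : CosetSpace) = Quotient.mk'' (f d.out) at hcd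
    rw [← Quotient.out_eq' c, ← Quotient.out_eq' d]
    -- After multiplication by J, both representatives are shifts of the common image coset, so
    -- uniqueness applies.
    refine (cosetSpace_mul_right _ _ (SymplecticGroup.symJ (Fin 2) ℤ)).1 ?_
    obtain ⟨δ, hδ, hδe⟩ : ∃ δ ∈ GammaInf, f c.out = δ * f d.out :=
      ⟨_, (cosetSpace_eq_iff _ _).1 hcd.symm, by group⟩
    refine (isShift_mul_symJ.2 (hf c.out)).unique hq ?_
    rw [hδe, mul_assoc]
    exact (isShift_mul_symJ.2 (hf d.out)).mul_left hδ
  · intro c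
    induction c using Quotient.inductionOn' with | h g' => ?_
    have h1 := hf (g' * SymplecticGroup.symJ (Fin 2) ℤ)
    have h2 : IsShift q (f (g' * SymplecticGroup.symJ (Fin 2) ℤ) *
        (SymplecticGroup.symJ (Fin 2) ℤ)⁻¹) g' := by
      rw [← isShift_mul_symJ, inv_mul_cancel_right]
      exact h1
    exact ⟨_, key _ _ h2⟩

end shift

/-! ### Integral representatives of the shifted coset, by the rank of D modulo q. -/

section
variable {q : ℕ} [Fact q.Prime]

theorem blockC_mul_add_blockD_mul (g : Sp2Z) :
    blockC g * (-(blockB g)ᵀ) + blockD g * (blockA g)ᵀ = 1 := by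
  rw [← blockD_mul_blockA_transpose g, Matrix.mul_neg, neg_add_eq_sub]

/-- As det D is prime to q, the pair (qC, D) is still coprime and Q = 1. The Bézout identity
combines D · adj D = det D with that of (C, D). -/
theorem exists_shift_of_det_ne_zero {g : Sp2Z} (hD : ((blockD g).det : ZMod q) ≠ 0) :
    ∃ g' : Sp2Z, blockC g' = (q : ℤ) • blockC g ∧ blockD g' = blockD g := by
  obtain ⟨u, hu⟩ := ZMod.intCast_surjective (((blockD g).det : ZMod q)⁻¹)
  obtain ⟨z, hz⟩ : ∃ z, (blockD g).det * u - 1 = q * z := by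
    rw [← dvd_def, ← ZMod.intCast_zmod_eq_zero_iff_dvd]
    rw [Int.cast_sub, Int.cast_mul, hu, mul_inv_cancel₀ hD, Int.cast_one, sub_self]
  refine exists_blockC_blockD (X := -z • (-(blockB g)ᵀ))
    (Y := u • (blockD g).adjugate - (q * z) • (blockA g)ᵀ) ?_ ?_
  · rw [Matrix.smul_mul, blockC_mul_blockD_transpose, transpose_smul, Matrix.mul_smul]
  · have h1 : blockD g * (u • (blockD g).adjugate) = (1 + q * z) • 1 := by
      rw [Matrix.mul_smul, mul_adjugate, smul_smul, ← hz]
      congr 1; ring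
    rw [Matrix.mul_sub, h1, Matrix.smul_mul, Matrix.mul_smul, Matrix.mul_smul, smul_smul, add_smul,
      one_smul, show (q : ℤ) * -z = -(q * z) by ring, neg_smul]
    have h2 := congrArg (fun X => ((q : ℤ) * z) • X) (blockC_mul_add_blockD_mul g)
    simp only [smul_add] at h2
    rw [← h2]
    abel

/-- Coprimality forces C to be invertible modulo q, and q divides out of (qC, D), so Q = q · 1. -/
theorem exists_shift_of_dvd {g : Sp2Z} (hD : (blockD g).map (Int.cast : ℤ → ZMod q) = 0) :
    ((blockC g).det : ZMod q) ≠ 0 ∧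
      ∃ g' : Sp2Z, blockC g' = blockC g ∧ blockD g = (q : ℤ) • blockD g' := by
  have hq : (q : ℤ) ≠ 0 := Int.natCast_ne_zero.2 (Fact.out : q.Prime).ne_zero
  obtain ⟨D', hD'⟩ : ∃ D' : Matrix (Fin 2) (Fin 2) ℤ, blockD g = (q : ℤ) • D' := by
    have : ∀ i j, ∃ d, blockD g i j = q * d := fun i j => by
      rw [← dvd_def, ← ZMod.intCast_zmod_eq_zero_iff_dvd]
      exact congrFun (congrFun hD i) j
    choose d hd using this
    exact ⟨of d, by ext i j; exact hd i j⟩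
  refine ⟨fun h0 => ?_, ?_⟩
  · have := congrArg (fun X => X.map (Int.cast : ℤ → ZMod q)) (blockC_mul_add_blockD_mul g)
    simp only [map_cast_add, map_cast_mul, hD, Matrix.zero_mul, add_zero,
      Matrix.map_one _ Int.cast_zero Int.cast_one] at this
    have := congrArg det this
    rw [det_mul, ← map_cast_det, h0, zero_mul, det_one] at this
    exact zero_ne_one this
  · obtain ⟨g', h1, h2⟩ := exists_blockC_blockD (C := blockC g) (D := D') (X := -(blockB g)ᵀ)
      (Y := (q : ℤ) • (blockA g)ᵀ) (by
        have := blockC_mul_blockD_transpose g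
        rw [hD', transpose_smul, Matrix.mul_smul, Matrix.smul_mul] at this
        exact smul_right_injective _ hq this) (by
        rw [← blockC_mul_add_blockD_mul g, hD', Matrix.mul_smul, Matrix.smul_mul])
    exact ⟨g', h1, by rw [h2, hD']⟩

/-- Here Q = diag(1, q): only the second row of (qC, D) is divisible by q. Symmetry of C Dᵀ makes
the new pair symmetric, and coprimality makes c₂ nonzero modulo q. -/
theorem exists_shift_of_rank_one {g : Sp2Z} {c₁₁ c₁₂ c₂₁ c₂₂ d₁₁ d₁₂ d₂₁ d₂₂ : ℤ}
    (hC : blockC g = !![c₁₁, c₁₂; c₂₁, c₂₂]) (hD : blockD g = !![d₁₁, d₁₂; q * d₂₁, q * d₂₂])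
    (hd : ¬ ((d₁₁ : ZMod q) = 0 ∧ (d₁₂ : ZMod q) = 0)) :
    d₁₁ * c₂₁ + d₁₂ * c₂₂ = q * (c₁₁ * d₂₁ + c₁₂ * d₂₂) ∧
    ¬ ((c₂₁ : ZMod q) = 0 ∧ (c₂₂ : ZMod q) = 0) ∧
    ∃ g' : Sp2Z, blockC g' = !![q * c₁₁, q * c₁₂; c₂₁, c₂₂] ∧
      blockD g' = !![d₁₁, d₁₂; d₂₁, d₂₂] := by
  have hs : d₁₁ * c₂₁ + d₁₂ * c₂₂ = q * (c₁₁ * d₂₁ + c₁₂ * d₂₂) := by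
    have := congrFun (congrFun (blockC_mul_blockD_transpose g) 0) 1
    rw [hC, hD] at this
    simp [Matrix.mul_apply, Fin.sum_univ_two] at this
    linear_combination -this
  obtain ⟨X, hX⟩ : ∃ X, X = -(blockB g)ᵀ := ⟨_, rfl⟩
  obtain ⟨Y, hY⟩ : ∃ Y, Y = (blockA g)ᵀ := ⟨_, rfl⟩
  have h := blockC_mul_add_blockD_mul g
  rw [hC, hD, ← hX, ← hY, ← Matrix.ext_iff] at h
  simp [vecMul, dotProduct, Fin.sum_univ_two, Fin.forall_fin_two] at h
  obtain ⟨⟨h00, h01⟩, h10, h11⟩ := h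
  refine ⟨hs, ?_, ?_⟩
  · rintro ⟨e1, e2⟩
    have := congrArg (Int.cast : ℤ → ZMod q) h11
    push_cast at this
    rw [e1, e2] at this
    simp at this
  · obtain ⟨z₁, z₂, s, hz⟩ : ∃ z₁ z₂ s : ℤ, d₁₁ * z₁ + d₁₂ * z₂ - 1 = q * s := by
      have key : ∃ z₁ z₂ : ZMod q, (d₁₁ : ZMod q) * z₁ + d₁₂ * z₂ = 1 := by
        by_cases h0 : (d₁₁ : ZMod q) = 0
        · exact ⟨0, (d₁₂ : ZMod q)⁻¹, by rw [mul_inv_cancel₀ fun h => hd ⟨h0, h⟩]; simp⟩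
        · exact ⟨(d₁₁ : ZMod q)⁻¹, 0, by rw [mul_inv_cancel₀ h0]; simp⟩
      obtain ⟨z₁, z₂, hz⟩ := key
      obtain ⟨z₁, rfl⟩ := ZMod.intCast_surjective z₁
      obtain ⟨z₂, rfl⟩ := ZMod.intCast_surjective z₂
      refine ⟨z₁, z₂, ?_⟩
      rw [← dvd_def, ← ZMod.intCast_zmod_eq_zero_iff_dvd]
      push_cast
      rw [hz, sub_self]
    obtain ⟨w, hw⟩ : ∃ w, w = d₂₁ * z₁ + d₂₂ * z₂ := ⟨_, rfl⟩
    have hq : (q : ℤ) ≠ 0 := Int.natCast_ne_zero.2 (Fact.out : q.Prime).ne_zero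
    -- The columns of (X, qY) are sent by (C', D') to (q, 0) and (0, 1), and (0, z) is sent to (1 +
    -- qs, w). Subtracting s and w times those columns from (0, z) gives a first column sent to (1,
    -- 0).
    refine exists_blockC_blockD (X := X * !![-s, 0; -w, 1])
      (Y := Y * !![-(q * s), 0; -(q * w), q] + !![z₁, 0; z₂, 0]) ?_ ?_
    · ext i j
      fin_cases i <;> fin_cases j <;> simp [Matrix.mul_apply, Fin.sum_univ_two]
      · ring
      · linear_combination -hs
      · linear_combination hs
      · ring
    · ext i j
      fin_cases i <;> fin_cases j <;> simp [vecMul, dotProduct, Matrix.mul_apply, Fin.sum_univ_two]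
      · linear_combination -(q * s) * h00 - q * w * h01 + hz
      · linear_combination q * h01
      · linear_combination -s * h10 - w * h11 - hw
      · linear_combination h11

/-- A singular nonzero matrix over a field has a nonzero first row and a zero second row after
left multiplication by a matrix of determinant one. -/
theorem exists_det_eq_one_mul_row_eq_zero {F : Type*} [Field F] {D : Matrix (Fin 2) (Fin 2) F}
    (h : D.det = 0) : ∃ U : Matrix (Fin 2) (Fin 2) F, U.det = 1 ∧ (U * D) 1 = 0 := by
  obtain ⟨v, hv, hvD⟩ := exists_vecMul_eq_zero_iff.2 h
  have key : ∀ a b : F, (!![a, b; v 0, v 1] * D) 1 = 0 := by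
    intro a b
    funext j
    have := congrFun hvD j
    simpa [Matrix.mul_apply, vecMul, dotProduct, Fin.sum_univ_two] using this
  by_cases h0 : v 0 = 0
  · have h1 : v 1 ≠ 0 := fun h1 => hv (by funext i; fin_cases i <;> assumption)
    exact ⟨!![(v 1)⁻¹, 0; v 0, v 1], by simp [det_fin_two_of, h1], key _ _⟩
  · exact ⟨!![0, -(v 0)⁻¹; v 0, v 1], by simp [det_fin_two_of, h0], key _ _⟩

/-- Every coset of `Γ_∞` has a representative of one of three shapes modulo `q`. -/
theorem exists_normalized (q : ℕ) [Fact q.Prime] (g : Sp2Z) : ∃ δ ∈ GammaInf,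
    ((blockD (δ * g)).det : ZMod q) ≠ 0 ∨
    (blockD (δ * g)).map (Int.cast : ℤ → ZMod q) = 0 ∨
    ∃ c₁₁ c₁₂ c₂₁ c₂₂ d₁₁ d₁₂ d₂₁ d₂₂ : ℤ,
      blockC (δ * g) = !![c₁₁, c₁₂; c₂₁, c₂₂] ∧ blockD (δ * g) = !![d₁₁, d₁₂; q * d₂₁, q * d₂₂] ∧
      ¬ ((d₁₁ : ZMod q) = 0 ∧ (d₁₂ : ZMod q) = 0) := by
  by_cases h0 : ((blockD g).det : ZMod q) = 0
  · rw [map_cast_det] at h0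
    obtain ⟨U, hU, hUD⟩ := exists_det_eq_one_mul_row_eq_zero h0
    obtain ⟨V, hV, rfl⟩ := exists_int_det_eq_one_lift U hU
    obtain ⟨δ, hδ⟩ : ∃ δ, δ = upperParabolic V 0 hV transpose_zero := ⟨_, rfl⟩
    have hδm : δ ∈ GammaInf := hδ ▸ upperParabolic_mem _ _ _ _
    have hδD : blockD δ = V := by rw [hδ]; exact toBlocks_fromBlocks₂₂ _ _ _ _
    rw [← map_cast_mul, ← hδD, ← blockD_mul_of_mem hδm] at hUD
    have hrow : ∀ j, ∃ d, blockD (δ * g) 1 j = q * d := fun j => by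
      rw [← dvd_def, ← ZMod.intCast_zmod_eq_zero_iff_dvd]
      exact congrFun hUD j
    choose d hd using hrow
    refine ⟨δ, hδm, Or.inr ?_⟩
    by_cases h1 : (blockD (δ * g) 0 0 : ZMod q) = 0 ∧ (blockD (δ * g) 0 1 : ZMod q) = 0
    · left
      ext i j
      fin_cases i
      · fin_cases j
        · exact h1.1
        · exact h1.2
      · exact congrFun hUD j
    · refine Or.inr ⟨_, _, _, _, _, _, d 0, d 1, eta_fin_two _, ?_, h1⟩
      rw [← hd, ← hd]
      exact eta_fin_two _
  · exact ⟨1, one_mem _, Or.inl (by rwa [one_mul])⟩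

end

/-- This is C(qτ) + D = Q (C'τ + D'), taken to determinants. -/
theorem oneSlash_shift {q j k : ℕ} {h g : Sp2Z} {Q : Matrix (Fin 2) (Fin 2) ℤ}
    (hC : (q : ℤ) • blockC h = Q * blockC g) (hD : blockD h = Q * blockD g)
    (hQ : Q.det = (q : ℤ) ^ j) (τ : Matrix (Fin 2) (Fin 2) ℂ) :
    oneSlash k h ((q : ℂ) • τ) = ((q : ℂ)⁻¹ ^ k) ^ j * oneSlash k g τ := by
  have hC' := congrArg (fun X => X.map (Int.cast : ℤ → ℂ)) hC
  have e : ((q : ℤ) • blockC h).map (Int.cast : ℤ → ℂ) =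
      (q : ℂ) • (blockC h).map (Int.cast : ℤ → ℂ) := by
    ext i j
    rw [Matrix.map_apply, Matrix.smul_apply, smul_eq_mul, Int.cast_mul, Int.cast_natCast]
    rfl
  simp only [e, map_cast_mul] at hC'
  rw [oneSlash, oneSlash, Matrix.mul_smul, ← Matrix.smul_mul, hC', hD, map_cast_mul,
    Matrix.mul_assoc, ← Matrix.mul_add, det_mul, ← map_cast_det, hQ, mul_pow, mul_inv, ← pow_mul,
    Int.cast_pow, Int.cast_natCast, ← pow_mul, inv_pow, mul_comm k j]

theorem IsTypeMatrix.diagModEq {N₀ N₁ N₂ : ℕ} {m m' : Fin 2 → ℤ}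
    (hsq : Squarefree (N₀ * N₁ * N₂)) (h : IsTypeMatrix N₀ N₁ N₂ m)
    (h' : IsTypeMatrix N₀ N₁ N₂ m') : DiagModEq (N₀ * N₁ * N₂) m m' := by
  intro i
  refine Int.modEq_of_dvd (Int.natCast_dvd.2 ?_)
  rw [← Nat.prod_primeFactors_of_squarefree hsq]
  refine Finset.prod_primes_dvd _ (fun p hp => (Nat.prime_of_mem_primeFactors hp).prime)
    fun p hp => Int.natCast_dvd.1 (Int.ModEq.dvd ?_)
  obtain ⟨a0, a1, a2⟩ := h p (Nat.prime_of_mem_primeFactors hp)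
  obtain ⟨b0, b1, b2⟩ := h' p (Nat.prime_of_mem_primeFactors hp)
  rcases (Nat.prime_of_mem_primeFactors hp).dvd_mul.1 (Nat.dvd_of_mem_primeFactors hp) with h | h
  · rcases (Nat.prime_of_mem_primeFactors hp).dvd_mul.1 h with h | h
    · exact (a0 h i).trans (b0 h i).symm
    · exact (a1 h i).trans (b1 h i).symm
  · exact (a2 h i).trans (b2 h i).symm

/-! ### Values of a quadratic character modulo q. -/

section quadratic
variable {q : ℕ} [Fact q.Prime] {ψ : DirichletCharacter ℂ q} {ω : ℤ}

theorem char_mul_sq (hψ : ψ ^ 2 = 1) (a : ZMod q) {b : ZMod q} (hb : b ≠ 0) :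
    ψ (a * b ^ 2) = ψ a := by
  rw [map_mul, map_pow, sq_eq_one_of_isUnit hψ hb.isUnit, mul_one]

theorem char_eq_one_of_quadraticChar (hψ : ψ ^ 2 = 1) {a : ZMod q}
    (h : quadraticChar (ZMod q) a = 1) : ψ a = 1 := by
  have ha : a ≠ 0 := by rintro rfl; simp at h
  obtain ⟨b, hb⟩ := (quadraticChar_one_iff_isSquare ha).1 h
  have hb0 : b ≠ 0 := by rintro rfl; simp at hb; exact ha hb
  rw [hb, ← pow_two, ← one_mul (b ^ 2), char_mul_sq hψ 1 hb0, map_one]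

theorem char_eq_of_quadraticChar (hψ : ψ ^ 2 = 1) (hω : legendreSym q ω = -1) {a : ZMod q}
    (h : quadraticChar (ZMod q) a = -1) : ψ a = ψ (ω : ZMod q) := by
  have ha : a ≠ 0 := by rintro rfl; simp at h
  obtain ⟨b, hb, rfl | rfl⟩ := isSquare_or_eq_mul_sq hω ha
  · rw [quadraticChar_sq_one' hb] at h
    norm_num at h
  · exact char_mul_sq hψ _ hb

theorem char_sum (hψ : ψ ^ 2 = 1) (hω : legendreSym q ω = -1) (f : (ZMod q)ˣ → ℂ) :
    ∑ α : (ZMod q)ˣ, ψ (α : ZMod q) * f α =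
      (∑ α ∈ Finset.univ.filter
        (fun α : (ZMod q)ˣ => quadraticChar (ZMod q) (α : ZMod q) = 1), f α) +
      ψ (ω : ZMod q) * ∑ α ∈ Finset.univ.filter
        (fun α : (ZMod q)ˣ => quadraticChar (ZMod q) (α : ZMod q) = -1), f α := by
  rw [Finset.mul_sum, Finset.sum_filter, Finset.sum_filter, ← Finset.sum_add_distrib]
  refine Finset.sum_congr rfl fun α _ => ?_
  rcases quadraticChar_dichotomy α.ne_zero with h | h
  · rw [if_pos h, if_neg (by rw [h]; norm_num), char_eq_one_of_quadraticChar hψ h]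
    ring
  · rw [if_pos h, if_neg (by rw [h]; norm_num), char_eq_of_quadraticChar hψ hω h]
    ring

/-- A quadratic character modulo q is 1 on squares and constant on nonsquares, hence determined by
its value at ω; this is where the two cases of the theorem separate. -/
theorem char_nonresidue (hψ : ψ ^ 2 = 1) (hω : legendreSym q ω = -1) :
    (ψ = 1 → ψ (ω : ZMod q) = 1) ∧ (ψ ≠ 1 → ψ (ω : ZMod q) = -1) := by
  have h0 := (cast_ne_zero_of_legendreSym hω).isUnit
  refine ⟨fun h => by rw [h, MulChar.one_apply h0], fun h => ?_⟩
  refine (mul_self_eq_one_iff.1 ((pow_two _).symm.trans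
    (sq_eq_one_of_isUnit hψ h0))).resolve_left fun h1 => h (MulChar.ext fun u => ?_)
  rw [MulChar.one_apply u.isUnit]
  rcases quadraticChar_dichotomy u.ne_zero with h | h
  · exact char_eq_one_of_quadraticChar hψ h
  · rw [char_eq_of_quadraticChar hψ hω h, h1]

end quadratic

/-! ### Termwise comparison and summation. -/

section
variable {k N q N₀ N₁ N₂ : ℕ} {χ : DirichletCharacter ℂ N} {ω : ℤ}

/-- All base matrices of one type agree modulo N₀N₁N₂, so a single m' serves for the prime-to-q
factor of every series, and this factor can be taken out of the identities. -/
theorem localCoeff_eq_mul {b : ℕ} (hN : Squarefree N) (hχ : χ ^ 2 = 1)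
    (hqN : q * (N₀ * N₁ * N₂) = N) (hqb : q ∣ b) (hb : b ∣ q ^ 2) {m m' t : Fin 2 → ℤ}
    (hm : IsTypeMatrix N₀ N₁ N₂ m) (hm' : IsTypeMatrix N₀ N₁ N₂ m') (ht : DiagModEq b m t)
    (C D : Matrix (Fin 2) (Fin 2) ℤ) :
    localCoeff χ (N₀ * N₁ * N₂ * b) m C D =
      localCoeff (component χ (N₀ * N₁ * N₂)) (N₀ * N₁ * N₂) m' C D *
        localCoeff (component χ q) b t C D := by
  have hsq : Squarefree (N₀ * N₁ * N₂) := hN.squarefree_of_dvd (hqN ▸ dvd_mul_left _ _)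
  have hc : (N₀ * N₁ * N₂).Coprime (q ^ 2) :=
    (Nat.coprime_of_squarefree_mul (hqN ▸ hN)).symm.pow_right 2
  rw [localCoeff_mul ((mul_comm _ _).trans hqN) hN hχ dvd_rfl hqb (hc.coprime_dvd_right hb),
    localCoeff_congr ht, localCoeff_congr (hm.diagModEq hsq hm')]

/-- The identities between the summands of the shifted series and of the series of level `q N`. -/
theorem cosetTerm_shift [Fact q.Prime] (hq : Odd q) (hN : Squarefree N) (hχ : χ ^ 2 = 1)
    (hχk : χ (-1) = (-1) ^ k) (hqN : q * (N₀ * N₁ * N₂) = N) (hω : legendreSym q ω = -1)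
    {m₀ m₁ m₂ m₀₀ m₀₁p m₀₁m m₁₁ m₁₂p m₁₂m : Fin 2 → ℤ} {m₀₂ : (ZMod q)ˣ → Fin 2 → ℤ}
    (hm₀ : IsTypeMatrix N₀ N₁ N₂ m₀ ∧ DiagModEq q m₀ ![0, 0])
    (hm₁ : IsTypeMatrix N₀ N₁ N₂ m₁ ∧ DiagModEq q m₁ ![1, 0])
    (hm₂ : IsTypeMatrix N₀ N₁ N₂ m₂ ∧ DiagModEq q m₂ ![1, 1])
    (hm₀₀ : IsTypeMatrix N₀ N₁ N₂ m₀₀ ∧ DiagModEq (q ^ 2) m₀₀ ![0, 0])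
    (hm₀₁p : IsTypeMatrix N₀ N₁ N₂ m₀₁p ∧ DiagModEq (q ^ 2) m₀₁p ![(q : ℤ), 0])
    (hm₀₁m : IsTypeMatrix N₀ N₁ N₂ m₀₁m ∧ DiagModEq (q ^ 2) m₀₁m ![(q : ℤ) * ω, 0])
    (hm₀₂ : ∀ α : (ZMod q)ˣ, IsTypeMatrix N₀ N₁ N₂ (m₀₂ α) ∧
      DiagModEq (q ^ 2) (m₀₂ α) ![(q : ℤ), (q : ℤ) * ((α : ZMod q).val : ℤ)])
    (hm₁₁ : IsTypeMatrix N₀ N₁ N₂ m₁₁ ∧ DiagModEq (q ^ 2) m₁₁ ![1, 0])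
    (hm₁₂p : IsTypeMatrix N₀ N₁ N₂ m₁₂p ∧ DiagModEq (q ^ 2) m₁₂p ![1, (q : ℤ)])
    (hm₁₂m : IsTypeMatrix N₀ N₁ N₂ m₁₂m ∧ DiagModEq (q ^ 2) m₁₂m ![1, (q : ℤ) * ω])
    (τ : Matrix (Fin 2) (Fin 2) ℂ) (g : Sp2Z) :
    ∃ g' : Sp2Z, IsShift q g g' ∧
      cosetTerm k χ N m₀ ((q : ℂ) • τ) g =
        component χ N₁ (q : ZMod N₁) * cosetTerm k χ (q * N) m₀₀ τ g' ∧
      cosetTerm k χ N m₁ ((q : ℂ) • τ) g =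
        component χ (N₀ * N₂) (q : ZMod (N₀ * N₂)) * (q : ℂ)⁻¹ ^ k *
          cosetTerm k χ (q * N) m₁₁ τ g' +
        component χ N₁ (q : ZMod N₁) * (cosetTerm k χ (q * N) m₀₁p τ g' +
          component χ q (ω : ZMod q) * cosetTerm k χ (q * N) m₀₁m τ g') ∧
      cosetTerm k χ N m₂ ((q : ℂ) • τ) g =
        component χ N₁ (q : ZMod N₁) * ((q : ℂ)⁻¹ ^ k) ^ 2 * cosetTerm k χ N m₂ τ g' +
        component χ (N₀ * N₂) (q : ZMod (N₀ * N₂)) * (q : ℂ)⁻¹ ^ k *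
          (cosetTerm k χ (q * N) m₁₂p τ g' +
            component χ q (ω : ZMod q) * cosetTerm k χ (q * N) m₁₂m τ g') +
        component χ N₁ (q : ZMod N₁) * ∑ α : (ZMod q)ˣ, component χ q (α : ZMod q) *
          cosetTerm k χ (q * N) (m₀₂ α) τ g' := by
  have hqp : q.Prime := Fact.out
  have hc : q.Coprime (N₀ * N₁ * N₂) := Nat.coprime_of_squarefree_mul (hqN ▸ hN)
  have hN0 := hN.ne_zero
  have hψ : component χ q ^ 2 = 1 := component_sq hqN hN0 hc hχ
  have e₁ : N₁ * (q * (N₀ * N₂)) = N := by rw [← hqN]; ring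
  have e₂ : N₀ * N₂ * (q * N₁) = N := by rw [← hqN]; ring
  have hs₁ : component χ N₁ (q : ZMod N₁) ^ 2 = 1 := by
    refine sq_eq_one_of_isUnit (component_sq e₁ hN0
      (Nat.coprime_of_squarefree_mul (e₁ ▸ hN)) hχ) ((ZMod.isUnit_iff_coprime _ _).2 ?_)
    exact hc.coprime_dvd_right ⟨N₀ * N₂, by ring⟩
  have hs₂ : component χ (N₀ * N₂) (q : ZMod (N₀ * N₂)) ^ 2 = 1 := by
    refine sq_eq_one_of_isUnit (component_sq e₂ hN0
      (Nat.coprime_of_squarefree_mul (e₂ ▸ hN)) hχ) ((ZMod.isUnit_iff_coprime _ _).2 ?_)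
    exact hc.coprime_dvd_right ⟨N₁, by ring⟩
  have lq : ∀ {m t : Fin 2 → ℤ}, IsTypeMatrix N₀ N₁ N₂ m ∧ DiagModEq q m t →
      ∀ C D, localCoeff χ N m C D =
        localCoeff (component χ (N₀ * N₁ * N₂)) (N₀ * N₁ * N₂) m₀ C D *
          localCoeff (component χ q) q t C D := fun {m t} h C D =>
    (congrArg (fun n => localCoeff χ n m C D) (hqN.symm.trans (mul_comm _ _))).trans
      (localCoeff_eq_mul hN hχ hqN dvd_rfl (dvd_pow_self q two_ne_zero) h.1 hm₀.1 h.2 C D)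
  have lqq : ∀ {m t : Fin 2 → ℤ}, IsTypeMatrix N₀ N₁ N₂ m ∧ DiagModEq (q ^ 2) m t →
      ∀ C D, localCoeff χ (q * N) m C D =
        localCoeff (component χ (N₀ * N₁ * N₂)) (N₀ * N₁ * N₂) m₀ C D *
          localCoeff (component χ q) (q ^ 2) t C D := fun {m t} h C D =>
    (congrArg (fun n => localCoeff χ n m C D) (by rw [← hqN]; ring)).trans
      (localCoeff_eq_mul hN hχ hqN (dvd_pow_self q two_ne_zero) dvd_rfl h.1 hm₀.1 h.2 C D)
  obtain ⟨δ, hδ, hcase⟩ := exists_normalized q g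
  have hinv : ∀ m σ, cosetTerm k χ N m σ g = cosetTerm k χ N m σ (δ * g) := fun m σ =>
    (cosetTerm_mul hN dvd_rfl hχ hχk σ hδ g).symm
  have hshift : ∀ g', IsShift q (δ * g) g' → IsShift q g g' := fun g' h => by
    have := h.mul_left (inv_mem hδ)
    rwa [inv_mul_cancel_left] at this
  simp only [hinv]
  generalize δ * g = h at hcase hshift
  clear hinv hδ
  have hsym := blockC_mul_blockD_transpose h
  rcases hcase with h0 | h0 | ⟨c₁₁, c₁₂, c₂₁, c₂₂, d₁₁, d₁₂, d₂₁, d₂₂, hC, hD, hd⟩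
  -- D invertible modulo q: Q = 1, j = 0, and the prime-to-q factor changes by χ_{N₁}(q).
  · obtain ⟨g', hC, hD⟩ := exists_shift_of_det_ne_zero h0
    have hC1 : (q : ℤ) • blockC h = 1 * blockC g' := by rw [hC, Matrix.one_mul]
    have hD1 : blockD h = 1 * blockD g' := by rw [hD, Matrix.one_mul]
    have hQ : (1 : Matrix (Fin 2) (Fin 2) ℤ).det = (q : ℤ) ^ 0 := by simp
    refine ⟨g', hshift _ (isShift_of_eq hC1 hD1), ?_⟩
    have hL := localCoeff_shift hN hχ hqN hm₀.1 hC1 hD1 hQ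
    have hS := oneSlash_shift (k := k) hC1 hD1 hQ τ
    obtain ⟨i1, ⟨i2, i3⟩, i4, i5, i6, i7⟩ := localCoeff_of_det_ne_zero hq hω hψ hsym h0
    have hL' : localCoeff (component χ (N₀ * N₁ * N₂)) (N₀ * N₁ * N₂) m₀ (blockC h) (blockD h) =
        component χ N₁ (q : ZMod N₁) *
          localCoeff (component χ (N₀ * N₁ * N₂)) (N₀ * N₁ * N₂) m₀ ((q : ℤ) • blockC h)
            (blockD h) := by
      rw [← hC, ← hD, hL, hD]
      linear_combination -localCoeff (component χ (N₀ * N₁ * N₂)) (N₀ * N₁ * N₂) m₀ (blockC h)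
        (blockD h) * hs₁
    simp only [cosetTerm, lq hm₀, lq hm₁, lq hm₂, lqq hm₀₀, lqq hm₀₁p, lqq hm₀₁m,
      lqq (hm₀₂ _), lqq hm₁₁, lqq hm₁₂p, lqq hm₁₂m, hL', hS, i1, i2, i4, hC, hD, i3, i5, i6, i7,
      pow_zero, one_mul, mul_zero, zero_mul, add_zero, zero_add]
    refine ⟨by ring, by ring, ?_⟩
    simp only [Finset.mul_sum, Finset.sum_mul]
    exact Finset.sum_congr rfl fun _ _ => by ring
  -- D zero modulo q: Q = q · 1, j = 2, and the prime-to-q factor changes by χ_{N₁}(q)³ = χ_{N₁}(q).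
  -- Only the series with base I modulo q, at level N, survives.
  · obtain ⟨h1, g', hC, hD⟩ := exists_shift_of_dvd h0
    have hC1 : (q : ℤ) • blockC h = (q : ℤ) • 1 * blockC g' := by
      rw [hC, Matrix.smul_mul, Matrix.one_mul]
    have hD1 : blockD h = (q : ℤ) • 1 * blockD g' := by rw [hD, Matrix.smul_mul, Matrix.one_mul]
    have hQ : ((q : ℤ) • (1 : Matrix (Fin 2) (Fin 2) ℤ)).det = (q : ℤ) ^ 2 := by
      rw [det_smul, det_one, mul_one, Fintype.card_fin]
    refine ⟨g', hshift _ (isShift_of_eq hC1 hD1), ?_⟩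
    have hL := localCoeff_shift hN hχ hqN hm₀.1 hC1 hD1 hQ
    have hS := oneSlash_shift (k := k) hC1 hD1 hQ τ
    have hsym' := blockC_mul_blockD_transpose g'
    rw [hC] at hsym'
    obtain ⟨i1, i2, i3⟩ := localCoeff_of_dvd hψ h1 hsym hsym'
    have j1 : ∀ a : ℤ, localCoeff (component χ q) (q ^ 2) ![a, 0] (blockC h) (blockD g') = 0 :=
      fun a => i2 a 0 (by simp)
    have j2 : ∀ a b : ℤ, localCoeff (component χ q) (q ^ 2) ![a, q * b] (blockC h) (blockD g') = 0 :=
      fun a b => i2 a _ (by simp)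
    have j3 : ∀ a : ℤ, localCoeff (component χ q) (q ^ 2) ![a, q] (blockC h) (blockD g') = 0 :=
      fun a => i2 a q (by simp)
    have hL' : localCoeff (component χ (N₀ * N₁ * N₂)) (N₀ * N₁ * N₂) m₀ (blockC h) (blockD h) =
        component χ N₁ (q : ZMod N₁) *
          localCoeff (component χ (N₀ * N₁ * N₂)) (N₀ * N₁ * N₂) m₀ (blockC h) (blockD g') := by
      rw [← hC, hL, hC, hs₂, one_mul, ← mul_assoc, ← pow_succ',
        show component χ N₁ (q : ZMod N₁) ^ (2 + 1 + 1) = 1 by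
          rw [show 2 + 1 + 1 = 2 * 2 from rfl, pow_mul, hs₁, one_pow], one_mul]
    simp only [cosetTerm, lq hm₀, lq hm₁, lq hm₂, lqq hm₀₀, lqq hm₀₁p, lqq hm₀₁m,
      lqq (hm₀₂ _), lqq hm₁₁, lqq hm₁₂p, lqq hm₁₂m, hL', hS, i1, i3, hC, j1, j2, j3,
      mul_zero, zero_mul, add_zero, Finset.sum_const_zero, true_and]
    ring
  -- D of rank one modulo q: Q = diag(1, q), j = 1, and the prime-to-q factor changes by
  -- χ_{N₀N₂}(q), since χ_{N₁}(q)² = 1.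
  · obtain ⟨hs, hc', g', hC', hD'⟩ := exists_shift_of_rank_one hC hD hd
    have hC1 : (q : ℤ) • blockC h = diagonal ![1, (q : ℤ)] * blockC g' := by
      rw [hC, hC']
      ext i j
      rw [Matrix.smul_apply]
      fin_cases i <;> fin_cases j <;> simp [Matrix.mul_apply, Fin.sum_univ_two]
    have hD1 : blockD h = diagonal ![1, (q : ℤ)] * blockD g' := by
      rw [hD, hD']
      ext i j
      fin_cases i <;> fin_cases j <;> simp [Matrix.mul_apply, Fin.sum_univ_two]
    have hQ : (diagonal ![1, (q : ℤ)]).det = (q : ℤ) ^ 1 := by simp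
    refine ⟨g', hshift _ (isShift_of_eq hC1 hD1), ?_⟩
    have hL := localCoeff_shift hN hχ hqN hm₀.1 hC1 hD1 hQ
    have hS := oneSlash_shift (k := k) hC1 hD1 hQ τ
    obtain ⟨⟨i1, i2⟩, ⟨i3, i4, i5⟩, i6, i7, i8⟩ :=
      localCoeff_of_rank_one hω hψ hs hc' hd hC hD hC' hD'
    have hL' : localCoeff (component χ (N₀ * N₁ * N₂)) (N₀ * N₁ * N₂) m₀ (blockC h) (blockD h) =
        component χ (N₀ * N₂) (q : ZMod (N₀ * N₂)) *
          localCoeff (component χ (N₀ * N₁ * N₂)) (N₀ * N₁ * N₂) m₀ (blockC g') (blockD g') := by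
      rw [hL, pow_one, hs₁, mul_one, ← mul_assoc, ← pow_two, hs₂, one_mul]
    simp only [cosetTerm, lq hm₀, lq hm₁, lq hm₂, lqq hm₀₀, lqq hm₀₁p, lqq hm₀₁m,
      lqq (hm₀₂ _), lqq hm₁₁, lqq hm₁₂p, lqq hm₁₂m, hL', hS, i1, i2, i3, i4, i5, i6, i7, i8,
      mul_zero, zero_mul, add_zero, zero_add, Finset.sum_const_zero, true_and, pow_one]
    exact ⟨by ring, by ring⟩

end

section
variable {k N : ℕ} {χ : DirichletCharacter ℂ N}

theorem hasSum_siegelEisenstein {n : ℕ} (hN : Squarefree N) (hNn : N ∣ n) (hχ : χ ^ 2 = 1)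
    (hχk : χ (-1) = (-1) ^ k) (m : Fin 2 → ℤ) {τ : Matrix (Fin 2) (Fin 2) ℂ}
    (h : Summable fun c : CosetSpace => oneSlash k c.out τ) :
    HasSum (fun c : CosetSpace => cosetTerm k χ n m τ c.out)
      (siegelEisenstein k χ n (lowerUnipotent m) τ) := by
  rw [siegelEisenstein_eq_tsum hN hNn hχ hχk]
  exact (summable_cosetTerm h).hasSum

theorem shift_siegelEisenstein_eq {q : ℕ} (hN : Squarefree N) (hχ : χ ^ 2 = 1)
    (hχk : χ (-1) = (-1) ^ k) (m : Fin 2 → ℤ) {τ : Matrix (Fin 2) (Fin 2) ℂ}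
    (φ : CosetSpace ≃ CosetSpace) {F : CosetSpace → ℂ} {a : ℂ} (hF : HasSum F a)
    (h : ∀ c : CosetSpace, cosetTerm k χ N m ((q : ℂ) • τ) c.out = F (φ c)) :
    shift q (siegelEisenstein k χ N (lowerUnipotent m)) τ = a := by
  rw [shift, siegelEisenstein_eq_tsum hN dvd_rfl hχ hχk, tsum_congr h, φ.tsum_eq F, hF.tsum_eq]

theorem shift_siegelEisenstein {q N₀ N₁ N₂ : ℕ} [Fact q.Prime] {ω : ℤ}
    (hq : Odd q) (hN : Squarefree N) (hχ : χ ^ 2 = 1)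
    (hχk : χ (-1) = (-1) ^ k) (hqN : q * (N₀ * N₁ * N₂) = N) (hω : legendreSym q ω = -1)
    {m₀ m₁ m₂ m₀₀ m₀₁p m₀₁m m₁₁ m₁₂p m₁₂m : Fin 2 → ℤ} {m₀₂ : (ZMod q)ˣ → Fin 2 → ℤ}
    (hm₀ : IsTypeMatrix N₀ N₁ N₂ m₀ ∧ DiagModEq q m₀ ![0, 0])
    (hm₁ : IsTypeMatrix N₀ N₁ N₂ m₁ ∧ DiagModEq q m₁ ![1, 0])
    (hm₂ : IsTypeMatrix N₀ N₁ N₂ m₂ ∧ DiagModEq q m₂ ![1, 1])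
    (hm₀₀ : IsTypeMatrix N₀ N₁ N₂ m₀₀ ∧ DiagModEq (q ^ 2) m₀₀ ![0, 0])
    (hm₀₁p : IsTypeMatrix N₀ N₁ N₂ m₀₁p ∧ DiagModEq (q ^ 2) m₀₁p ![(q : ℤ), 0])
    (hm₀₁m : IsTypeMatrix N₀ N₁ N₂ m₀₁m ∧ DiagModEq (q ^ 2) m₀₁m ![(q : ℤ) * ω, 0])
    (hm₀₂ : ∀ α : (ZMod q)ˣ, IsTypeMatrix N₀ N₁ N₂ (m₀₂ α) ∧
      DiagModEq (q ^ 2) (m₀₂ α) ![(q : ℤ), (q : ℤ) * ((α : ZMod q).val : ℤ)])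
    (hm₁₁ : IsTypeMatrix N₀ N₁ N₂ m₁₁ ∧ DiagModEq (q ^ 2) m₁₁ ![1, 0])
    (hm₁₂p : IsTypeMatrix N₀ N₁ N₂ m₁₂p ∧ DiagModEq (q ^ 2) m₁₂p ![1, (q : ℤ)])
    (hm₁₂m : IsTypeMatrix N₀ N₁ N₂ m₁₂m ∧ DiagModEq (q ^ 2) m₁₂m ![1, (q : ℤ) * ω])
    {τ : Matrix (Fin 2) (Fin 2) ℂ} (hs : Summable fun c : CosetSpace => oneSlash k c.out τ) :
    shift q (siegelEisenstein k χ N (lowerUnipotent m₀)) τ =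
      component χ N₁ (q : ZMod N₁) * siegelEisenstein k χ (q * N) (lowerUnipotent m₀₀) τ ∧
    shift q (siegelEisenstein k χ N (lowerUnipotent m₁)) τ =
      component χ (N₀ * N₂) (q : ZMod (N₀ * N₂)) * (q : ℂ)⁻¹ ^ k *
        siegelEisenstein k χ (q * N) (lowerUnipotent m₁₁) τ +
      component χ N₁ (q : ZMod N₁) * (siegelEisenstein k χ (q * N) (lowerUnipotent m₀₁p) τ +
        component χ q (ω : ZMod q) * siegelEisenstein k χ (q * N) (lowerUnipotent m₀₁m) τ) ∧
    shift q (siegelEisenstein k χ N (lowerUnipotent m₂)) τ =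
      component χ N₁ (q : ZMod N₁) * ((q : ℂ)⁻¹ ^ k) ^ 2 *
        siegelEisenstein k χ N (lowerUnipotent m₂) τ +
      component χ (N₀ * N₂) (q : ZMod (N₀ * N₂)) * (q : ℂ)⁻¹ ^ k *
        (siegelEisenstein k χ (q * N) (lowerUnipotent m₁₂p) τ +
          component χ q (ω : ZMod q) * siegelEisenstein k χ (q * N) (lowerUnipotent m₁₂m) τ) +
      component χ N₁ (q : ZMod N₁) * ∑ α : (ZMod q)ˣ, component χ q (α : ZMod q) *
        siegelEisenstein k χ (q * N) (lowerUnipotent (m₀₂ α)) τ := by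
  have hqp : q.Prime := Fact.out
  have hNn : N ∣ q * N := dvd_mul_left N q
  have hE := fun {n : ℕ} (hn : N ∣ n) m => hasSum_siegelEisenstein hN hn hχ hχk m hs
  have hT := cosetTerm_shift hq hN hχ hχk hqN hω hm₀ hm₁ hm₂ hm₀₀ hm₀₁p hm₀₁m hm₀₂ hm₁₁ hm₁₂p
    hm₁₂m τ
  obtain ⟨φ, hφ⟩ := exists_shift_equiv hqp.ne_zero fun g => (hT g).imp fun _ h => h.1
  -- Invariance under Γ_∞ replaces the representative g' by the chosen representative of φ c, so
  -- that the sum can be reindexed by φ.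
  have hinv : ∀ {n : ℕ}, N ∣ n → ∀ (c : CosetSpace) g', IsShift q c.out g' → ∀ m,
      cosetTerm k χ n m τ g' = cosetTerm k χ n m τ (φ c).out := fun hn c g' h m => by
    rw [← cosetTerm_out hN hn hχ hχk τ g', ← hφ _ _ h, Quotient.out_eq']
  refine ⟨?_, ?_, ?_⟩
  · refine shift_siegelEisenstein_eq hN hχ hχk m₀ φ ((hE hNn m₀₀).mul_left _) fun c => ?_
    obtain ⟨g', h, h1, -⟩ := hT c.out
    simp only [h1, hinv hNn c g' h]
  · refine shift_siegelEisenstein_eq hN hχ hχk m₁ φ (((hE hNn m₁₁).mul_left _).add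
      (((hE hNn m₀₁p).add ((hE hNn m₀₁m).mul_left _)).mul_left _)) fun c => ?_
    obtain ⟨g', h, -, h1, -⟩ := hT c.out
    simp only [h1, hinv hNn c g' h]
  · refine shift_siegelEisenstein_eq hN hχ hχk m₂ φ ((((hE dvd_rfl m₂).mul_left _).add
        (((hE hNn m₁₂p).add ((hE hNn m₁₂m).mul_left _)).mul_left _)).add
        ((hasSum_sum fun α _ => (hE hNn (m₀₂ α)).mul_left _).mul_left _)) fun c => ?_
    obtain ⟨g', h, -, -, h1⟩ := hT c.out
    simp only [h1, hinv hNn c g' h, hinv dvd_rfl c g' h]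

end

/-! ### Convergence: integral points on the Plücker quadric. -/

/-- The integral points of the Plücker quadric, without the origin. -/
def quadricPoints : Set (Fin 5 → ℤ) :=
  {p | p ≠ 0 ∧ p 0 * p 4 = p 1 * p 3 - p 2 ^ 2}

/-- The `ℓ¹`-norm of an integral vector. -/
def l1Norm (p : Fin 5 → ℤ) : ℤ := ∑ i, |p i|

theorem abs_le_l1Norm (p : Fin 5 → ℤ) (i : Fin 5) : |p i| ≤ l1Norm p :=
  Finset.single_le_sum (f := fun i => |p i|) (fun _ _ => abs_nonneg _) (Finset.mem_univ i)

theorem one_le_l1Norm {p : Fin 5 → ℤ} (hp : p ≠ 0) : 1 ≤ l1Norm p := by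
  obtain ⟨i, hi⟩ := Function.ne_iff.1 hp
  exact (Int.one_le_abs hi).trans (abs_le_l1Norm p i)

/-- Coordinates on the part of the quadric where the first coordinate dominates the second. -/
def quadricKey (p : Fin 5 → ℤ) : Fin 5 → ℤ :=
  ![Int.gcd (p 0) (p 1), p 0 / Int.gcd (p 0) (p 1), p 1 / Int.gcd (p 0) (p 1), p 2,
    p 3 / (p 0 / Int.gcd (p 0) (p 1))]

/-- With p₀ = ga, p₁ = gb and a, b coprime, the equation reads g(b p₃ - a p₄) = p₂². So g, a, b and
p₂ determine p₃ modulo a; the quotient of p₃ by a fixes p₃, and then p₄ follows. -/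
theorem quadricKey_injective {p p' : Fin 5 → ℤ} (h : p 0 * p 4 = p 1 * p 3 - p 2 ^ 2)
    (h' : p' 0 * p' 4 = p' 1 * p' 3 - p' 2 ^ 2) (h0 : p 0 ≠ 0)
    (hk : quadricKey p = quadricKey p') : p = p' := by
  have hg : 0 < Int.gcd (p 0) (p 1) := Int.gcd_pos_of_ne_zero_left _ h0
  have k0 : (Int.gcd (p 0) (p 1) : ℤ) = Int.gcd (p' 0) (p' 1) := congrFun hk 0
  have k1 : p 0 / Int.gcd (p 0) (p 1) = p' 0 / Int.gcd (p' 0) (p' 1) := congrFun hk 1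
  have k2 : p 1 / Int.gcd (p 0) (p 1) = p' 1 / Int.gcd (p' 0) (p' 1) := congrFun hk 2
  have k3 : p 2 = p' 2 := congrFun hk 3
  have k4 : p 3 / (p 0 / Int.gcd (p 0) (p 1)) = p' 3 / (p' 0 / Int.gcd (p' 0) (p' 1)) :=
    congrFun hk 4
  have e0 := Int.ediv_mul_cancel (Int.gcd_dvd_left (p 0) (p 1))
  have e1 := Int.ediv_mul_cancel (Int.gcd_dvd_right (p 0) (p 1))
  have e0' := Int.ediv_mul_cancel (Int.gcd_dvd_left (p' 0) (p' 1))
  have e1' := Int.ediv_mul_cancel (Int.gcd_dvd_right (p' 0) (p' 1))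
  have hcop : IsCoprime (p 0 / Int.gcd (p 0) (p 1)) (p 1 / Int.gcd (p 0) (p 1)) :=
    Int.isCoprime_iff_gcd_eq_one.2 (Int.gcd_ediv_gcd_ediv_gcd hg)
  rw [← k1, ← k0] at e0'
  rw [← k2, ← k0] at e1'
  rw [← k1] at k4
  obtain ⟨a, ha⟩ : ∃ a, a = p 0 / (Int.gcd (p 0) (p 1) : ℤ) := ⟨_, rfl⟩
  obtain ⟨b, hb⟩ : ∃ b, b = p 1 / (Int.gcd (p 0) (p 1) : ℤ) := ⟨_, rfl⟩
  obtain ⟨g, hgg⟩ : ∃ g : ℤ, g = Int.gcd (p 0) (p 1) := ⟨_, rfl⟩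
  rw [← ha] at e0 e0' k4 hcop
  rw [← hb] at e1 e1' hcop
  rw [← hgg] at e0 e1 e0' e1'
  have hg0 : g ≠ 0 := by rw [hgg]; exact_mod_cast hg.ne'
  have ha0 : a ≠ 0 := by rintro rfl; exact h0 (by rw [← e0, zero_mul])
  have key : a * (p 4 - p' 4) = b * (p 3 - p' 3) := by
    apply mul_left_cancel₀ hg0
    linear_combination h - h' + p 4 * e0 - p' 4 * e0' - p 3 * e1 + p' 3 * e1' -
      (p 2 + p' 2) * k3
  have h3 : p 3 = p' 3 := by
    have hd : a ∣ p 3 - p' 3 := hcop.dvd_of_dvd_mul_left ⟨_, key.symm⟩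
    have hm : p 3 % a = p' 3 % a := Int.emod_eq_emod_iff_emod_sub_eq_zero.2 (Int.emod_eq_zero_of_dvd hd)
    rw [← Int.mul_ediv_add_emod (p 3) a, ← Int.mul_ediv_add_emod (p' 3) a, k4, hm]
  have h4 : p 4 = p' 4 := by
    rw [h3, sub_self, mul_zero] at key
    exact sub_eq_zero.1 ((mul_eq_zero.1 key).resolve_left ha0)
  funext i
  fin_cases i
  · exact e0.symm.trans e0'
  · exact e1.symm.trans e1'
  · exact k3
  · exact h3
  · exact h4

/-- Since |b| ≤ |a|, the factors of a and b together cost |a|²: one |a| joins g to give |p₀|, the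
other joins the quotient p₃ / a to give at most 3 times the norm. The four remaining factors cost 2
each, whence 48 = 16 · 3. -/
theorem prod_quadricKey_le {p : Fin 5 → ℤ} (h0 : p 0 ≠ 0) (h1 : |p 1| ≤ |p 0|) :
    ∏ i, (1 + |quadricKey p i|) ≤ 48 * l1Norm p ^ 3 := by
  have hg : 0 < Int.gcd (p 0) (p 1) := Int.gcd_pos_of_ne_zero_left _ h0
  have e0 := Int.ediv_mul_cancel (Int.gcd_dvd_left (p 0) (p 1))
  have e1 := Int.ediv_mul_cancel (Int.gcd_dvd_right (p 0) (p 1))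
  rw [Fin.prod_univ_five]
  change (1 + |(Int.gcd (p 0) (p 1) : ℤ)|) * (1 + |p 0 / Int.gcd (p 0) (p 1)|) *
    (1 + |p 1 / Int.gcd (p 0) (p 1)|) * (1 + |p 2|) *
    (1 + |p 3 / (p 0 / Int.gcd (p 0) (p 1))|) ≤ _
  obtain ⟨a, ha⟩ : ∃ a, a = p 0 / (Int.gcd (p 0) (p 1) : ℤ) := ⟨_, rfl⟩
  obtain ⟨b, hb⟩ : ∃ b, b = p 1 / (Int.gcd (p 0) (p 1) : ℤ) := ⟨_, rfl⟩
  obtain ⟨g, hgg⟩ : ∃ g : ℤ, g = Int.gcd (p 0) (p 1) := ⟨_, rfl⟩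
  rw [← ha, ← hb, ← hgg]
  rw [← ha, ← hgg] at e0
  rw [← hb, ← hgg] at e1
  have hg1 : 1 ≤ g := by rw [hgg]; exact_mod_cast hg
  have ha0 : a ≠ 0 := by rintro rfl; exact h0 (by rw [← e0, zero_mul])
  have ha1 : 1 ≤ |a| := Int.one_le_abs ha0
  have hab : |b| ≤ |a| := by
    rw [← e0, ← e1, abs_mul, abs_mul] at h1
    exact le_of_mul_le_mul_right h1 (by rw [abs_of_pos (by linarith)]; linarith)
  have hga : |a| * g ≤ l1Norm p := by
    have := abs_le_l1Norm p 0
    rwa [← e0, abs_mul, abs_of_pos (by linarith : 0 < g)] at this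
  have haM : |a| ≤ l1Norm p := le_trans (le_mul_of_one_le_right (abs_nonneg _) hg1) hga
  have ht : (1 + |p 3 / a|) * |a| ≤ 3 * l1Norm p := by
    have h1 : |a * (p 3 / a)| ≤ |p 3| + |a| := by
      have e : a * (p 3 / a) = p 3 - p 3 % a := by
        linear_combination Int.mul_ediv_add_emod (p 3) a
      rw [e]
      refine (abs_sub _ _).trans (add_le_add le_rfl ?_)
      rw [abs_of_nonneg (Int.emod_nonneg _ ha0)]
      exact (Int.emod_lt_abs _ ha0).le
    rw [abs_mul] at h1
    have := abs_le_l1Norm p 3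
    linarith
  have h2 : 1 + |p 2| ≤ 2 * l1Norm p := by
    have := abs_le_l1Norm p 2
    linarith
  have hM : 0 ≤ l1Norm p := by linarith
  calc (1 + |g|) * (1 + |a|) * (1 + |b|) * (1 + |p 2|) * (1 + |p 3 / a|)
      ≤ (2 * g) * (2 * |a|) * (2 * |a|) * (2 * l1Norm p) * (1 + |p 3 / a|) := by
        rw [abs_of_pos (by linarith : 0 < g)]
        gcongr <;> linarith
    _ = 16 * l1Norm p * (|a| * g) * ((1 + |p 3 / a|) * |a|) := by ring
    _ ≤ 16 * l1Norm p * l1Norm p * (3 * l1Norm p) := by gcongr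
    _ = 48 * l1Norm p ^ 3 := by ring

/-- The automorphism of the quadric which exchanges the first two coordinates. -/
def quadricSwap (p : Fin 5 → ℤ) : Fin 5 → ℤ := ![p 1, p 0, p 2, -p 4, -p 3]

theorem quadricSwap_injective : Function.Injective quadricSwap := by
  intro p p' h
  funext i
  fin_cases i
  · exact congrFun h 1
  · exact congrFun h 0
  · exact congrFun h 2
  · exact neg_injective (congrFun h 4)
  · exact neg_injective (congrFun h 3)

theorem l1Norm_quadricSwap (p : Fin 5 → ℤ) : l1Norm (quadricSwap p) = l1Norm p := by
  simp only [l1Norm, quadricSwap, Fin.sum_univ_five]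
  simp
  ring

/-- An injection of the quadric which shows that its points are as sparse as needed. -/
theorem exists_injective_key : ∃ f : quadricPoints → Fin 3 × (Fin 5 → ℤ), Function.Injective f ∧
    ∀ p, ∏ i, (1 + |(f p).2 i|) ≤ 48 * l1Norm p ^ 3 := by
  classical
  -- Three charts, kept apart by the tag: the locus p₀ = p₁ = 0, where p₂ = 0 as well; the region
  -- |p₁| ≤ |p₀|; and its mirror image under `quadricSwap`.
  refine ⟨fun p => if (p : Fin 5 → ℤ) 0 = 0 ∧ (p : Fin 5 → ℤ) 1 = 0 then
      (0, p) else if |(p : Fin 5 → ℤ) 1| ≤ |(p : Fin 5 → ℤ) 0| then (1, quadricKey p) else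
        (2, quadricKey (quadricSwap p)), ?_, ?_⟩
  · rintro ⟨p, hp0, hp⟩ ⟨p', hp0', hp'⟩ h
    have hs : ∀ {p : Fin 5 → ℤ}, p 0 * p 4 = p 1 * p 3 - p 2 ^ 2 →
        quadricSwap p 0 * quadricSwap p 4 =
          quadricSwap p 1 * quadricSwap p 3 - quadricSwap p 2 ^ 2 := fun {p} hp => by
      change p 1 * -p 3 = p 0 * -p 4 - p 2 ^ 2
      linear_combination hp
    refine Subtype.ext ?_
    change p = p'
    dsimp only at h
    split_ifs at h with h1 h2 h3 h4 h5 h6 h7 h8 <;> rw [Prod.mk.injEq] at h <;>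
      first
      | exact absurd h.1 (by decide)
      | exact h.2
      | skip
    · refine quadricKey_injective hp hp' (fun h0 => h1 ⟨h0, ?_⟩) h.2
      rw [h0, abs_zero] at h4
      exact abs_nonpos_iff.1 h4
    · refine quadricSwap_injective (quadricKey_injective (hs hp) (hs hp') (fun h0 => ?_) h.2)
      have h0' : p 1 = 0 := h0
      rw [h0', abs_zero] at h4
      exact h4 (abs_nonneg _)
  · rintro ⟨p, hp0, hp⟩
    have hM := one_le_l1Norm hp0
    dsimp only
    split_ifs with h1 h2
    · have h2 : p 2 = 0 := by
        rw [h1.1, h1.2] at hp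
        simpa using hp
      have b3 := abs_le_l1Norm p 3
      have b4 := abs_le_l1Norm p 4
      simp only [Fin.prod_univ_five, h1.1, h1.2, h2, abs_zero, add_zero, mul_one]
      calc 1 * 1 * 1 * (1 + |p 3|) * (1 + |p 4|)
          ≤ 1 * 1 * 1 * (2 * l1Norm p) * (2 * l1Norm p) := by gcongr <;> linarith
        _ ≤ 48 * l1Norm p ^ 3 := by nlinarith [sq_nonneg (l1Norm p)]
    · refine prod_quadricKey_le (fun h0 => h1 ⟨h0, ?_⟩) h2
      rw [h0, abs_zero] at h2
      exact abs_nonpos_iff.1 h2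
    · rw [← l1Norm_quadricSwap p]
      refine prod_quadricKey_le (fun h0 => ?_) (not_le.1 h2).le
      have h0' : p 1 = 0 := h0
      rw [h0', abs_zero] at h2
      exact h2 (abs_nonneg _)

theorem summable_one_add_abs_rpow {b : ℝ} (hb : 1 < b) :
    Summable fun n : ℤ => (1 + |(n : ℝ)|) ^ (-b) := by
  refine Summable.of_norm_bounded_eventually (Real.summable_abs_int_rpow hb) ?_
  filter_upwards [(Set.finite_singleton (0 : ℤ)).compl_mem_cofinite] with n hn
  have hn' : 0 < |(n : ℝ)| := abs_pos.2 (Int.cast_ne_zero.2 hn)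
  rw [Real.norm_of_nonneg (by positivity)]
  exact Real.rpow_le_rpow_of_nonpos hn' (by linarith) (by linarith)

theorem summable_prod_one_add_abs_rpow {b : ℝ} (hb : 1 < b) (n : ℕ) :
    Summable fun x : Fin n → ℤ => (∏ i, (1 + |(x i : ℝ)|)) ^ (-b) := by
  induction n with
  | zero => exact Summable.of_finite
  | succ n ih =>
    rw [← (Fin.consEquiv fun _ => ℤ).summable_iff]
    refine ((summable_one_add_abs_rpow hb).mul_of_nonneg ih (fun _ => by positivity)
      (fun _ => by positivity)).congr fun x => ?_
    rw [Function.comp_apply, Fin.prod_univ_succ, Real.mul_rpow (by positivity) (by positivity)]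
    rfl

/-- If the product of the factors 1 + |xᵢ| is at most 48 M³, then M⁻⁴ is at most 48^{4/3} times the
product to the power -4/3, and the exponent 4/3 > 1 makes the sum over ℤ⁵ converge. -/
theorem summable_l1Norm : Summable fun p : quadricPoints => ((l1Norm p : ℝ) ^ 4)⁻¹ := by
  obtain ⟨f, hf, hle⟩ := exists_injective_key
  have hb : (1 : ℝ) < 4 / 3 := by norm_num
  have h1 : Summable fun x : Fin 3 × (Fin 5 → ℤ) =>
      (1 : ℝ) * (∏ i, (1 + |(x.2 i : ℝ)|)) ^ (-(4 / 3) : ℝ) :=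
    (Summable.of_finite (f := fun _ : Fin 3 => (1 : ℝ))).mul_of_nonneg
      (summable_prod_one_add_abs_rpow hb 5) (fun _ => zero_le_one) (fun _ => by positivity)
  refine Summable.of_nonneg_of_le (fun p => by positivity) (fun p => ?_)
    ((h1.comp_injective hf).mul_left ((48 : ℝ) ^ (4 / 3 : ℝ)))
  have hM : (1 : ℝ) ≤ l1Norm p := by exact_mod_cast one_le_l1Norm p.2.1
  have hM0 : (0 : ℝ) ≤ l1Norm p := by linarith
  have hle' : (∏ i, (1 + |((f p).2 i : ℝ)|)) ≤ 48 * (l1Norm p : ℝ) ^ 3 := by exact_mod_cast hle p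
  have hpos : 0 < ∏ i, (1 + |((f p).2 i : ℝ)|) := Finset.prod_pos fun _ _ => by positivity
  have h2 := Real.rpow_le_rpow_of_nonpos hpos hle' (by norm_num : (-(4 / 3) : ℝ) ≤ 0)
  have h3 : ((l1Norm p : ℝ) ^ 3) ^ (-(4 / 3) : ℝ) = ((l1Norm p : ℝ) ^ 4)⁻¹ := by
    rw [← Real.rpow_natCast, ← Real.rpow_mul hM0, ← Real.rpow_natCast, ← Real.rpow_neg hM0]
    norm_num
  rw [Real.mul_rpow (by norm_num) (by positivity), h3, Real.rpow_neg (by norm_num)] at h2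
  rw [Function.comp_apply, one_mul]
  have h48 : (0 : ℝ) < 48 ^ (4 / 3 : ℝ) := by positivity
  calc ((l1Norm p : ℝ) ^ 4)⁻¹ = 48 ^ (4 / 3 : ℝ) * ((48 ^ (4 / 3 : ℝ))⁻¹ * ((l1Norm p : ℝ) ^ 4)⁻¹) := by
        rw [mul_inv_cancel_left₀ h48.ne']
    _ ≤ _ := mul_le_mul_of_nonneg_left h2 h48.le

/-! ### Plücker coordinates of cosets and the lower bound for det(Cτ + D). -/

/-- The Plücker coordinates of the bottom row of `g`. -/
def plucker (g : Sp2Z) : Fin 5 → ℤ :=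
  ![(blockC g).det, ((blockD g).adjugate * blockC g) 0 0, ((blockD g).adjugate * blockC g) 0 1,
    ((blockD g).adjugate * blockC g) 1 1, (blockD g).det]

theorem adjugate_mul_apply_comm {R : Type*} [CommRing R] {C D : Matrix (Fin 2) (Fin 2) R}
    (h : C * Dᵀ = D * Cᵀ) : (D.adjugate * C) 1 0 = (D.adjugate * C) 0 1 := by
  have := congrFun (congrFun h 0) 1
  simp only [Matrix.mul_apply, Fin.sum_univ_two, transpose_apply] at this
  simp [adjugate_fin_two, Matrix.mul_apply, Fin.sum_univ_two]
  linear_combination -this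

/-- The equation is det(adj(D) C) = det D · det C for the symmetric matrix adj(D) C. The coordinates
cannot all vanish because det(C(-Bᵀ) + D Aᵀ) = 1 expands into terms each containing one of them. -/
theorem plucker_mem (g : Sp2Z) : plucker g ∈ quadricPoints := by
  have hs := adjugate_mul_apply_comm (blockC_mul_blockD_transpose g)
  constructor
  · intro h
    have h0 : (blockC g).det = 0 := congrFun h 0
    have h1 : ((blockD g).adjugate * blockC g) 0 0 = 0 := congrFun h 1
    have h2 : ((blockD g).adjugate * blockC g) 0 1 = 0 := congrFun h 2
    have h3 : ((blockD g).adjugate * blockC g) 1 1 = 0 := congrFun h 3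
    have h4 : (blockD g).det = 0 := congrFun h 4
    have hS : (blockD g).adjugate * blockC g = 0 := by
      ext i j
      fin_cases i <;> fin_cases j
      · exact h1
      · exact h2
      · exact hs.trans h2
      · exact h3
    have e : ∀ X Y : Matrix (Fin 2) (Fin 2) ℤ, (X + Y).det = X.det + (Y.adjugate * X).trace + Y.det := by
      intro X Y
      simp [det_fin_two, adjugate_fin_two, trace_fin_two, vecMul, dotProduct, Fin.sum_univ_two]
      ring
    have h5 := congrArg det (blockC_mul_add_blockD_mul g)
    rw [e, det_mul, det_mul, h0, h4, adjugate_mul_distrib, Matrix.mul_assoc,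
      ← Matrix.mul_assoc _ (blockC g), hS] at h5
    simp at h5
  · change (blockC g).det * (blockD g).det = ((blockD g).adjugate * blockC g) 0 0 *
      ((blockD g).adjugate * blockC g) 1 1 - ((blockD g).adjugate * blockC g) 0 1 ^ 2
    have h := det_mul (blockD g).adjugate (blockC g)
    rw [det_adjugate, det_fin_two, hs] at h
    simp only [Fintype.card_fin, Nat.add_one_sub_one, pow_one] at h
    linear_combination -h

/-- The linear form on Plücker coordinates which computes `det (C τ + D)`. -/
noncomputable def pluckerForm (τ : Matrix (Fin 2) (Fin 2) ℂ) (v : Fin 5 → ℝ) : ℂ :=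
  v 0 * τ.det + v 1 * τ 0 0 + 2 * v 2 * τ 0 1 + v 3 * τ 1 1 + v 4

theorem det_eq_pluckerForm {τ : Matrix (Fin 2) (Fin 2) ℂ} (hτ : τ.IsSymm) (g : Sp2Z) :
    ((blockC g).map (Int.cast : ℤ → ℂ) * τ + (blockD g).map (Int.cast : ℤ → ℂ)).det =
      pluckerForm τ (fun i => (plucker g i : ℝ)) := by
  have hs := adjugate_mul_apply_comm (blockC_mul_blockD_transpose g)
  have h10 : τ 1 0 = τ 0 1 := hτ.apply 0 1
  simp only [adjugate_fin_two, Matrix.mul_apply, Fin.sum_univ_two] at hs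
  have hs' := congrArg (Int.cast : ℤ → ℂ) hs
  simp [pluckerForm, plucker, det_fin_two, adjugate_fin_two, Matrix.mul_apply,
    Fin.sum_univ_two, h10] at hs' ⊢
  linear_combination τ 0 1 * hs'

/-- For invertible D, a pair up to left multiplication is determined by D⁻¹ C; the adjugate avoids
inverses. -/
theorem mul_transpose_eq_of_adjugate_mul_eq {R : Type*} [CommRing R] [IsDomain R]
    {C D C' D' : Matrix (Fin 2) (Fin 2) R} (h' : C' * D'ᵀ = D' * C'ᵀ) (hD : D.det = D'.det)
    (h0 : D.det ≠ 0) (h : D.adjugate * C = D'.adjugate * C') : C * D'ᵀ = D * C'ᵀ := by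
  have e : D.det • (C * D'ᵀ) = D.det • (D * C'ᵀ) := by
    calc D.det • (C * D'ᵀ) = D * D.adjugate * (C * D'ᵀ) := by
          rw [mul_adjugate, Matrix.smul_mul, Matrix.one_mul]
      _ = D * (D.adjugate * C) * D'ᵀ := by simp only [Matrix.mul_assoc]
      _ = D * (D'.adjugate * (C' * D'ᵀ)) := by rw [h]; simp only [Matrix.mul_assoc]
      _ = D * (D'.adjugate * D' * C'ᵀ) := by rw [h', Matrix.mul_assoc]
      _ = _ := by rw [adjugate_mul, ← hD, Matrix.smul_mul, Matrix.one_mul, Matrix.mul_smul]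
  exact smul_right_injective _ h0 e

/-- Neither C nor D need be invertible, but Cτ + D is. Replacing D by Cτ + D does not affect the
condition for equality of cosets, and adj(Cτ + D) C is a function of the Plücker coordinates. -/
theorem coset_eq_of_plucker_eq {τ : Matrix (Fin 2) (Fin 2) ℂ} (hτ : τ.IsSymm) {g h : Sp2Z}
    (h0 : pluckerForm τ (fun i => (plucker h i : ℝ)) ≠ 0) (hgh : plucker g = plucker h) :
    (Quotient.mk'' g : CosetSpace) = Quotient.mk'' h := by
  rw [cosetSpace_eq_iff, mul_inv_mem_GammaInf]
  have hS : (blockD g).adjugate * blockC g = (blockD h).adjugate * blockC h := by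
    ext i j
    fin_cases i <;> fin_cases j
    · exact congrFun hgh 1
    · exact congrFun hgh 2
    · exact (adjugate_mul_apply_comm (blockC_mul_blockD_transpose g)).trans ((congrFun hgh 2).trans
        (adjugate_mul_apply_comm (blockC_mul_blockD_transpose h)).symm)
    · exact congrFun hgh 3
  have hC : (blockC g).det = (blockC h).det := congrFun hgh 0
  have hadj : ∀ C D : Matrix (Fin 2) (Fin 2) ℂ, (C * τ + D).adjugate * C =
      D.adjugate * C + C.det • τ.adjugate := by
    intro C D
    have e : (C * τ + D).adjugate = D.adjugate + τ.adjugate * C.adjugate := by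
      rw [← adjugate_mul_distrib]
      ext i j
      fin_cases i <;> fin_cases j <;> simp [adjugate_fin_two] <;> ring
    rw [e, Matrix.add_mul, Matrix.mul_assoc, adjugate_mul, Matrix.mul_smul, Matrix.mul_one]
  have hadj' : ∀ X : Matrix (Fin 2) (Fin 2) ℤ, X.adjugate.map (Int.cast : ℤ → ℂ) =
      (X.map (Int.cast : ℤ → ℂ)).adjugate := fun X => (Int.castRingHom ℂ).map_adjugate X
  have hsym : ∀ g : Sp2Z, (blockC g).map (Int.cast : ℤ → ℂ) * ((blockD g).map (Int.cast : ℤ → ℂ))ᵀ =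
      (blockD g).map (Int.cast : ℤ → ℂ) * ((blockC g).map (Int.cast : ℤ → ℂ))ᵀ := fun g => by
    rw [← transpose_map, ← transpose_map, ← map_cast_mul, ← map_cast_mul,
      blockC_mul_blockD_transpose]
  have key := mul_transpose_eq_of_adjugate_mul_eq
    (C := (blockC h).map (Int.cast : ℤ → ℂ))
    (D := (blockC h).map (Int.cast : ℤ → ℂ) * τ + (blockD h).map (Int.cast : ℤ → ℂ))
    (C' := (blockC g).map (Int.cast : ℤ → ℂ))
    (D' := (blockC g).map (Int.cast : ℤ → ℂ) * τ + (blockD g).map (Int.cast : ℤ → ℂ))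
    (by rw [transpose_add, transpose_mul, hτ.eq, Matrix.mul_add, Matrix.add_mul, hsym,
          Matrix.mul_assoc])
    (by rw [det_eq_pluckerForm hτ, det_eq_pluckerForm hτ, hgh])
    (by rw [det_eq_pluckerForm hτ]; exact h0)
    (by rw [hadj, hadj, ← hadj', ← hadj', ← map_cast_mul, ← map_cast_mul, hS, ← map_cast_det,
          ← map_cast_det, hC])
  rw [transpose_add, transpose_mul, hτ.eq, Matrix.mul_add, Matrix.add_mul, Matrix.mul_assoc,
    add_right_inj, ← transpose_map, ← transpose_map, ← map_cast_mul, ← map_cast_mul] at key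
  exact Matrix.map_injective Int.cast_injective key

/-- Translating by the real part of τ turns v₁, v₂, v₃ into the entries a, b, e of a symmetric
matrix. The equations say that a y₁ + 2 b y₂ + e y₃ = 0 and ae - b² = v₀² det y ≥ 0. A semidefinite
matrix pairing to zero with the definite y vanishes, which `i3` expresses as a sum of nonnegative
terms. -/
theorem pluckerForm_ne_zero {τ : Matrix (Fin 2) (Fin 2) ℂ} (hτ : τ ∈ upperHalfSpace)
    {v : Fin 5 → ℝ} (hv : v ≠ 0) (hq : v 0 * v 4 = v 1 * v 3 - v 2 ^ 2) : pluckerForm τ v ≠ 0 := by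
  intro h
  apply hv
  have h10 : τ 1 0 = τ 0 1 := hτ.1.apply 0 1
  have hy : 0 < (τ 0 0).im := hτ.2.diag_pos
  have hd : 0 < (τ 0 0).im * (τ 1 1).im - (τ 0 1).im ^ 2 := by
    have := hτ.2.det_pos
    rw [det_fin_two] at this
    simp only [Matrix.map_apply, h10] at this
    linarith
  have hre := congrArg Complex.re h
  have him := congrArg Complex.im h
  simp [pluckerForm, det_fin_two, h10] at hre him
  generalize (τ 0 0).re = x₁ at *
  generalize (τ 0 1).re = x₂ at *
  generalize (τ 1 1).re = x₃ at *
  generalize (τ 0 0).im = y₁ at *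
  generalize (τ 0 1).im = y₂ at *
  generalize (τ 1 1).im = y₃ at *
  obtain ⟨a, ha⟩ : ∃ a, a = v 1 + v 0 * x₃ := ⟨_, rfl⟩
  obtain ⟨b, hb⟩ : ∃ b, b = v 2 - v 0 * x₂ := ⟨_, rfl⟩
  obtain ⟨e, he⟩ : ∃ e, e = v 3 + v 0 * x₁ := ⟨_, rfl⟩
  have i1 : a * y₁ + 2 * b * y₂ + e * y₃ = 0 := by
    rw [ha, hb, he]; linear_combination him
  have i2 : a * e - b ^ 2 = v 0 ^ 2 * (y₁ * y₃ - y₂ ^ 2) := by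
    rw [ha, hb, he]; linear_combination v 0 * hre - hq
  have i3 : (v 0 * y₁) ^ 2 * (y₁ * y₃ - y₂ ^ 2) + (b * y₁ + e * y₂) ^ 2 +
      e ^ 2 * (y₁ * y₃ - y₂ ^ 2) = 0 := by
    linear_combination -y₁ ^ 2 * i2 + y₁ * e * i1
  have p1 : 0 ≤ (v 0 * y₁) ^ 2 * (y₁ * y₃ - y₂ ^ 2) := by positivity
  have p2 : 0 ≤ (b * y₁ + e * y₂) ^ 2 := sq_nonneg _
  have p3 : 0 ≤ e ^ 2 * (y₁ * y₃ - y₂ ^ 2) := by positivity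
  have q1 : v 0 = 0 := by
    have : (v 0 * y₁) ^ 2 * (y₁ * y₃ - y₂ ^ 2) = 0 := by linarith
    simpa [hy.ne', hd.ne'] using this
  have q3 : e = 0 := by
    have : e ^ 2 * (y₁ * y₃ - y₂ ^ 2) = 0 := by linarith
    simpa [hd.ne'] using this
  have q2 : b = 0 := by
    have : (b * y₁ + e * y₂) ^ 2 = 0 := by linarith
    simpa [q3, hy.ne'] using this
  have q4 : a = 0 := by simpa [q3, q2, hy.ne'] using i1
  rw [q1, zero_mul, add_zero] at ha he
  rw [q1, zero_mul, sub_zero] at hb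
  have r1 : v 1 = 0 := ha.symm.trans q4
  have r2 : v 2 = 0 := hb.symm.trans q2
  have r3 : v 3 = 0 := he.symm.trans q3
  have r4 : v 4 = 0 := by simpa [q1, r1, r2, r3] using hre
  funext i
  fin_cases i
  · exact q1
  · exact r1
  · exact r2
  · exact r3
  · exact r4

theorem continuous_pluckerForm (τ : Matrix (Fin 2) (Fin 2) ℂ) : Continuous (pluckerForm τ) := by
  unfold pluckerForm
  fun_prop

/-- The quadric meets the unit sphere in a compact set on which the form has no zero; form and
quadric are homogeneous. -/
theorem exists_mul_norm_le_norm_pluckerForm {τ : Matrix (Fin 2) (Fin 2) ℂ}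
    (hτ : τ ∈ upperHalfSpace) : ∃ κ : ℝ, 0 < κ ∧ ∀ v : Fin 5 → ℝ, v 0 * v 4 = v 1 * v 3 - v 2 ^ 2 →
      κ * ‖v‖ ≤ ‖pluckerForm τ v‖ := by
  obtain ⟨K, hK⟩ : ∃ K : Set (Fin 5 → ℝ), K = Metric.sphere 0 1 ∩
    {v | v 0 * v 4 = v 1 * v 3 - v 2 ^ 2} := ⟨_, rfl⟩
  have hKc : IsCompact K := by
    rw [hK]
    exact (isCompact_sphere _ _).inter_right (isClosed_eq (by fun_prop) (by fun_prop))
  obtain ⟨κ, hκ, hle⟩ := hKc.exists_forall_le' (f := fun v => ‖pluckerForm τ v‖) (a := 0)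
    (continuous_pluckerForm τ).norm.continuousOn (fun v hv => by
      rw [hK] at hv
      refine norm_pos_iff.2 (pluckerForm_ne_zero hτ ?_ hv.2)
      rintro rfl
      simpa using hv.1)
  refine ⟨κ, hκ, fun v hq => ?_⟩
  by_cases hv : v = 0
  · rw [hv, norm_zero, mul_zero]
    exact norm_nonneg _
  · have hn : 0 < ‖v‖ := norm_pos_iff.2 hv
    have h := hle (‖v‖⁻¹ • v) (by
      rw [hK]
      refine ⟨by rw [mem_sphere_zero_iff_norm, norm_smul, norm_inv, norm_norm,
        inv_mul_cancel₀ hn.ne'], ?_⟩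
      simp only [Set.mem_ofPred_eq, Pi.smul_apply, smul_eq_mul]
      linear_combination ‖v‖⁻¹ ^ 2 * hq)
    have e : pluckerForm τ (‖v‖⁻¹ • v) = (‖v‖⁻¹ : ℝ) * pluckerForm τ v := by
      simp only [pluckerForm, Pi.smul_apply, smul_eq_mul, Complex.ofReal_mul]
      ring
    rw [e, norm_mul, Complex.norm_real, norm_inv, norm_norm, inv_mul_eq_div, le_div_iff₀ hn] at h
    exact h

/-- Absolute convergence of the Eisenstein series of weight at least four. -/
theorem summable_oneSlash {k : ℕ} (hk : 4 ≤ k) {τ : Matrix (Fin 2) (Fin 2) ℂ}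
    (hτ : τ ∈ upperHalfSpace) : Summable fun c : CosetSpace => oneSlash k c.out τ := by
  obtain ⟨κ, hκ, hle⟩ := exists_mul_norm_le_norm_pluckerForm hτ
  have hq : ∀ g : Sp2Z, (plucker g 0 : ℝ) * plucker g 4 =
      plucker g 1 * plucker g 3 - (plucker g 2 : ℝ) ^ 2 := fun g => by
    exact_mod_cast (plucker_mem g).2
  have h0 : ∀ g : Sp2Z, pluckerForm τ (fun i => (plucker g i : ℝ)) ≠ 0 := fun g =>
    pluckerForm_ne_zero hτ (fun h => (plucker_mem g).1 (funext fun i =>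
      Int.cast_injective (α := ℝ) ((congrFun h i).trans Int.cast_zero.symm))) (hq g)
  have hinj : Function.Injective fun c : CosetSpace =>
      (⟨plucker c.out, plucker_mem c.out⟩ : quadricPoints) := fun c d h => by
    rw [← Quotient.out_eq' c, ← Quotient.out_eq' d]
    exact coset_eq_of_plucker_eq hτ.1 (h0 _) (congrArg Subtype.val h)
  refine Summable.of_norm_bounded
    ((summable_l1Norm.comp_injective hinj).mul_left (((κ / 5) ^ k)⁻¹)) fun c => ?_
  have hM : (1 : ℝ) ≤ l1Norm (plucker c.out) := by
    exact_mod_cast one_le_l1Norm (plucker_mem c.out).1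
  have hl : (l1Norm (plucker c.out) : ℝ) ≤ 5 * ‖fun i => (plucker c.out i : ℝ)‖ := by
    rw [l1Norm]
    push_cast
    refine (Finset.sum_le_card_nsmul _ _ _ fun i _ =>
      norm_le_pi_norm (fun i => (plucker c.out i : ℝ)) i).trans_eq ?_
    simp
  -- The 5 compares the ℓ¹-norm with the sup norm on five coordinates. As the ℓ¹-norm is at least 1,
  -- its k-th power dominates its fourth.
  have h1 : κ / 5 * l1Norm (plucker c.out) ≤ ‖pluckerForm τ (fun i => (plucker c.out i : ℝ))‖ :=
    le_trans (by nlinarith) (hle _ (hq c.out))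
  rw [oneSlash, det_eq_pluckerForm hτ.1, norm_inv, norm_pow, Function.comp_apply, ← mul_inv]
  refine inv_anti₀ (by positivity) (le_trans ?_ (pow_le_pow_left₀ (by positivity) h1 k))
  rw [mul_pow]
  gcongr

end SiegelEisenstein

theorem proposition5p2
    (k : ℕ) (hk : 4 ≤ k)
    (N : ℕ) (hNodd : Odd N) (hNsq : Squarefree N)
    (χ : DirichletCharacter ℂ N) (hχ : χ ^ 2 = 1) (hχk : χ (-1) = (-1) ^ k)
    (q : ℕ) [Fact q.Prime] (hqN : q ∣ N)
    (N₀ N₁ N₂ : ℕ) (hσ : N₀ * N₁ * N₂ = N / q)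
    (ω : ℤ) (hω : legendreSym q ω = -1)
    -- diagonal matrices for the three series of level `N`
    (m₀ m₁ m₂ : Fin 2 → ℤ)
    (hm₀ : IsTypeMatrix (q * N₀) N₁ N₂ m₀)
    (hm₁ : IsTypeMatrix N₀ (q * N₁) N₂ m₁)
    (hm₂ : IsTypeMatrix N₀ N₁ (q * N₂) m₂)
    -- diagonal matrices for the series of level `q * N`
    (m₀₀ m₀₁p m₀₁m m₁₁ m₁₂p m₁₂m : Fin 2 → ℤ) (m₀₂ : (ZMod q)ˣ → Fin 2 → ℤ)
    (hm₀₀ : IsTypeMatrix N₀ N₁ N₂ m₀₀ ∧ DiagModEq (q ^ 2) m₀₀ ![0, 0])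
    (hm₀₁p : IsTypeMatrix N₀ N₁ N₂ m₀₁p ∧ DiagModEq (q ^ 2) m₀₁p ![(q : ℤ), 0])
    (hm₀₁m : IsTypeMatrix N₀ N₁ N₂ m₀₁m ∧ DiagModEq (q ^ 2) m₀₁m ![(q : ℤ) * ω, 0])
    (hm₀₂ : ∀ α : (ZMod q)ˣ, IsTypeMatrix N₀ N₁ N₂ (m₀₂ α) ∧
      DiagModEq (q ^ 2) (m₀₂ α) ![(q : ℤ), (q : ℤ) * ((α : ZMod q).val : ℤ)])
    (hm₁₁ : IsTypeMatrix N₀ N₁ N₂ m₁₁ ∧ DiagModEq (q ^ 2) m₁₁ ![1, 0])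
    (hm₁₂p : IsTypeMatrix N₀ N₁ N₂ m₁₂p ∧ DiagModEq (q ^ 2) m₁₂p ![1, (q : ℤ)])
    (hm₁₂m : IsTypeMatrix N₀ N₁ N₂ m₁₂m ∧ DiagModEq (q ^ 2) m₁₂m ![1, (q : ℤ) * ω]) :
    let χq := component χ q
    let c₁ : ℂ := component χ N₁ (q : ZMod N₁)
    let c₀₂ : ℂ := component χ (N₀ * N₂) (q : ZMod (N₀ * N₂))
    let r : ℂ := (q : ℂ)⁻¹ ^ k
    let E₀ := siegelEisenstein k χ N (lowerUnipotent m₀)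
    let E₁ := siegelEisenstein k χ N (lowerUnipotent m₁)
    let E₂ := siegelEisenstein k χ N (lowerUnipotent m₂)
    let E₀₀ := siegelEisenstein k χ (q * N) (lowerUnipotent m₀₀)
    let E₀₁p := siegelEisenstein k χ (q * N) (lowerUnipotent m₀₁p)
    let E₀₁m := siegelEisenstein k χ (q * N) (lowerUnipotent m₀₁m)
    let E₀₂p := ∑ α ∈ Finset.univ.filter (fun α : (ZMod q)ˣ => quadraticChar (ZMod q) (α : ZMod q) = 1),
      siegelEisenstein k χ (q * N) (lowerUnipotent (m₀₂ α))
    let E₀₂m := ∑ α ∈ Finset.univ.filter (fun α : (ZMod q)ˣ => quadraticChar (ZMod q) (α : ZMod q) = -1),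
      siegelEisenstein k χ (q * N) (lowerUnipotent (m₀₂ α))
    let E₁₁ := siegelEisenstein k χ (q * N) (lowerUnipotent m₁₁)
    let E₁₂p := siegelEisenstein k χ (q * N) (lowerUnipotent m₁₂p)
    let E₁₂m := siegelEisenstein k χ (q * N) (lowerUnipotent m₁₂m)
    -- the series converge absolutely
    (∀ n ∈ ({N, q * N} : Set ℕ), ∀ γ₀ : Sp2Z, ∀ τ ∈ upperHalfSpace,
      Summable (cosetSummand k χ n γ₀ τ)) ∧
    (χq ≠ 1 → ∀ τ ∈ upperHalfSpace,
      shift q E₀ τ = c₁ * E₀₀ τ ∧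
      shift q E₁ τ = c₀₂ * r * E₁₁ τ + c₁ * (E₀₁p τ - E₀₁m τ) ∧
      shift q E₂ τ = c₁ * r ^ 2 * E₂ τ + c₀₂ * r * (E₁₂p τ - E₁₂m τ)
        + c₁ * (E₀₂p τ - E₀₂m τ)) ∧
    (χq = 1 → ∀ τ ∈ upperHalfSpace,
      shift q E₀ τ = c₁ * E₀₀ τ ∧
      shift q E₁ τ = c₀₂ * r * E₁₁ τ + c₁ * (E₀₁p τ + E₀₁m τ) ∧
      shift q E₂ τ = c₁ * r ^ 2 * E₂ τ + c₀₂ * r * (E₁₂p τ + E₁₂m τ)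
        + c₁ * (E₀₂p τ + E₀₂m τ)) := by
  have hqp : q.Prime := Fact.out
  have hqN' : q * (N₀ * N₁ * N₂) = N := by rw [hσ, Nat.mul_div_cancel' hqN]
  have hq : Odd q := hNodd.of_dvd_nat hqN
  have hNn : N ∣ q * N := dvd_mul_left N q
  have hψ : component χ q ^ 2 = 1 :=
    component_sq hqN' hNsq.ne_zero (Nat.coprime_of_squarefree_mul (hqN' ▸ hNsq)) hχ
  obtain ⟨hε₁, hε₂⟩ := char_nonresidue hψ hω
  have key : ∀ τ ∈ upperHalfSpace,
      shift q (siegelEisenstein k χ N (lowerUnipotent m₀)) τ =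
        component χ N₁ (q : ZMod N₁) * siegelEisenstein k χ (q * N) (lowerUnipotent m₀₀) τ ∧
      shift q (siegelEisenstein k χ N (lowerUnipotent m₁)) τ =
        component χ (N₀ * N₂) (q : ZMod (N₀ * N₂)) * (q : ℂ)⁻¹ ^ k *
          siegelEisenstein k χ (q * N) (lowerUnipotent m₁₁) τ +
        component χ N₁ (q : ZMod N₁) * (siegelEisenstein k χ (q * N) (lowerUnipotent m₀₁p) τ +
          component χ q (ω : ZMod q) * siegelEisenstein k χ (q * N) (lowerUnipotent m₀₁m) τ) ∧
      shift q (siegelEisenstein k χ N (lowerUnipotent m₂)) τ =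
        component χ N₁ (q : ZMod N₁) * ((q : ℂ)⁻¹ ^ k) ^ 2 *
          siegelEisenstein k χ N (lowerUnipotent m₂) τ +
        component χ (N₀ * N₂) (q : ZMod (N₀ * N₂)) * (q : ℂ)⁻¹ ^ k *
          (siegelEisenstein k χ (q * N) (lowerUnipotent m₁₂p) τ +
            component χ q (ω : ZMod q) * siegelEisenstein k χ (q * N) (lowerUnipotent m₁₂m) τ) +
        component χ N₁ (q : ZMod N₁) * ∑ α : (ZMod q)ˣ, component χ q (α : ZMod q) *
          siegelEisenstein k χ (q * N) (lowerUnipotent (m₀₂ α)) τ := by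
    -- Placing q in one of the three factors of the type encodes both the type away from q and the
    -- residue modulo q; the two are separated here.
    exact fun τ hτ => shift_siegelEisenstein hq hNsq hχ hχk hqN' hω
      ⟨fun p hp => ⟨fun h => (hm₀ p hp).1 (h.mul_left q), (hm₀ p hp).2⟩,
        (hm₀ q hqp).1 (dvd_mul_right q N₀)⟩
      ⟨fun p hp => ⟨(hm₁ p hp).1, fun h => (hm₁ p hp).2.1 (h.mul_left q), (hm₁ p hp).2.2⟩,
        (hm₁ q hqp).2.1 (dvd_mul_right q N₁)⟩
      ⟨fun p hp => ⟨(hm₂ p hp).1, (hm₂ p hp).2.1, fun h => (hm₂ p hp).2.2 (h.mul_left q)⟩,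
        (hm₂ q hqp).2.2 (dvd_mul_right q N₂)⟩ hm₀₀ hm₀₁p hm₀₁m hm₀₂ hm₁₁ hm₁₂p hm₁₂m
      (summable_oneSlash hk hτ)
  refine ⟨fun n _ γ₀ τ hτ => summable_cosetSummand (summable_oneSlash hk hτ) γ₀, fun h τ hτ => ?_,
    fun h τ hτ => ?_⟩
  · obtain ⟨h1, h2, h3⟩ := key τ hτ
    -- The sum weighted by χ_q(α) becomes the residue part plus χ_q(ω) times the nonresidue part,
    -- with χ_q(ω) = -1 here and 1 in the other case.
    rw [char_sum hψ hω] at h3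
    rw [hε₂ h] at h2 h3
    refine ⟨h1, h2.trans (by ring), h3.trans ?_⟩
    rw [Finset.sum_apply, Finset.sum_apply]
    ring
  · obtain ⟨h1, h2, h3⟩ := key τ hτ
    rw [char_sum hψ hω] at h3
    rw [hε₁ h] at h2 h3
    refine ⟨h1, h2.trans (by ring), h3.trans ?_⟩
    rw [Finset.sum_apply, Finset.sum_apply]
    ring
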